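/- **Setting.** Let $a\in(0,1]$ and let $\mathcal M=\{x\in\mathbb R^3:|x|\ge a\}$, with boundary $\Sigma=\{|x|=a\}$ and compact core $K=\{a\le|x|\le1\}$, so that the identity on $\{|x|>1\}$ is the asymptotic chart. Let $\mathring g$ be a Riemannian metric on $\mathcal M$, smooth up to the boundary, with $\mathring g=\delta$ for $|x|>1$, and let $r$ be a smooth function on $\mathcal M$ with $r=|x|$ for $|x|>1$ and $\frac12\le r\le2$ on $K$. For $1\le p<\infty$ put $$\|u\|_{p,\delta}=\Big(\int_{\mathcal M}|u|^pr^{-\delta p-3}\,dx\Big)^{1/p},\qquad \|u\|_{k,p,\delta}=\sum_{j=0}^k\|\partial^ju\|_{p,\delta-j}.$$ Let $L^p_\delta$ be the space of measurable $u$ with $\|u\|_{p,\delta}<\infty$. Let $\overline H^k_\delta$ (resp. $H^k_\delta$) be the completion, in the norm $\|\cdot\|_{k,2,\delta}$, of the smooth functions with compact support in $\mathcal M\setminus\Sigma$ (resp. of the smooth functions with bounded support on $\mathcal M$). For tensors and densities these spaces are taken componentwise. Let $$\mathcal G=\{g \text{ symmetric covariant 2-tensor}:\ g>0,\ g-\mathring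 g\in\overline H^2_{-1/2}\},$$ $$\mathcal K=\{\pi \text{ symmetric contravariant 2-tensor density}:\ \pi-\mathring\pi\in\overline H^1_{-3/2}\},$$ where $\mathring\pi$ is a fixed symmetric contravariant 2-tensor density in $H^1_{-3/2}$ with bounded support. The ADM energy $E$ of a metric $g$ is defined by $$16\pi E=\oint_\infty\mathring g^{ik}\big(\mathring\nabla_kg_{ij}-\mathring\nabla_jg_{ik}\big)\,dS^j=\lim_{R\to\infty}\oint_{|x|=R}\mathring g^{ik}\big(\mathring\nabla_kg_{ij}-\mathring\nabla_jg_{ik}\big)\,dS^j .$$ **Proposition.** Fix $\tilde g\in\mathcal G$ whose scalar curvature $\tilde R$ satisfies $\tilde R\sqrt{\tilde g}\in L^1(\mathcal M)$. Let $\phi\in\overline H^2_{-1/2}$, $\pi\in\mathcal K$ and $\rho\in L^1_{-3}$ (a scalar density, so that $\int_{\mathcal M}|\rho|<\infty$), and suppose that, almost everywhere on $\mathcal M$, $$\hat\Phi_0(\phi,\pi):=e^{2\phi}\Big[\big(\tilde R-8|\tilde\nabla\phi|^2-8\tilde\Delta\phi\big)\sqrt{\tilde g}-\big(\pi^{ij}\pi_{ij}-\tfrac12(\pi^k_k)^2\big)/\sqrt{\tilde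 g}\Big]=16\pi\rho ,$$ where indices are lowered with $\tilde g$, and $|\tilde\nabla\phi|^2$ and $\tilde\Delta$ are taken with respect to $\tilde g$. Then the ADM energies $E$ of $g=e^{4\phi}\tilde g$ and $\tilde E$ of $\tilde g$ exist (the limits converge to finite values), the integrand below is in $L^1(\mathcal M)$, and $$16\pi E=16\pi\tilde E+\int_{\mathcal M}\Big(\big(8|\tilde\nabla\phi|^2-\tilde R\big)\sqrt{\tilde g}+\big(\pi^{ij}\pi_{ij}-\tfrac12(\pi^k_k)^2\big)/\sqrt{\tilde g}+16\pi e^{-2\phi}\rho\Big).$$ -/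

import Mathlib

open MeasureTheory Filter Topology
open scoped ContDiff

namespace ConformalEnergy

noncomputable section

/-- Three-dimensional Euclidean space. The manifold is described in global coordinates on it. -/
abbrev E3 : Type := EuclideanSpace ℝ (Fin 3)

/-- A tensor field (or tensor density) with two indices, given by its components in the
Cartesian coordinates of `E3`. -/
abbrev Field2 : Type := E3 → Matrix (Fin 3) (Fin 3) ℝ

/-- The classical partial derivative `∂ᵢ u`. -/
def partialD (i : Fin 3) (u : E3 → ℝ) : E3 → ℝ :=
  fun x => fderiv ℝ u x (EuclideanSpace.single i 1)

/-- Iterated classical partial derivatives `∂_{i₁} ⋯ ∂_{iₘ} u` along a list of indices. -/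
def iterPartialD : List (Fin 3) → (E3 → ℝ) → E3 → ℝ
  | [], u => u
  | i :: l, u => partialD i (iterPartialD l u)

/-- The manifold with its asymptotically flat background, in coordinates.
The manifold is `M = {‖x‖ ≥ a}`, diffeomorphic to the complement of a ball, with boundary
`Σ = {‖x‖ = a}`. Its asymptotic chart is the identity on `{‖x‖ > 1}`, the complement of the compact
set `K = {a ≤ ‖x‖ ≤ 1}`. The background metric `og` is smooth up to the boundary, positive definite
and Euclidean outside `K`. The function `r` is smooth, equal to the Euclidean radius outside `K`,
and lies between `1/2` and `2` on `K`. -/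
structure Background where
  a : ℝ
  a_pos : 0 < a
  a_le_one : a ≤ 1
  og : Field2
  og_smooth : ∀ i j, ContDiffOn ℝ ∞ (fun x => og x i j) {x : E3 | a ≤ ‖x‖}
  og_posDef : ∀ x : E3, a ≤ ‖x‖ → (og x).PosDef
  og_end : ∀ x : E3, 1 < ‖x‖ → og x = 1
  r : E3 → ℝ
  r_smooth : ContDiffOn ℝ ∞ r {x : E3 | a ≤ ‖x‖}
  r_end : ∀ x : E3, 1 < ‖x‖ → r x = ‖x‖
  r_core : ∀ x : E3, a ≤ ‖x‖ → ‖x‖ ≤ 1 → 1 / 2 ≤ r x ∧ r x ≤ 2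

namespace Background

variable (B : Background)

/-- The manifold with boundary `M`. -/
def M : Set E3 := {x | B.a ≤ ‖x‖}

/-- The interior `M \ Σ`. The boundary is a null set, so integrals over `M` are integrals over it. -/
def U : Set E3 := {x | B.a < ‖x‖}

/-- Smooth functions with compact support in `M \ Σ`. -/
def testFunctions : Set (E3 → ℝ) :=
  {ψ | ContDiff ℝ ∞ ψ ∧ HasCompactSupport ψ ∧ tsupport ψ ⊆ B.U}

/-- The weighted norm `‖u‖_{p,δ} = (∫_M |u|^p r^{-δp-3})^{1/p}`, for `1 ≤ p < ∞`. Since `og` is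
Euclidean outside a compact set and smooth and positive definite up to the boundary, its volume
measure and Lebesgue measure are comparable, and give the same spaces. -/
def wNorm (p δ : ℝ) (u : E3 → ℝ) : ENNReal :=
  (∫⁻ x in B.U, ENNReal.ofReal (|u x| ^ p * B.r x ^ (-δ * p - 3))) ^ (1 / p)

/-- The weighted Lebesgue space `L^p_δ`. -/
def MemL (p δ : ℝ) (u : E3 → ℝ) : Prop :=
  AEStronglyMeasurable u (volume.restrict B.U) ∧ B.wNorm p δ u < ⊤

/-- `u` belongs to the completion of the class `T` of smooth functions in the weighted Sobolev norm
`∑_{j ≤ k} ‖∇^j u‖_{p,δ-j}`: there are `ψₙ ∈ T` which converge to `u` in `L^p_δ`, and all of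
whose derivatives `∂_l ψₙ` of order `|l| ≤ k` converge in `L^p_{δ-|l|}`, to limits `D l`. -/
def MemCompletion (T : Set (E3 → ℝ)) (k : ℕ) (p δ : ℝ) (u : E3 → ℝ) : Prop :=
  ∃ D : List (Fin 3) → E3 → ℝ, D [] =ᵐ[volume.restrict B.U] u ∧
    (∀ l : List (Fin 3), l.length ≤ k → AEStronglyMeasurable (D l) (volume.restrict B.U)) ∧
    ∃ ψ : ℕ → E3 → ℝ, (∀ n, ψ n ∈ T) ∧
      ∀ l : List (Fin 3), l.length ≤ k →
        Tendsto (fun n => B.wNorm p (δ - l.length) (fun x => D l x - iterPartialD l (ψ n) x))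
          atTop (𝓝 0)

/-- The barred space `W̄^{k,p}_δ`, the completion of the smooth functions with compact support in
`M \ Σ`. `H̄^k_δ` is the case `p = 2`. -/
def MemWbar (k : ℕ) (p δ : ℝ) (u : E3 → ℝ) : Prop :=
  B.MemCompletion B.testFunctions k p δ u

/-- The space `W^{k,p}_δ`, the completion of the smooth functions with bounded support on `M`
(restrictions to `M` of smooth functions with compact support on the ambient space). -/
def MemW (k : ℕ) (p δ : ℝ) (u : E3 → ℝ) : Prop :=
  B.MemCompletion {ψ | ContDiff ℝ ∞ ψ ∧ HasCompactSupport ψ} k p δ u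

/-- `v` is the weak partial derivative `∂ᵢ u` on `M \ Σ`. -/
def HasWeakPartial (i : Fin 3) (u v : E3 → ℝ) : Prop :=
  LocallyIntegrableOn u B.U ∧ LocallyIntegrableOn v B.U ∧
    ∀ ψ ∈ B.testFunctions, ∫ x in B.U, u x * partialD i ψ x = - ∫ x in B.U, v x * ψ x

open Classical in
/-- A representative of the weak partial derivative `∂ᵢ u` (unique up to null sets), or `0` if there
is none. -/
def wd (i : Fin 3) (u : E3 → ℝ) : E3 → ℝ :=
  if h : ∃ v, B.HasWeakPartial i u v then h.choose else 0

/-- The space of metrics `𝒢 = {g > 0 : g - og ∈ H̄²_{-1/2}}`. Such metrics are continuous up to the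
boundary, and `g` stands for the continuous representative. -/
def MemG (g : Field2) : Prop :=
  (∀ i j, ContinuousOn (fun x => g x i j) B.M) ∧
  (∀ x ∈ B.M, (g x).PosDef) ∧
  ∀ i j, B.MemWbar 2 2 (-1 / 2) (fun x => g x i j - B.og x i j)

/-- The reference momentum: a symmetric contravariant 2-tensor density of class `H¹_{-3/2}` with
bounded support. -/
def IsMomentumReference (opi : Field2) : Prop :=
  (∀ᵐ x ∂volume.restrict B.U, (opi x).IsSymm) ∧
  (∃ R₀ : ℝ, ∀ x : E3, R₀ < ‖x‖ → opi x = 0) ∧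
  ∀ i j, B.MemW 1 2 (-3 / 2) (fun x => opi x i j)

/-- The space of momenta `𝒦 = {π : π - opi ∈ H̄¹_{-3/2}}` of symmetric contravariant 2-tensor
densities. -/
def MemK (opi π : Field2) : Prop :=
  (∀ᵐ x ∂volume.restrict B.U, (π x).IsSymm) ∧
  ∀ i j, B.MemWbar 1 2 (-3 / 2) (fun x => π x i j - opi x i j)

/-- The Christoffel symbols `Γ^k_{ij} = ½ g^{kl} (∂_i g_{jl} + ∂_j g_{il} - ∂_l g_{ij})`. -/
def christoffel (g : Field2) (k i j : Fin 3) : E3 → ℝ := fun x =>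
  (1 / 2) * ∑ l, (g x)⁻¹ k l *
    (B.wd i (fun y => g y j l) x + B.wd j (fun y => g y i l) x - B.wd l (fun y => g y i j) x)

/-- The scalar curvature
`R = g^{ij} (∂_k Γ^k_{ij} - ∂_j Γ^k_{ik} + Γ^k_{kl} Γ^l_{ij} - Γ^k_{jl} Γ^l_{ik})`. -/
def scalarCurvature (g : Field2) : E3 → ℝ := fun x =>
  ∑ i, ∑ j, (g x)⁻¹ i j * ∑ k,
    (B.wd k (B.christoffel g k i j) x - B.wd j (B.christoffel g k i k) x +
      ∑ l, (B.christoffel g k k l x * B.christoffel g l i j x -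
        B.christoffel g k j l x * B.christoffel g l i k x))

/-- `|∇φ|² = g^{ij} ∂_i φ ∂_j φ`. -/
def gradSq (g : Field2) (φ : E3 → ℝ) : E3 → ℝ := fun x =>
  ∑ i, ∑ j, (g x)⁻¹ i j * B.wd i φ x * B.wd j φ x

/-- The Laplacian `Δφ = g^{ij} ∇_i ∇_j φ = g^{ij} (∂_i ∂_j φ - Γ^k_{ij} ∂_k φ)`. -/
def laplacian (g : Field2) (φ : E3 → ℝ) : E3 → ℝ := fun x =>
  ∑ i, ∑ j, (g x)⁻¹ i j *
    (B.wd i (B.wd j φ) x - ∑ k, B.christoffel g k i j x * B.wd k φ x)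

end Background

/-- The volume density `√g = √(det g)`. -/
def sqrtDet (g : Field2) : E3 → ℝ := fun x => Real.sqrt (g x).det

/-- `π^{ij} π_{ij} = g_{ik} g_{jl} π^{ij} π^{kl}`, indices lowered with `g`. -/
def momentumSq (g π : Field2) : E3 → ℝ := fun x =>
  ∑ i, ∑ j, ∑ k, ∑ l, g x i k * g x j l * π x i j * π x k l

/-- The trace `π^k_k = g_{ij} π^{ij}`. -/
def momentumTrace (g π : Field2) : E3 → ℝ := fun x => ∑ i, ∑ j, g x i j * π x i j

/-- The conformal metric `e^{4φ} g`. -/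
def conformalMetric (φ : E3 → ℝ) (g : Field2) : Field2 := fun x => Real.exp (4 * φ x) • g x

namespace Background

variable (B : Background)

/-- The conformal Hamiltonian constraint map (the coefficient of a density)
`Φ̂₀(φ,π) = e^{2φ} [(R - 8|∇φ|² - 8Δφ) √g - (π^{ij} π_{ij} - ½ (π^k_k)²) / √g]`,
for the fixed metric `g`. -/
def conformalHamiltonian (g : Field2) (φ : E3 → ℝ) (π : Field2) : E3 → ℝ := fun x =>
  Real.exp (2 * φ x) *
    ((B.scalarCurvature g x - 8 * B.gradSq g φ x - 8 * B.laplacian g φ x) * sqrtDet g x -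
      (momentumSq g π x - 1 / 2 * momentumTrace g π x ^ 2) / sqrtDet g x)

/-- The density `og^{ik} (∇°_k g_{ij} - ∇°_j g_{ik}) ν^j` of the energy flux through the coordinate
spheres in the asymptotic end, where `og` is Euclidean and `ν = x / ‖x‖`. -/
def fluxDensity (g : Field2) : E3 → ℝ := fun x =>
  ∑ i, ∑ j, (B.wd i (fun y => g y i j) x - B.wd j (fun y => g y i i) x) * (x j / ‖x‖)

/-- `E` is the ADM energy of `g`: `16πE` is the limit as `R → ∞` of the integral of the flux density
over the sphere `S_R` (the integral over `S_R` is `R²` times that over the unit sphere, with its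
surface measure). The derivatives of `g` are Sobolev functions, whose trace on `S_R` agrees with
their restriction for almost every `R`, so the limit is taken along almost every `R`; as the
integrals of the traces depend continuously on `R`, that is the limit of these. -/
def HasADMEnergy (g : Field2) (E : ℝ) : Prop :=
  (∀ᵐ R : ℝ, 1 < R → Integrable
    (fun w : Metric.sphere (0 : E3) 1 => B.fluxDensity g (R • (w : E3)))
    (volume : Measure E3).toSphere) ∧
  Tendsto
    (fun R : ℝ => R ^ 2 * ∫ w : Metric.sphere (0 : E3) 1, B.fluxDensity g (R • (w : E3))
      ∂(volume : Measure E3).toSphere)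
    (atTop ⊓ ae volume) (𝓝 (16 * Real.pi * E))

/-- The integrand of the volume integral in the energy formula,
`(8|∇φ|² - R) √g + (π^{ij} π_{ij} - ½ (π^k_k)²) / √g + 16π e^{-2φ} ρ`. -/
def energyIntegrand (g : Field2) (φ : E3 → ℝ) (π : Field2) (ρ : E3 → ℝ) : E3 → ℝ := fun x =>
  (8 * B.gradSq g φ x - B.scalarCurvature g x) * sqrtDet g x +
    (momentumSq g π x - 1 / 2 * momentumTrace g π x ^ 2) / sqrtDet g x +
    16 * Real.pi * Real.exp (-2 * φ x) * ρ x

end Background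

end

end ConformalEnergy

/-! At infinity `e^{4φ}` tends to 1 and `g` to the Euclidean metric, so passing from `g` to `e^{4φ}
g` changes the field `∂_i g_{ij} - ∂_j g_{ii}` by `4 ∂_j φ - 12 ∂_j φ = -8 ∂_j φ`, up to errors
without flux at infinity (`hasFlux_conformal`). By the divergence theorem the flux of the gradient
is the integral of `√g Δφ`; the boundary `Σ` does not contribute, because `φ` is a limit of
functions supported in the interior (`Coef.integral_mul_wd`, `hasFlux_gradient`). The constraint,
multiplied by `e^{-2φ}`, says that the integrand of the formula is `-8 √g Δφ`
(`energyIntegrand_eq_of_constraint`), and the formula follows.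

Convergence is a count of weights. For `φ` and for `g` minus the background, `u / r`, `∂u` and `r
∂²u` are square integrable, and the momentum is square integrable. So a product of two first
derivatives, or of a decaying coefficient and a second derivative, is integrable. This covers the
terms of the integrand that are not integrable by assumption. It also shows that the divergence of
the energy field differs from `R √g` by an integrable function (`integrable_div_energyFlux`), so the
energy of `g` exists. The function `√g Δφ` has leading coefficients that do not decay; its
integrability comes from the constraint.

The errors are products `c b` with `c / r`, `∂c`, `b` and `r ∂b` square integrable. Their divergence
is integrable, so the flux has a limit; `c b / r` is integrable while `1 / R` is not, so the limit
is zero (`HasFlux.eq_zero`, `Coef.hasFlux_zero`).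

All derivatives are weak. The divergence theorem on balls holds for almost every radius and is
obtained by testing with radial functions (`sphereFlux_ae_eq`). Nonlinear expressions in `g` and `φ`
are differentiated through the class `Coef`, which is closed under products and smooth functions;
`H̄²_{-1/2}` lies in it by a Sobolev inequality (`sobolev_inequality`, `H2Approx.tendstoUnif`). -/

namespace ConformalEnergy

/-! ### Weighted `L²` spaces on the manifold. -/

namespace Background

variable (B : Background)

/-- Lebesgue measure on the interior of the manifold. -/
noncomputable abbrev vol : Measure E3 := volume.restrict B.U

lemma isOpen_U : IsOpen B.U := isOpen_lt continuous_const continuous_norm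

lemma measurableSet_U : MeasurableSet B.U := B.isOpen_U.measurableSet

lemma isClosed_M : IsClosed B.M := isClosed_le continuous_const continuous_norm

lemma U_subset_M : B.U ⊆ B.M := fun _ hx => le_of_lt (Set.mem_ofPred_eq ▸ hx)

lemma mem_U_of_one_lt {x : E3} (hx : 1 < ‖x‖) : x ∈ B.U := lt_of_le_of_lt B.a_le_one hx

lemma half_le_r {x : E3} (hx : x ∈ B.M) : 1 / 2 ≤ B.r x := by
  by_cases h : 1 < ‖x‖
  · rw [B.r_end x h]; linarith
  · exact (B.r_core x hx (not_lt.1 h)).1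

lemma r_pos {x : E3} (hx : x ∈ B.M) : 0 < B.r x := lt_of_lt_of_le (by norm_num) (B.half_le_r hx)

lemma continuousOn_r_rpow (s : ℝ) : ContinuousOn (fun x => B.r x ^ s) B.M :=
  B.r_smooth.continuousOn.rpow_const fun _ hx => Or.inl (B.r_pos hx).ne'

lemma aestronglyMeasurable_r_rpow (s : ℝ) : AEStronglyMeasurable (fun x => B.r x ^ s) B.vol :=
  ((B.continuousOn_r_rpow s).mono B.U_subset_M).aestronglyMeasurable B.measurableSet_U

lemma ae_mem_U : ∀ᵐ x ∂B.vol, x ∈ B.U := ae_restrict_mem B.measurableSet_U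

/-- Functions `u` on the manifold with `r ^ s u` square integrable. -/
def L2w (s : ℝ) (u : E3 → ℝ) : Prop := MemLp (fun x => B.r x ^ s * u x) 2 B.vol

/-- Convergence `u n → u` with respect to the norm of `r ^ s u` in `L²`. -/
def TendstoL2w (s : ℝ) (u : ℕ → E3 → ℝ) (v : E3 → ℝ) : Prop :=
  Tendsto (fun n => eLpNorm (fun x => B.r x ^ s * (u n x - v x)) 2 B.vol) atTop (𝓝 0)

variable {B}

lemma L2w.zero_iff {u : E3 → ℝ} : B.L2w 0 u ↔ MemLp u 2 B.vol := by
  simp [L2w]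

lemma L2w.aesm {s : ℝ} {u : E3 → ℝ} (h : B.L2w s u) : AEStronglyMeasurable u B.vol := by
  refine ((B.aestronglyMeasurable_r_rpow (-s)).mul h.1).congr ?_
  filter_upwards [B.ae_mem_U] with x hx
  have := B.r_pos (B.U_subset_M hx)
  simp only [Pi.mul_apply]
  rw [← mul_assoc, ← Real.rpow_add this]
  simp

lemma L2w.congr {s : ℝ} {u v : E3 → ℝ} (h : B.L2w s u) (huv : u =ᵐ[B.vol] v) : B.L2w s v := by
  refine (memLp_congr_ae ?_).1 h
  filter_upwards [huv] with x hx
  rw [hx]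

lemma L2w.add {s : ℝ} {u v : E3 → ℝ} (hu : B.L2w s u) (hv : B.L2w s v) :
    B.L2w s (fun x => u x + v x) := by
  simpa [L2w, mul_add] using! MemLp.add hu hv

lemma L2w.sub {s : ℝ} {u v : E3 → ℝ} (hu : B.L2w s u) (hv : B.L2w s v) :
    B.L2w s (fun x => u x - v x) := by
  simpa [L2w, mul_sub] using! MemLp.sub hu hv

lemma L2w.zero {s : ℝ} : B.L2w s (fun _ => 0) := by
  simp [L2w]

lemma L2w.sum {s : ℝ} {ι : Type*} {t : Finset ι} {u : ι → E3 → ℝ}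
    (hu : ∀ i ∈ t, B.L2w s (u i)) : B.L2w s (fun x => ∑ i ∈ t, u i x) := by
  have := memLp_finsetSum (μ := B.vol) (p := 2) t hu
  simpa [L2w, Finset.mul_sum] using! this

lemma L2w.of_le {s : ℝ} {u v : E3 → ℝ} {C : ℝ} (hv : B.L2w s v) (hu : AEStronglyMeasurable u B.vol)
    (h : ∀ᵐ x ∂B.vol, |u x| ≤ C * |v x|) : B.L2w s u := by
  refine MemLp.of_le_mul (c := C) hv ((B.aestronglyMeasurable_r_rpow s).mul hu) ?_
  filter_upwards [h, B.ae_mem_U] with x hx hU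
  have := B.r_pos (B.U_subset_M hU)
  have h2 : 0 < B.r x ^ s := Real.rpow_pos_of_pos this s
  rw [norm_mul, norm_mul, Real.norm_of_nonneg h2.le]
  simp only [Real.norm_eq_abs]
  nlinarith

lemma L2w.bdd_mul {s : ℝ} {c u : E3 → ℝ} {C : ℝ} (hu : B.L2w s u)
    (hc : AEStronglyMeasurable c B.vol) (h : ∀ᵐ x ∂B.vol, |c x| ≤ C) :
    B.L2w s (fun x => c x * u x) := by
  refine hu.of_le (C := C) (hc.mul hu.aesm) ?_
  filter_upwards [h] with x hx
  rw [abs_mul]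
  exact mul_le_mul_of_nonneg_right hx (abs_nonneg _)

lemma L2w.const_mul {s : ℝ} {u : E3 → ℝ} (hu : B.L2w s u) (k : ℝ) :
    B.L2w s (fun x => k * u x) :=
  hu.bdd_mul (C := |k|) aestronglyMeasurable_const (by simp)

lemma L2w.integrable_mul {s : ℝ} {u v : E3 → ℝ} (hu : B.L2w s u) (hv : B.L2w (-s) v) :
    Integrable (fun x => u x * v x) B.vol := by
  have h : Integrable (fun x => (B.r x ^ s * u x) * (B.r x ^ (-s) * v x)) B.vol :=
    MemLp.integrable_mul hu hv
  refine h.congr ?_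
  filter_upwards [B.ae_mem_U] with x hU
  have hr := B.r_pos (B.U_subset_M hU)
  have : B.r x ^ s * B.r x ^ (-s) = 1 := by rw [← Real.rpow_add hr]; simp
  linear_combination (u x * v x) * this

lemma L2w.integrable_mul₀ {u v : E3 → ℝ} (hu : B.L2w 0 u) (hv : B.L2w 0 v) :
    Integrable (fun x => u x * v x) B.vol :=
  hu.integrable_mul (by simpa using hv)

lemma L2w.locallyIntegrableOn {s : ℝ} {u : E3 → ℝ} (hu : B.L2w s u) :
    LocallyIntegrableOn u B.U := by
  have h1 : LocallyIntegrableOn (fun x => B.r x ^ s * u x) B.U := by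
    have := (MemLp.locallyIntegrable hu (by norm_num : (1 : ENNReal) ≤ 2))
    exact locallyIntegrableOn_of_locallyIntegrable_restrict this
  have h2 := h1.continuousOn_mul ((B.continuousOn_r_rpow (-s)).mono B.U_subset_M)
    B.isOpen_U.isLocallyClosed
  refine h2.congr ?_
  filter_upwards [B.ae_mem_U] with x hU
  have hr := B.r_pos (B.U_subset_M hU)
  have : B.r x ^ s * B.r x ^ (-s) = 1 := by rw [← Real.rpow_add hr]; simp
  linear_combination u x * this

lemma exists_r_rpow_le (s R : ℝ) : ∃ C, 0 ≤ C ∧ ∀ x ∈ B.M, ‖x‖ ≤ R → B.r x ^ s ≤ C := by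
  have hK : IsCompact (B.M ∩ Metric.closedBall 0 R) :=
    (isCompact_closedBall (0 : E3) R).inter_left B.isClosed_M
  obtain ⟨C, hC⟩ := hK.exists_bound_of_continuousOn
    ((B.continuousOn_r_rpow s).mono Set.inter_subset_left)
  refine ⟨|C|, abs_nonneg _, fun x hx hR => ?_⟩
  exact (le_abs_self _).trans ((hC x ⟨hx, by simpa using hR⟩).trans (le_abs_self _))

lemma L2w.of_bounded_support {s : ℝ} {u : E3 → ℝ} {C R : ℝ} (hu : AEStronglyMeasurable u B.vol)
    (hC : ∀ᵐ x ∂B.vol, |u x| ≤ C) (hR : ∀ x, R < ‖x‖ → u x = 0) : B.L2w s u := by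
  obtain ⟨D, hD0, hD⟩ := B.exists_r_rpow_le s R
  have h : MemLp ((Metric.closedBall (0 : E3) R).indicator fun _ => D * C) 2 B.vol := by
    refine memLp_indicator_const 2 Metric.isClosed_closedBall.measurableSet _ (Or.inr ?_)
    refine ne_top_of_le_ne_top ?_ (Measure.restrict_apply_le _ _)
    exact measure_closedBall_lt_top.ne
  refine h.of_le ((B.aestronglyMeasurable_r_rpow s).mul hu) ?_
  filter_upwards [hC, B.ae_mem_U] with x hx hU
  have hr := Real.rpow_pos_of_pos (B.r_pos (B.U_subset_M hU)) s
  by_cases hxR : R < ‖x‖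
  · simp [hR x hxR]
  · have h3 : x ∈ Metric.closedBall (0 : E3) R := by simpa using not_lt.1 hxR
    rw [Set.indicator_of_mem h3, norm_mul, Real.norm_of_nonneg hr.le]
    refine le_trans ?_ (le_abs_self _)
    exact mul_le_mul (hD x (B.U_subset_M hU) (not_lt.1 hxR)) hx (abs_nonneg _) hD0

lemma _root_.HasCompactSupport.exists_norm_bound {u : E3 → ℝ} (hu : HasCompactSupport u) :
    ∃ R : ℝ, ∀ x, R < ‖x‖ → u x = 0 := by
  obtain ⟨R, hR⟩ := hu.isCompact.isBounded.subset_closedBall 0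
  refine ⟨R, fun x hx => ?_⟩
  by_contra h
  have := hR (subset_tsupport u h)
  simp at this
  linarith

lemma L2w.of_continuous {s : ℝ} {u : E3 → ℝ} (hu : Continuous u) (hs : HasCompactSupport u) :
    B.L2w s u := by
  obtain ⟨C, hC⟩ := hs.exists_bound_of_continuous hu
  obtain ⟨R, hR⟩ := hs.exists_norm_bound
  exact L2w.of_bounded_support (C := C) (R := R) hu.aestronglyMeasurable
    (Eventually.of_forall hC) hR

/-- Hölder's inequality with opposite weights. It is the tool for passing to the limit in weak
identities. -/
lemma TendstoL2w.integral_mul {s : ℝ} {u : ℕ → E3 → ℝ} {v θ : E3 → ℝ} (h : B.TendstoL2w s u v)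
    (hu : ∀ᶠ n in atTop, B.L2w s (u n)) (hv : B.L2w s v) (hθ : B.L2w (-s) θ) :
    Tendsto (fun n => ∫ x in B.U, u n x * θ x) atTop (𝓝 (∫ x in B.U, v x * θ x)) := by
  refine tendsto_integral_of_L1' _ (hv.integrable_mul hθ).aestronglyMeasurable
    (hu.mono fun n hn => hn.integrable_mul hθ) ?_
  have hθ' : eLpNorm (fun x => B.r x ^ (-s) * θ x) 2 B.vol ≠ ⊤ := hθ.2.ne
  have h2 := ENNReal.Tendsto.mul_const h (Or.inr hθ')
  rw [zero_mul] at h2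
  refine tendsto_of_tendsto_of_tendsto_of_le_of_le' tendsto_const_nhds h2
    (Eventually.of_forall fun _ => zero_le) ?_
  filter_upwards [hu] with n hn
  have h3 := eLpNorm_smul_le_mul_eLpNorm (r := 1) (p := 2) (q := 2) (hpqr := inferInstance)
    hθ.1 (hn.sub hv).1
  refine le_trans (le_of_eq ?_) h3
  refine eLpNorm_congr_ae ?_
  filter_upwards [B.ae_mem_U] with x hU
  have hr := B.r_pos (B.U_subset_M hU)
  have : B.r x ^ s * B.r x ^ (-s) = 1 := by rw [← Real.rpow_add hr]; simp
  simp only [Pi.sub_apply, Pi.smul_apply', smul_eq_mul]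
  linear_combination -((u n x - v x) * θ x) * this

end Background

/-! ### Classical partial derivatives and test functions. -/

lemma contDiff_partialD {u : E3 → ℝ} (hu : ContDiff ℝ ∞ u) (i : Fin 3) :
    ContDiff ℝ ∞ (partialD i u) :=
  (hu.fderiv_right (m := ∞) (by simp)).clm_apply contDiff_const

lemma contDiffOn_partialD {u : E3 → ℝ} {s : Set E3} (hs : IsOpen s) (hu : ContDiffOn ℝ ∞ u s)
    (i : Fin 3) : ContDiffOn ℝ ∞ (partialD i u) s :=
  (hu.fderiv_of_isOpen hs (m := ∞) (by simp)).clm_apply contDiffOn_const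

lemma tsupport_partialD_subset (u : E3 → ℝ) (i : Fin 3) : tsupport (partialD i u) ⊆ tsupport u := by
  refine closure_minimal (fun x hx => ?_) isClosed_closure
  refine support_fderiv_subset ℝ (f := u) ?_
  intro h
  exact hx (by simp [partialD, h])

lemma partialD_eq_zero_of_notMem {u : E3 → ℝ} {x : E3} (hx : x ∉ tsupport u) (i : Fin 3) :
    partialD i u x = 0 := by
  by_contra h
  exact hx (tsupport_partialD_subset u i (subset_tsupport _ h))

lemma partialD_mul {u v : E3 → ℝ} {x : E3} (hu : DifferentiableAt ℝ u x)
    (hv : DifferentiableAt ℝ v x) (i : Fin 3) :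
    partialD i (fun y => u y * v y) x = partialD i u x * v x + u x * partialD i v x := by
  simp only [partialD]
  rw [fderiv_fun_mul hu hv]
  simp
  ring

namespace Background

variable {B : Background}

lemma partialD_mem_testFunctions {ψ : E3 → ℝ} (hψ : ψ ∈ B.testFunctions) (i : Fin 3) :
    partialD i ψ ∈ B.testFunctions :=
  ⟨contDiff_partialD hψ.1 i, hψ.2.1.mono' ((subset_tsupport _).trans (tsupport_partialD_subset ψ i)),
    (tsupport_partialD_subset ψ i).trans hψ.2.2⟩

/-- The values of `f` off the interior are irrelevant: near a point outside `tsupport ψ` the product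
vanishes identically. -/
lemma mul_mem_testFunctions {f ψ : E3 → ℝ} (hf : ContDiffOn ℝ ∞ f B.U)
    (hψ : ψ ∈ B.testFunctions) : (fun x => f x * ψ x) ∈ B.testFunctions := by
  have hsub : tsupport (fun x => f x * ψ x) ⊆ tsupport ψ := tsupport_mul_subset_right
  refine ⟨contDiff_iff_contDiffAt.2 fun x => ?_, hψ.2.1.mono' ((subset_tsupport _).trans hsub),
    hsub.trans hψ.2.2⟩
  by_cases hx : x ∈ tsupport ψ
  · exact (hf.contDiffAt (B.isOpen_U.mem_nhds (hψ.2.2 hx))).mul hψ.1.contDiffAt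
  · refine (contDiffAt_const (c := (0 : ℝ))).congr_of_eventuallyEq ?_
    filter_upwards [(isClosed_tsupport ψ).isOpen_compl.mem_nhds hx] with y hy
    rw [image_eq_zero_of_notMem_tsupport hy, mul_zero]

lemma partialD_mul_test {f ψ : E3 → ℝ} (hf : ContDiffOn ℝ ∞ f B.U)
    (hψ : ψ ∈ B.testFunctions) (i : Fin 3) (x : E3) :
    partialD i (fun x => f x * ψ x) x =
      partialD i f x * ψ x + f x * partialD i ψ x := by
  by_cases hx : x ∈ tsupport ψ
  · refine partialD_mul ?_ (hψ.1.contDiffAt.differentiableAt (by simp)) i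
    exact (hf.contDiffAt (B.isOpen_U.mem_nhds (hψ.2.2 hx))).differentiableAt (by simp)
  · rw [partialD_eq_zero_of_notMem (fun h => hx (tsupport_mul_subset_right h)),
      partialD_eq_zero_of_notMem hx, image_eq_zero_of_notMem_tsupport hx]
    simp

lemma L2w.of_test {s : ℝ} {ψ : E3 → ℝ} (hψ : ψ ∈ B.testFunctions) : B.L2w s ψ :=
  L2w.of_continuous hψ.1.continuous hψ.2.1

lemma _root_.MeasureTheory.LocallyIntegrableOn.integrable_mul_test {u ψ : E3 → ℝ}
    (hu : LocallyIntegrableOn u B.U) (hψ : ψ ∈ B.testFunctions) :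
    Integrable (fun x => u x * ψ x) B.vol := by
  have h := (hu.integrableOn_compact_subset hψ.2.2 hψ.2.1.isCompact).mul_continuousOn
    hψ.1.continuous.continuousOn hψ.2.1.isCompact
  refine Integrable.restrict ((integrableOn_iff_integrable_of_support_subset ?_).1 h)
  intro x hx
  exact subset_tsupport ψ (right_ne_zero_of_mul hx)

/-! ### Calculus of weak partial derivatives. -/

namespace HasWeakPartial

variable {i : Fin 3} {u v u' v' : E3 → ℝ}

/-- The fundamental lemma of the calculus of variations on the open set `U`. Through it the
arbitrary choice in `wd` can be replaced by any known weak derivative. -/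
lemma unique (h : B.HasWeakPartial i u v) (h' : B.HasWeakPartial i u v') : v =ᵐ[B.vol] v' := by
  have h1 : ∀ᵐ x, x ∈ B.U → (v x - v' x) = 0 := by
    refine B.isOpen_U.ae_eq_zero_of_integral_contDiff_smul_eq_zero (h.2.1.sub h'.2.1) ?_
    intro ψ h1 h2 h3
    have hψ : ψ ∈ B.testFunctions := ⟨h1, h2, h3⟩
    have e1 := h.2.2 ψ hψ
    rw [h'.2.2 ψ hψ, neg_inj] at e1
    rw [← setIntegral_eq_integral_of_forall_compl_eq_zero (s := B.U)]
    · simp only [smul_eq_mul]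
      have : ∀ x, ψ x * (v x - v' x) = v x * ψ x - v' x * ψ x := fun x => by ring
      simp_rw [this]
      rw [integral_sub (h.2.1.integrable_mul_test hψ) (h'.2.1.integrable_mul_test hψ), e1, sub_self]
    · intro x hx
      rw [image_eq_zero_of_notMem_tsupport fun hh => hx (h3 hh), zero_smul]
  refine (ae_restrict_iff' B.measurableSet_U).2 ?_
  filter_upwards [h1] with x hx hU
  linarith [hx hU]

lemma congr (h : B.HasWeakPartial i u v) (hu : u =ᵐ[B.vol] u') (hv : v =ᵐ[B.vol] v') :
    B.HasWeakPartial i u' v' := by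
  refine ⟨h.1.congr hu, h.2.1.congr hv, fun ψ hψ => ?_⟩
  have h1 : ∫ x in B.U, u' x * partialD i ψ x = ∫ x in B.U, u x * partialD i ψ x :=
    integral_congr_ae (by filter_upwards [hu] with x hx; rw [hx])
  have h2 : ∫ x in B.U, v' x * ψ x = ∫ x in B.U, v x * ψ x :=
    integral_congr_ae (by filter_upwards [hv] with x hx; rw [hx])
  rw [h1, h2, h.2.2 ψ hψ]

lemma wd_eq (h : B.HasWeakPartial i u v) : B.wd i u =ᵐ[B.vol] v := by
  have hex : ∃ v, B.HasWeakPartial i u v := ⟨v, h⟩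
  have : B.wd i u = hex.choose := by simp [wd, hex]
  rw [this]
  exact unique hex.choose_spec h

lemma self_wd (h : B.HasWeakPartial i u v) : B.HasWeakPartial i u (B.wd i u) :=
  h.congr .rfl h.wd_eq.symm

lemma add (h : B.HasWeakPartial i u v) (h' : B.HasWeakPartial i u' v') :
    B.HasWeakPartial i (fun x => u x + u' x) (fun x => v x + v' x) := by
  refine ⟨h.1.add h'.1, h.2.1.add h'.2.1, fun ψ hψ => ?_⟩
  simp_rw [add_mul]
  rw [integral_add (h.1.integrable_mul_test (partialD_mem_testFunctions hψ i))
    (h'.1.integrable_mul_test (partialD_mem_testFunctions hψ i)),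
    integral_add (h.2.1.integrable_mul_test hψ) (h'.2.1.integrable_mul_test hψ),
    h.2.2 ψ hψ, h'.2.2 ψ hψ]
  ring

lemma const_mul (h : B.HasWeakPartial i u v) (k : ℝ) :
    B.HasWeakPartial i (fun x => k * u x) (fun x => k * v x) := by
  refine ⟨h.1.smul k, h.2.1.smul k, fun ψ hψ => ?_⟩
  simp_rw [mul_assoc]
  rw [integral_const_mul, integral_const_mul, h.2.2 ψ hψ]
  ring

lemma sub (h : B.HasWeakPartial i u v) (h' : B.HasWeakPartial i u' v') :
    B.HasWeakPartial i (fun x => u x - u' x) (fun x => v x - v' x) := by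
  simpa [sub_eq_add_neg] using h.add (h'.const_mul (-1))

lemma zero : B.HasWeakPartial i (fun _ => 0) (fun _ => 0) :=
  ⟨locallyIntegrableOn_zero, locallyIntegrableOn_zero, by simp⟩

lemma sum {ι : Type*} {s : Finset ι} {u v : ι → E3 → ℝ}
    (h : ∀ k ∈ s, B.HasWeakPartial i (u k) (v k)) :
    B.HasWeakPartial i (fun x => ∑ k ∈ s, u k x) (fun x => ∑ k ∈ s, v k x) := by
  classical
  induction s using Finset.induction_on with
  | empty => simpa using zero
  | insert a s ha ih =>
    simp_rw [Finset.sum_insert ha]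
    exact (h a (Finset.mem_insert_self _ _)).add (ih fun k hk => h k (Finset.mem_insert_of_mem hk))

lemma of_contDiffOn (hu : ContDiffOn ℝ ∞ u B.U) : B.HasWeakPartial i u (partialD i u) := by
  have c1 := hu.continuousOn
  have c2 := (contDiffOn_partialD B.isOpen_U hu i).continuousOn
  have l1 := c1.locallyIntegrableOn B.measurableSet_U (μ := volume)
  have l2 := c2.locallyIntegrableOn B.measurableSet_U (μ := volume)
  refine ⟨l1, l2, fun ψ hψ => ?_⟩
  have hs : ∀ {f : E3 → ℝ}, (∀ x, x ∉ tsupport ψ → f x = 0) →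
      (∫ x in B.U, f x = ∫ x, f x ∧ (Integrable f B.vol → Integrable f)) := by
    intro f hf
    refine ⟨setIntegral_eq_integral_of_forall_compl_eq_zero fun x hx =>
      hf x fun h => hx (hψ.2.2 h), fun h => ?_⟩
    refine (integrableOn_iff_integrable_of_support_subset fun x hx => ?_).1 h
    by_contra hU
    exact hx (hf x fun h => hU (hψ.2.2 h))
  have a1 := hs (f := fun x => u x * partialD i ψ x) fun x hx => by
    simp [partialD_eq_zero_of_notMem hx]
  have a2 := hs (f := fun x => partialD i u x * ψ x) fun x hx => by
    simp [image_eq_zero_of_notMem_tsupport hx]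
  have a3 := hs (f := fun x => u x * ψ x) fun x hx => by
    simp [image_eq_zero_of_notMem_tsupport hx]
  rw [a1.1, a2.1]
  refine integral_mul_fderiv_eq_neg_fderiv_mul_of_integrable
    (a2.2 (l2.integrable_mul_test hψ)) (a1.2 (l1.integrable_mul_test (partialD_mem_testFunctions hψ i)))
    (a3.2 (l1.integrable_mul_test hψ)) ?_ fun x _ => hψ.1.contDiffAt.differentiableAt (by simp)
  intro x hx
  exact (hu.contDiffAt (B.isOpen_U.mem_nhds (hψ.2.2 hx))).differentiableAt (by simp)

/-- The weak derivative is a closed operator: both sides of the defining identity converge for a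
fixed test function. The two weights are independent, since test functions lie in every weighted
space. -/
lemma of_tendsto {s t : ℝ} {U V : ℕ → E3 → ℝ} (h : ∀ n, B.HasWeakPartial i (U n) (V n))
    (hU : ∀ᶠ n in atTop, B.L2w s (U n)) (hV : ∀ᶠ n in atTop, B.L2w t (V n))
    (hu : B.L2w s u) (hv : B.L2w t v) (hUu : B.TendstoL2w s U u) (hVv : B.TendstoL2w t V v) :
    B.HasWeakPartial i u v := by
  refine ⟨hu.locallyIntegrableOn, hv.locallyIntegrableOn, fun ψ hψ => ?_⟩
  have h1 := hUu.integral_mul hU hu (L2w.of_test (partialD_mem_testFunctions hψ i))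
  have h2 := (hVv.integral_mul hV hv (L2w.of_test hψ)).neg
  refine tendsto_nhds_unique h1 (h2.congr fun n => ?_)
  rw [(h n).2.2 ψ hψ]

end HasWeakPartial

lemma wd_congr {i : Fin 3} {u v : E3 → ℝ} (h : u =ᵐ[B.vol] v) : B.wd i u =ᵐ[B.vol] B.wd i v := by
  by_cases hu : ∃ w, B.HasWeakPartial i u w
  · obtain ⟨w, hw⟩ := hu
    exact hw.wd_eq.trans (hw.congr h .rfl).wd_eq.symm
  -- If one function has no weak derivative then neither has the other, and `wd` takes its default
  -- value 0 for both.
  · have hv : ¬ ∃ w, B.HasWeakPartial i v w := fun ⟨w, hw⟩ => hu ⟨w, hw.congr h.symm .rfl⟩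
    simp only [wd, hu, hv, dite_false]
    rfl

end Background

/-! ### Coefficients: uniform limits of smooth functions, with product and chain rules. -/

namespace Background

/-- Convergence `u n → v` uniformly up to null sets. -/
def TendstoUnif (B : Background) (u : ℕ → E3 → ℝ) (v : E3 → ℝ) : Prop :=
  ∀ ε > 0, ∀ᶠ n in atTop, ∀ᵐ x ∂B.vol, |u n x - v x| ≤ ε

variable {B : Background}

lemma TendstoUnif.tendsto_eLpNorm {u : ℕ → E3 → ℝ} {v : E3 → ℝ} (h : B.TendstoUnif u v) :
    Tendsto (fun n => eLpNorm (fun x => u n x - v x) ⊤ B.vol) atTop (𝓝 0) := by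
  rw [ENNReal.tendsto_nhds_zero]
  intro ε hε
  obtain ⟨δ, hδ0, hδ⟩ : ∃ δ : ℝ, 0 < δ ∧ ENNReal.ofReal δ ≤ ε := by
    by_cases hε' : ε = ⊤
    · exact ⟨1, one_pos, by simp [hε']⟩
    · exact ⟨ε.toReal, ENNReal.toReal_pos hε.ne' hε', (ENNReal.ofReal_toReal hε').le⟩
  filter_upwards [h δ hδ0] with n hn
  rw [eLpNorm_exponent_top]
  exact (eLpNormEssSup_le_of_ae_bound hn).trans hδ

/-- Split `a n * w n - α * v = a n * (w n - v) + (a n - α) * v`; the factor `a n` is eventually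
bounded by `C + 1`. -/
lemma TendstoL2w.mul_of_unif {s : ℝ} {a w : ℕ → E3 → ℝ} {α v : E3 → ℝ} {C : ℝ}
    (hα : AEStronglyMeasurable α B.vol) (hC : ∀ᵐ x ∂B.vol, |α x| ≤ C)
    (ha : B.TendstoUnif a α) (ham : ∀ᶠ n in atTop, AEStronglyMeasurable (a n) B.vol)
    (hw : B.TendstoL2w s w v) (hwm : ∀ᶠ n in atTop, AEStronglyMeasurable (w n) B.vol)
    (hv : B.L2w s v) :
    B.TendstoL2w s (fun n x => a n x * w n x) (fun x => α x * v x) := by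
  have hlim : Tendsto (fun n => ENNReal.ofReal (C + 1) *
      eLpNorm (fun x => B.r x ^ s * (w n x - v x)) 2 B.vol +
      eLpNorm (fun x => a n x - α x) ⊤ B.vol * eLpNorm (fun x => B.r x ^ s * v x) 2 B.vol)
      atTop (𝓝 (ENNReal.ofReal (C + 1) * 0 + 0 * eLpNorm (fun x => B.r x ^ s * v x) 2 B.vol)) :=
    (ENNReal.Tendsto.const_mul hw (Or.inr ENNReal.ofReal_ne_top)).add
      (ENNReal.Tendsto.mul_const ha.tendsto_eLpNorm (Or.inr hv.2.ne))
  rw [mul_zero, zero_mul, add_zero] at hlim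
  refine tendsto_of_tendsto_of_tendsto_of_le_of_le' tendsto_const_nhds hlim
    (Eventually.of_forall fun _ => zero_le) ?_
  filter_upwards [ham, hwm, ha 1 one_pos] with n hn1 hn2 hn3
  have m1 : AEStronglyMeasurable (fun x => B.r x ^ s * (w n x - v x)) B.vol :=
    (B.aestronglyMeasurable_r_rpow s).mul (hn2.sub hv.aesm)
  have e : (fun x => B.r x ^ s * (a n x * w n x - α x * v x)) =
      (a n • fun x => B.r x ^ s * (w n x - v x)) +
      ((fun x => a n x - α x) • fun x => B.r x ^ s * v x) := by
    ext x
    simp only [Pi.add_apply, Pi.mul_apply, smul_eq_mul]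
    ring
  rw [e]
  refine (eLpNorm_add_le (hn1.smul m1) ((hn1.sub hα).smul hv.1) (by norm_num)).trans ?_
  gcongr
  · refine (eLpNorm_smul_le_eLpNorm_top_mul_eLpNorm 2 m1 _).trans ?_
    gcongr
    rw [eLpNorm_exponent_top]
    refine eLpNormEssSup_le_of_ae_bound ?_
    filter_upwards [hn3, hC] with x h1 h2
    have := abs_sub_abs_le_abs_sub (a n x) (α x)
    rw [Real.norm_eq_abs]
    linarith
  · exact eLpNorm_smul_le_eLpNorm_top_mul_eLpNorm 2 hv.1 _

lemma TendstoUnif.integral_mul {u : ℕ → E3 → ℝ} {v θ : E3 → ℝ} {C : ℝ} (h : B.TendstoUnif u v)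
    (hu : ∀ᶠ n in atTop, AEStronglyMeasurable (u n) B.vol) (hv : AEStronglyMeasurable v B.vol)
    (hC : ∀ᵐ x ∂B.vol, |v x| ≤ C) (hθ : Integrable θ B.vol) :
    Tendsto (fun n => ∫ x in B.U, u n x * θ x) atTop (𝓝 (∫ x in B.U, v x * θ x)) := by
  refine tendsto_integral_of_L1' _ (hθ.bdd_mul hv hC).aestronglyMeasurable ?_ ?_
  · filter_upwards [hu, h 1 one_pos] with n hn hn3
    refine hθ.bdd_mul (c := C + 1) hn ?_
    filter_upwards [hn3, hC] with x h1 h2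
    have := abs_sub_abs_le_abs_sub (u n x) (v x)
    rw [Real.norm_eq_abs]
    linarith
  · have h2 := ENNReal.Tendsto.mul_const (b := eLpNorm θ 1 B.vol) h.tendsto_eLpNorm
      (Or.inr (memLp_one_iff_integrable.2 hθ).2.ne)
    rw [zero_mul] at h2
    refine tendsto_of_tendsto_of_tendsto_of_le_of_le tendsto_const_nhds h2
      (fun _ => zero_le) fun n => ?_
    refine le_trans (le_of_eq ?_) (eLpNorm_smul_le_eLpNorm_top_mul_eLpNorm 1 hθ.1 _)
    congr 1
    ext x
    simp only [Pi.sub_apply, Pi.smul_apply', smul_eq_mul]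
    ring

/-- A null open set is empty. This turns the almost everywhere bounds on smooth approximants into
bounds at every point, which are needed to compose them with a function smooth only near `K`. -/
lemma mapsTo_of_ae {u : E3 → ℝ} {K : Set ℝ} (hu : ContinuousOn u B.U) (hK : IsClosed K)
    (h : ∀ᵐ x ∂B.vol, u x ∈ K) : ∀ x ∈ B.U, u x ∈ K := by
  have ho : IsOpen (B.U ∩ u ⁻¹' Kᶜ) := hu.isOpen_inter_preimage B.isOpen_U hK.isOpen_compl
  have h0 : volume (B.U ∩ u ⁻¹' Kᶜ) = 0 := by
    rw [ae_restrict_iff' B.measurableSet_U] at h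
    refine measure_mono_null ?_ h
    intro x hx hx2
    exact hx.2 (hx2 hx.1)
  rw [ho.measure_eq_zero_iff (μ := volume)] at h0
  intro x hx
  by_contra hx2
  have : x ∈ B.U ∩ u ⁻¹' Kᶜ := ⟨hx, hx2⟩
  rw [h0] at this
  exact this

/-- Bounded coefficients `c` on the manifold which tend to the constant `c₀` at infinity in the sense
that `(c - c₀) / r` is square integrable, and which are uniform limits of smooth functions whose
derivatives converge in `L²` to `c'`. -/
structure Coef (B : Background) (c : E3 → ℝ) (c' : Fin 3 → E3 → ℝ) (c₀ : ℝ) : Prop where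
  aesm : AEStronglyMeasurable c B.vol
  bdd : ∃ C, ∀ᵐ x ∂B.vol, |c x| ≤ C
  decay : B.L2w (-1) (fun x => c x - c₀)
  deriv : ∀ i, B.L2w 0 (c' i)
  approx : ∃ u : ℕ → E3 → ℝ, (∀ᶠ n in atTop, ContDiffOn ℝ ∞ (u n) B.U) ∧ B.TendstoUnif u c ∧
    ∀ i, B.TendstoL2w 0 (fun n => partialD i (u n)) (c' i)

lemma L2w.of_eLpNorm_sub {s : ℝ} {u v : E3 → ℝ} (hv : B.L2w s v)
    (hu : AEStronglyMeasurable u B.vol)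
    (h : eLpNorm (fun x => B.r x ^ s * (u x - v x)) 2 B.vol < ⊤) : B.L2w s u := by
  have h1 : B.L2w s (fun x => u x - v x) :=
    ⟨(B.aestronglyMeasurable_r_rpow s).mul (hu.sub hv.aesm), h⟩
  simpa using h1.add hv

lemma TendstoL2w.eventually_L2w {s : ℝ} {u : ℕ → E3 → ℝ} {v : E3 → ℝ} (h : B.TendstoL2w s u v)
    (hv : B.L2w s v) (hu : ∀ᶠ n in atTop, AEStronglyMeasurable (u n) B.vol) :
    ∀ᶠ n in atTop, B.L2w s (u n) := by
  filter_upwards [hu, (ENNReal.tendsto_nhds_zero.1 h) 1 one_pos] with n h1 h2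
  exact hv.of_eLpNorm_sub h1 (lt_of_le_of_lt h2 ENNReal.one_lt_top)

lemma aesm_of_contDiffOn {u : E3 → ℝ} (hu : ContDiffOn ℝ ∞ u B.U) :
    AEStronglyMeasurable u B.vol :=
  hu.continuousOn.aestronglyMeasurable B.measurableSet_U

lemma aesm_partialD {u : E3 → ℝ} (hu : ContDiffOn ℝ ∞ u B.U) (i : Fin 3) :
    AEStronglyMeasurable (partialD i u) B.vol :=
  aesm_of_contDiffOn (contDiffOn_partialD B.isOpen_U hu i)

namespace Coef

variable {c d : E3 → ℝ} {c' d' : Fin 3 → E3 → ℝ} {c₀ d₀ : ℝ}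

/-- Replace `c` by its smooth approximants `u n`. Then `u n * ψ` is itself a test function for the
weak derivative of `b`, and the limit gives the product rule. The conditions `hloc` and `hψb` are
weaker than square integrability of `b`, so that `b = 1` is allowed. -/
lemma hasWeakPartial_mul_of {i : Fin 3} {b b' : E3 → ℝ} (hc : B.Coef c c' c₀)
    (hb : B.HasWeakPartial i b b') (hloc : LocallyIntegrableOn (fun x => c' i x * b x) B.U)
    (hψb : ∀ ψ ∈ B.testFunctions, B.L2w 0 (fun x => b x * ψ x)) :
    B.HasWeakPartial i (fun x => c x * b x) (fun x => c' i x * b x + c x * b' x) := by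
  obtain ⟨C, hC⟩ := hc.bdd
  obtain ⟨u, hu, huc, hu'⟩ := hc.approx
  have hloc2 : ∀ {f : E3 → ℝ}, LocallyIntegrableOn f B.U →
      LocallyIntegrableOn (fun x => c x * f x) B.U := by
    intro f hf x hx
    obtain ⟨s, hs, hfs⟩ := hf x hx
    obtain ⟨t, ht, hts⟩ := hfs.aestronglyMeasurable
    refine ⟨s ∩ B.U, inter_mem hs self_mem_nhdsWithin, ?_⟩
    refine Integrable.bdd_mul (c := C) (hfs.mono_set Set.inter_subset_left) ?_ ?_
    · exact hc.aesm.mono_measure (Measure.restrict_mono Set.inter_subset_right le_rfl)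
    · exact ae_mono (Measure.restrict_mono Set.inter_subset_right le_rfl) hC
  refine ⟨hloc2 hb.1, hloc.add (hloc2 hb.2.1), fun ψ hψ => ?_⟩
  have hψ' := partialD_mem_testFunctions hψ i
  have um := hu.mono fun n hn => aesm_of_contDiffOn hn
  have t1 := huc.integral_mul um hc.aesm hC (hb.1.integrable_mul_test hψ')
  have t2 := huc.integral_mul um hc.aesm hC (hb.2.1.integrable_mul_test hψ)
  have um' := (hu' i).eventually_L2w (hc.deriv i) (hu.mono fun n hn => aesm_partialD hn i)
  have hψb' : B.L2w (-0) (fun x => b x * ψ x) := by simpa using hψb ψ hψ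
  have t3 := (hu' i).integral_mul um' (hc.deriv i) hψb'
  have hlim := (t3.add t2).neg
  have e : ∀ᶠ n in atTop, -((∫ x in B.U, partialD i (u n) x * (b x * ψ x)) +
      ∫ x in B.U, u n x * (b' x * ψ x)) = ∫ x in B.U, u n x * (b x * partialD i ψ x) := by
    filter_upwards [hu, um'] with n hn hn'
    have hT := mul_mem_testFunctions hn hψ
    have h1 := hb.2.2 _ hT
    have h2 := hb.1.integrable_mul_test (mul_mem_testFunctions hn hψ')
    have h3 := hn'.integrable_mul hψb'
    have e1 : ∫ x in B.U, b x * partialD i (fun x => u n x * ψ x) x =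
        (∫ x in B.U, partialD i (u n) x * (b x * ψ x)) +
        ∫ x in B.U, u n x * (b x * partialD i ψ x) := by
      have h2' : Integrable (fun x => u n x * (b x * partialD i ψ x)) B.vol :=
        h2.congr (Eventually.of_forall fun x => by ring)
      rw [← integral_add h3 h2']
      refine integral_congr_ae (Eventually.of_forall fun x => ?_)
      simp only [partialD_mul_test hn hψ]
      ring
    have e2 : ∫ x in B.U, b' x * (u n x * ψ x) = ∫ x in B.U, u n x * (b' x * ψ x) :=
      integral_congr_ae (Eventually.of_forall fun x => by ring)
    rw [e1, e2] at h1
    linarith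
  have h := tendsto_nhds_unique (hlim.congr' e) t1
  have e3 : ∫ x in B.U, c x * b x * partialD i ψ x = ∫ x in B.U, c x * (b x * partialD i ψ x) :=
    integral_congr_ae (Eventually.of_forall fun x => by ring)
  rw [e3, ← h]
  congr 1
  have i1 := (hc.deriv i).integrable_mul hψb'
  have i2 := (hb.2.1.integrable_mul_test hψ).bdd_mul hc.aesm hC
  rw [← integral_add i1 i2]
  exact integral_congr_ae (Eventually.of_forall fun x => by ring)

lemma hasWeakPartial (hc : B.Coef c c' c₀) (i : Fin 3) : B.HasWeakPartial i c (c' i) := by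
  have h1 : B.HasWeakPartial i (fun _ => (1 : ℝ)) (partialD i fun _ => 1) :=
    HasWeakPartial.of_contDiffOn contDiffOn_const
  have h := hc.hasWeakPartial_mul_of h1 (by simpa using (hc.deriv i).locallyIntegrableOn)
    fun ψ hψ => by simpa using L2w.of_test hψ
  have e : partialD i (fun _ => (1 : ℝ)) = fun _ => 0 := by
    ext x
    simp [partialD]
  simpa [e] using h

/-- Product rule for a coefficient and a square integrable function with a weak derivative. -/
lemma hasWeakPartial_mul {i : Fin 3} {b b' : E3 → ℝ} (hc : B.Coef c c' c₀)
    (hb : B.HasWeakPartial i b b') (hb2 : B.L2w 0 b) :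
    B.HasWeakPartial i (fun x => c x * b x) (fun x => c' i x * b x + c x * b' x) := by
  refine hc.hasWeakPartial_mul_of hb ?_ fun ψ hψ => ?_
  · exact locallyIntegrableOn_of_locallyIntegrable_restrict
      ((hc.deriv i).integrable_mul₀ hb2).locallyIntegrable
  · obtain ⟨C, hC⟩ := hψ.2.1.exists_bound_of_continuous hψ.1.continuous
    have := hb2.bdd_mul (C := C) hψ.1.continuous.aestronglyMeasurable (Eventually.of_forall hC)
    simpa [mul_comm] using this

lemma wd_eq (hc : B.Coef c c' c₀) (i : Fin 3) : B.wd i c =ᵐ[B.vol] c' i :=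
  (hc.hasWeakPartial i).wd_eq

lemma congr (hc : B.Coef c c' c₀) (h : c =ᵐ[B.vol] d) (h' : ∀ i, c' i =ᵐ[B.vol] d' i) :
    B.Coef d d' c₀ := by
  obtain ⟨C, hC⟩ := hc.bdd
  obtain ⟨u, hu, huc, hu'⟩ := hc.approx
  refine ⟨hc.aesm.congr h, ⟨C, ?_⟩, hc.decay.congr ?_, fun i => (hc.deriv i).congr (h' i),
    u, hu, ?_, fun i => ?_⟩
  · filter_upwards [hC, h] with x h1 h2
    rwa [← h2]
  · filter_upwards [h] with x h2
    rw [h2]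
  · intro ε hε
    filter_upwards [huc ε hε] with n hn
    filter_upwards [hn, h] with x h1 h2
    rwa [← h2]
  · refine (hu' i).congr fun n => eLpNorm_congr_ae ?_
    filter_upwards [h' i] with x h2
    rw [h2]

lemma const (k : ℝ) : B.Coef (fun _ => k) (fun _ _ => 0) k := by
  refine ⟨aestronglyMeasurable_const, ⟨|k|, by simp⟩, by simpa using L2w.zero,
    fun i => L2w.zero, fun _ _ => k, Eventually.of_forall fun _ => contDiffOn_const, ?_, ?_⟩
  · intro ε hε
    simp [hε.le]
  · intro i
    simp [TendstoL2w, partialD]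

lemma add (hc : B.Coef c c' c₀) (hd : B.Coef d d' d₀) :
    B.Coef (fun x => c x + d x) (fun i x => c' i x + d' i x) (c₀ + d₀) := by
  obtain ⟨C, hC⟩ := hc.bdd
  obtain ⟨u, hu, huc, hu'⟩ := hc.approx
  obtain ⟨D, hD⟩ := hd.bdd
  obtain ⟨v, hv, hvd, hv'⟩ := hd.approx
  refine ⟨hc.aesm.add hd.aesm, ⟨C + D, ?_⟩, ?_, fun i => (hc.deriv i).add (hd.deriv i),
    fun n x => u n x + v n x, ?_, ?_, fun i => ?_⟩
  · filter_upwards [hC, hD] with x h1 h2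
    exact (abs_add_le _ _).trans (add_le_add h1 h2)
  · refine (hc.decay.add hd.decay).congr (Eventually.of_forall fun x => ?_)
    ring
  · filter_upwards [hu, hv] with n h1 h2
    exact h1.add h2
  · intro ε hε
    filter_upwards [huc (ε / 2) (half_pos hε), hvd (ε / 2) (half_pos hε)] with n h1 h2
    filter_upwards [h1, h2] with x h3 h4
    have := abs_add_le (u n x - c x) (v n x - d x)
    have e : u n x + v n x - (c x + d x) = u n x - c x + (v n x - d x) := by ring
    rw [e]
    linarith
  · have hl := (hu' i).add (hv' i)
    rw [add_zero] at hl
    refine tendsto_of_tendsto_of_tendsto_of_le_of_le' tendsto_const_nhds hl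
      (Eventually.of_forall fun _ => zero_le) ?_
    filter_upwards [hu, hv] with n h1 h2
    have m1 : AEStronglyMeasurable (fun x => B.r x ^ (0 : ℝ) * (partialD i (u n) x - c' i x)) B.vol :=
      (B.aestronglyMeasurable_r_rpow 0).mul ((aesm_partialD h1 i).sub (hc.deriv i).aesm)
    have m2 : AEStronglyMeasurable (fun x => B.r x ^ (0 : ℝ) * (partialD i (v n) x - d' i x)) B.vol :=
      (B.aestronglyMeasurable_r_rpow 0).mul ((aesm_partialD h2 i).sub (hd.deriv i).aesm)
    refine le_trans (le_of_eq ?_) (eLpNorm_add_le m1 m2 (by norm_num))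
    refine eLpNorm_congr_ae ?_
    filter_upwards [B.ae_mem_U] with x hx
    have e : partialD i (fun y => u n y + v n y) x = partialD i (u n) x + partialD i (v n) x := by
      simp only [partialD]
      rw [fderiv_fun_add]
      · rfl
      · exact (h1.contDiffAt (B.isOpen_U.mem_nhds hx)).differentiableAt (by simp)
      · exact (h2.contDiffAt (B.isOpen_U.mem_nhds hx)).differentiableAt (by simp)
    simp only [Pi.add_apply, e]
    ring

/-- Chain rule for a smooth function of a coefficient. -/
lemma comp (hc : B.Coef c c' c₀) {F : ℝ → ℝ} {Ω : Set ℝ} {a b : ℝ} (hΩ : IsOpen Ω)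
    (hF : ContDiffOn ℝ ∞ F Ω) (hab : Set.Icc a b ⊆ Ω) (hcab : ∀ᵐ x ∂B.vol, c x ∈ Set.Icc a b)
    (hc₀ : c₀ ∈ Set.Icc a b) :
    B.Coef (fun x => F (c x)) (fun i x => _root_.deriv F (c x) * c' i x) (F c₀) := by
  obtain ⟨u, hu, huc, hu'⟩ := hc.approx
  -- The approximants of `c` may leave `[a, b]`, but by uniform convergence they eventually stay in
  -- a compact thickening `K` inside `Ω`, where `F` and `F'` are bounded and uniformly continuous.
  obtain ⟨δ, hδ, hδΩ⟩ := isCompact_Icc.exists_cthickening_subset_open hΩ hab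
  set K := Metric.cthickening δ (Set.Icc a b) with hKdef
  have hK : IsCompact K := isCompact_Icc.cthickening
  have habK : Set.Icc a b ⊆ K := Metric.self_subset_cthickening _
  have hF' : ContDiffOn ℝ ∞ (_root_.deriv F) Ω := hF.deriv_of_isOpen hΩ (by simp)
  have hFK := hF.continuousOn.mono hδΩ
  have hF'K := hF'.continuousOn.mono hδΩ
  have hFd : ∀ y ∈ Ω, DifferentiableAt ℝ F y := fun y hy =>
    (hF.contDiffAt (hΩ.mem_nhds hy)).differentiableAt (by simp)
  obtain ⟨A, hA⟩ := hK.exists_bound_of_continuousOn hFK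
  obtain ⟨L, hL⟩ := hK.exists_bound_of_continuousOn hF'K
  have ucF := hK.uniformContinuousOn_of_continuous hFK
  have ucF' := hK.uniformContinuousOn_of_continuous hF'K
  have huK : ∀ᶠ n in atTop, ∀ x ∈ B.U, u n x ∈ K := by
    filter_upwards [hu, huc δ hδ] with n h1 h2
    refine mapsTo_of_ae h1.continuousOn hK.isClosed ?_
    filter_upwards [h2, hcab] with x h3 h4
    exact Metric.mem_cthickening_of_dist_le _ _ _ _ h4 (by rwa [Real.dist_eq])
  -- Since `G` is controlled only on `K`, measurability goes through its extension by zero off `K`.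
  have haesm : ∀ {G : ℝ → ℝ}, ContinuousOn G K → AEStronglyMeasurable (fun x => G (c x)) B.vol := by
    intro G hG
    classical
    have h1 : Measurable (K.piecewise G fun _ => 0) :=
      hG.measurable_piecewise (continuousOn_const (c := (0 : ℝ))) hK.isClosed.measurableSet
    refine (h1.comp_aemeasurable hc.aesm.aemeasurable).aestronglyMeasurable.congr ?_
    filter_upwards [hcab] with x hx
    simp [Set.piecewise_eq_of_mem _ _ _ (habK hx)]
  have hunif : ∀ {G : ℝ → ℝ}, UniformContinuousOn G K →
      B.TendstoUnif (fun n x => G (u n x)) (fun x => G (c x)) := by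
    intro G hG ε hε
    obtain ⟨η, hη, hGη⟩ := Metric.uniformContinuousOn_iff.1 hG ε hε
    filter_upwards [huc (η / 2) (half_pos hη), huK] with n h1 h2
    filter_upwards [h1, hcab, B.ae_mem_U] with x h3 h4 h5
    have := hGη _ (h2 x h5) _ (habK h4) (by rw [Real.dist_eq]; linarith)
    rw [Real.dist_eq] at this
    exact this.le
  have hLae : ∀ᵐ x ∂B.vol, |_root_.deriv F (c x)| ≤ L := by
    filter_upwards [hcab] with x hx
    exact hL _ (habK hx)
  have hsm : ∀ᶠ n in atTop, ContDiffOn ℝ ∞ (fun x => F (u n x)) B.U := by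
    filter_upwards [hu, huK] with n h1 h2
    exact hF.comp h1 fun x hx => hδΩ (h2 x hx)
  refine ⟨haesm hFK, ⟨A, ?_⟩, ?_, fun i => (hc.deriv i).bdd_mul (haesm hF'K) hLae,
    fun n x => F (u n x), hsm, hunif ucF, fun i => ?_⟩
  · filter_upwards [hcab] with x hx
    exact hA _ (habK hx)
  · refine hc.decay.of_le (C := L) ((haesm hFK).sub aestronglyMeasurable_const) ?_
    filter_upwards [hcab] with x hx
    -- The mean value inequality, `|F (c x) - F c₀| ≤ L |c x - c₀|`, transfers the decay; hence the
    -- requirement that `c₀` lie in `[a, b]`.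
    have := (convex_Icc a b).norm_image_sub_le_of_norm_deriv_le (f := F) (C := L)
      (fun y hy => hFd y (hab hy)) (fun y hy => hL y (habK hy)) hc₀ hx
    simpa using this
  · have hmul := TendstoL2w.mul_of_unif (haesm hF'K) hLae (hunif ucF') ?_ (hu' i)
      (hu.mono fun n hn => aesm_partialD hn i) (hc.deriv i)
    · refine hmul.congr' ?_
      filter_upwards [hu, huK] with n h1 h2
      refine eLpNorm_congr_ae ?_
      filter_upwards [B.ae_mem_U] with x hx
      have hd := (h1.contDiffAt (B.isOpen_U.mem_nhds hx)).differentiableAt (n := ∞) (by simp)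
      have hcomp := (hFd _ (hδΩ (h2 x hx))).hasDerivAt.comp_hasFDerivAt x hd.hasFDerivAt
      have e : partialD i (fun y => F (u n y)) x =
          _root_.deriv F (u n x) * partialD i (u n) x := by
        have := hcomp.fderiv
        simp only [partialD]
        rw [show (fun y => F (u n y)) = F ∘ u n from rfl, this]
        simp
      rw [e]
    · filter_upwards [hu, huK] with n h1 h2
      exact (hF'K.comp h1.continuousOn h2).aestronglyMeasurable B.measurableSet_U

lemma comp_contDiff (hc : B.Coef c c' c₀) {F : ℝ → ℝ} (hF : ContDiff ℝ ∞ F) :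
    B.Coef (fun x => F (c x)) (fun i x => _root_.deriv F (c x) * c' i x) (F c₀) := by
  obtain ⟨C, hC⟩ := hc.bdd
  refine hc.comp (a := -(|C| + |c₀|)) (b := |C| + |c₀|) isOpen_univ hF.contDiffOn
    (Set.subset_univ _) ?_ ?_
  · filter_upwards [hC] with x hx
    have h1 := abs_le.1 (hx.trans (le_abs_self C))
    have h2 := abs_nonneg c₀
    exact ⟨by linarith, by linarith⟩
  · have h1 := abs_le.1 (le_refl |c₀|)
    have h2 := abs_nonneg C
    exact ⟨by linarith, by linarith⟩

lemma const_mul (hc : B.Coef c c' c₀) (k : ℝ) :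
    B.Coef (fun x => k * c x) (fun i x => k * c' i x) (k * c₀) := by
  have h := hc.comp_contDiff (F := fun y => k * y) (by fun_prop)
  refine h.congr .rfl fun i => Eventually.of_forall fun x => ?_
  simp

lemma sub (hc : B.Coef c c' c₀) (hd : B.Coef d d' d₀) :
    B.Coef (fun x => c x - d x) (fun i x => c' i x - d' i x) (c₀ - d₀) := by
  simpa [sub_eq_add_neg] using hc.add (hd.const_mul (-1))

/-- Polarization, `c d = ((c + d)² - (c - d)²) / 4`, reduces products to the chain rule for the
square. -/
lemma mul (hc : B.Coef c c' c₀) (hd : B.Coef d d' d₀) :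
    B.Coef (fun x => c x * d x) (fun i x => c' i x * d x + c x * d' i x) (c₀ * d₀) := by
  have hsq : ContDiff ℝ ∞ fun y : ℝ => y ^ 2 := by fun_prop
  have h := (((hc.add hd).comp_contDiff hsq).sub ((hc.sub hd).comp_contDiff hsq)).const_mul (1 / 4)
  have e : 1 / 4 * ((c₀ + d₀) ^ 2 - (c₀ - d₀) ^ 2) = c₀ * d₀ := by ring
  rw [e] at h
  refine h.congr (Eventually.of_forall fun x => ?_) fun i => Eventually.of_forall fun x => ?_
  · ring
  · simp
    ring

lemma sum {ι : Type*} {s : Finset ι} {c : ι → E3 → ℝ} {c' : ι → Fin 3 → E3 → ℝ} {c₀ : ι → ℝ}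
    (h : ∀ k ∈ s, B.Coef (c k) (c' k) (c₀ k)) :
    B.Coef (fun x => ∑ k ∈ s, c k x) (fun i x => ∑ k ∈ s, c' k i x) (∑ k ∈ s, c₀ k) := by
  classical
  induction s using Finset.induction_on with
  | empty => simpa using const 0
  | insert a s ha ih =>
    simp_rw [Finset.sum_insert ha]
    exact (h a (Finset.mem_insert_self _ _)).add (ih fun k hk => h k (Finset.mem_insert_of_mem hk))

end Coef

end Background

/-! ### Polar coordinates. -/

/-- The measure `s² ds` on the half line. -/
noncomputable abbrev radialMeasure : Measure ℝ :=
  (volume.restrict (Set.Ioi 0)).withDensity fun s => ENNReal.ofReal (s ^ 2)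

/-- The area measure on the unit sphere. -/
noncomputable abbrev sphereMeasure : Measure (Metric.sphere (0 : E3) 1) :=
  (volume : Measure E3).toSphere

/-- Polar coordinates. -/
def polarMap (p : Metric.sphere (0 : E3) 1 × ℝ) : E3 := p.2 • (p.1 : E3)

lemma continuous_polarMap : Continuous polarMap := by
  unfold polarMap
  fun_prop

lemma map_val_volumeIoiPow :
    Measure.map (Subtype.val : Set.Ioi (0 : ℝ) → ℝ) (Measure.volumeIoiPow 2) = radialMeasure := by
  ext t ht
  rw [Measure.map_apply measurable_subtype_coe ht, Measure.volumeIoiPow,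
    withDensity_apply _ (measurable_subtype_coe ht), withDensity_apply _ ht,
    setLIntegral_subtype measurableSet_Ioi _ fun a : ℝ => ENNReal.ofReal (a ^ 2),
    Subtype.image_preimage_coe, Measure.restrict_restrict ht, Set.inter_comm]

instance : SFinite radialMeasure := by
  rw [← map_val_volumeIoiPow]; infer_instance

/-- Polar coordinates on the complement of the origin, moved from the half line as a subtype to a
measure on `ℝ`, and extended to the whole space because the origin is null. -/
lemma measurePreserving_polarMap :
    MeasurePreserving polarMap (sphereMeasure.prod radialMeasure) (volume : Measure E3) := by
  refine ⟨continuous_polarMap.measurable, ?_⟩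
  have h1 := (volume : Measure E3).measurePreserving_homeomorphUnitSphereProd
  have hd : Module.finrank ℝ E3 - 1 = 2 := by simp
  rw [hd] at h1
  have h2 : MeasurePreserving (homeomorphUnitSphereProd E3).symm
      (sphereMeasure.prod (Measure.volumeIoiPow 2)) (Measure.comap Subtype.val volume) :=
    h1.symm (homeomorphUnitSphereProd E3).toMeasurableEquiv
  have h3 : sphereMeasure.prod radialMeasure =
      Measure.map (Prod.map id Subtype.val) (sphereMeasure.prod (Measure.volumeIoiPow 2)) := by
    rw [← map_val_volumeIoiPow, ← Measure.map_prod_map _ _ measurable_id measurable_subtype_coe,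
      Measure.map_id]
  rw [h3, Measure.map_map continuous_polarMap.measurable
    (measurable_id.prodMap measurable_subtype_coe)]
  have e : polarMap ∘ Prod.map id Subtype.val =
      Subtype.val ∘ (homeomorphUnitSphereProd E3).symm := by
    ext p
    simp [polarMap]
  rw [e, ← Measure.map_map measurable_subtype_coe h2.measurable, h2.map_eq,
    map_comap_subtype_coe (measurableSet_singleton _).compl, restrict_compl_singleton]

lemma lintegral_polar {f : E3 → ENNReal} (hf : Measurable f) :
    ∫⁻ x, f x = ∫⁻ w, ∫⁻ s in Set.Ioi 0, ENNReal.ofReal (s ^ 2) * f (s • (w : E3)) ∂volume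
      ∂sphereMeasure := by
  rw [← measurePreserving_polarMap.lintegral_comp hf,
    lintegral_prod (fun p => f (polarMap p)) (hf.comp continuous_polarMap.measurable).aemeasurable]
  refine lintegral_congr fun w => ?_
  have hm : Measurable fun s : ℝ => f (polarMap (w, s)) :=
    hf.comp (continuous_polarMap.measurable.comp measurable_prodMk_left)
  rw [radialMeasure, lintegral_withDensity_eq_lintegral_mul _ (by fun_prop) hm]
  rfl

/-! ### A Sobolev inequality by integration along rays. -/

/-- A one-dimensional estimate for compactly supported functions on a ray. -/
lemma sq_le_integral_ray {f f' f'' : ℝ → ℝ} (h1 : ∀ s, HasDerivAt f (f' s) s)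
    (h2 : ∀ s, HasDerivAt f' (f'' s) s) (h3 : Continuous f'') {N : ℝ} (hN : 0 ≤ N)
    (hfN : f N = 0) (hf'N : f' N = 0) :
    f 0 ^ 2 ≤ ∫ s in (0 : ℝ)..N, s ^ 2 * (8 * f' s ^ 2 + 2 * f'' s ^ 2) := by
  have c1 : Continuous f' := continuous_iff_continuousAt.2 fun s => (h2 s).continuousAt
  set J := ∫ s in (0 : ℝ)..N, s ^ 2 * (8 * f' s ^ 2 + 2 * f'' s ^ 2) with hJ
  have hsub : ∀ s ∈ Set.uIcc 0 N, (0 : ℝ) < 1 + s := by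
    intro s hs
    rw [Set.uIcc_of_le hN] at hs
    linarith [hs.1]
  -- The correction vanishes at 0 and at `N`, so the integral of this derivative is `-f 0`. With `y
  -- = 1 / (1 + s)` the derivative equals `s y ((1 + y) f' - f'')`: the coefficient `1 - y²` of `f'`
  -- vanishes at `s = 0`. The factor `s` provides the weight `s²` of polar coordinates after
  -- squaring, and `y` is square integrable on the half line.
  have hd : ∀ s ∈ Set.uIcc 0 N, HasDerivAt (fun s => f s - s / (1 + s) * f' s)
      (f' s - (1 / (1 + s) ^ 2 * f' s + s / (1 + s) * f'' s)) s := by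
    intro s hs
    have hs' := (hsub s hs).ne'
    have hq : HasDerivAt (fun s : ℝ => s / (1 + s)) (1 / (1 + s) ^ 2) s := by
      have := (hasDerivAt_id s).div ((hasDerivAt_id s).const_add 1) hs'
      exact this.congr_deriv (by simp)
    exact (h1 s).sub (hq.mul (h2 s))
  have hcont : ContinuousOn (fun s => f' s - (1 / (1 + s) ^ 2 * f' s + s / (1 + s) * f'' s))
      (Set.uIcc 0 N) := by
    have a1 : ContinuousOn (fun s : ℝ => 1 / (1 + s) ^ 2) (Set.uIcc 0 N) :=
      continuousOn_const.div (by fun_prop) fun s hs => (pow_pos (hsub s hs) 2).ne'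
    have a2 : ContinuousOn (fun s : ℝ => s / (1 + s)) (Set.uIcc 0 N) :=
      continuousOn_id.div (by fun_prop) fun s hs => (hsub s hs).ne'
    exact c1.continuousOn.sub ((a1.mul c1.continuousOn).add (a2.mul h3.continuousOn))
  have hint := intervalIntegral.integral_eq_sub_of_hasDerivAt hd hcont.intervalIntegrable
  have hinv : ∫ s in (0 : ℝ)..N, 1 / (1 + s) ^ 2 = 1 - 1 / (1 + N) := by
    have hd' : ∀ s ∈ Set.uIcc 0 N, HasDerivAt (fun s => -(1 / (1 + s))) (1 / (1 + s) ^ 2) s := by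
      intro s hs
      have := ((hasDerivAt_const s (1 : ℝ)).div ((hasDerivAt_id s).const_add 1) (hsub s hs).ne').neg
      exact this.congr_deriv (by simp [neg_div])
    have hc : ContinuousOn (fun s : ℝ => 1 / (1 + s) ^ 2) (Set.uIcc 0 N) :=
      continuousOn_const.div (by fun_prop) fun s hs => (pow_pos (hsub s hs) 2).ne'
    rw [intervalIntegral.integral_eq_sub_of_hasDerivAt hd' hc.intervalIntegrable]
    ring
  -- Cauchy–Schwarz in the form of Young's inequality with a free parameter `l`, using that the
  -- integral of `1 / (1 + s)²` is at most 1.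
  have key : ∀ l : ℝ, 0 < l → |f 0| ≤ 1 / 2 * (l + J / l) := by
    intro l hl
    have e0 : |f 0| = |∫ s in (0 : ℝ)..N,
        (f' s - (1 / (1 + s) ^ 2 * f' s + s / (1 + s) * f'' s))| := by
      rw [hint, hfN, hf'N]
      simp
    have hi1 : IntervalIntegrable (fun s : ℝ => 1 / (1 + s) ^ 2) volume 0 N :=
      (continuousOn_const.div (by fun_prop)
        fun s hs => (pow_pos (hsub s hs) 2).ne').intervalIntegrable
    have hi2 : IntervalIntegrable (fun s => s ^ 2 * (8 * f' s ^ 2 + 2 * f'' s ^ 2)) volume 0 N :=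
      Continuous.intervalIntegrable (by fun_prop) _ _
    have e1 : ∫ s in (0 : ℝ)..N, 1 / 2 * (l * (1 / (1 + s) ^ 2) +
        1 / l * (s ^ 2 * (8 * f' s ^ 2 + 2 * f'' s ^ 2))) =
        1 / 2 * (l * (1 - 1 / (1 + N)) + 1 / l * J) := by
      rw [intervalIntegral.integral_const_mul, intervalIntegral.integral_add (hi1.const_mul l)
        (hi2.const_mul _), intervalIntegral.integral_const_mul,
        intervalIntegral.integral_const_mul, hinv]
    have e2 : |f 0| ≤ 1 / 2 * (l * (1 - 1 / (1 + N)) + 1 / l * J) := by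
      rw [e0, ← e1]
      refine (intervalIntegral.abs_integral_le_integral_abs hN).trans ?_
      refine intervalIntegral.integral_mono_on hN hcont.abs.intervalIntegrable
        (((hi1.const_mul l).add (hi2.const_mul _)).const_mul _) fun s hs => ?_
      have hs1 : 0 < 1 + s := by linarith [hs.1]
      have hs0 := hs.1
      set y := 1 / (1 + s) with hy
      have hy0 : 0 < y := by positivity
      have ey : s / (1 + s) = s * y := by rw [hy]; ring
      have ey2 : 1 / (1 + s) ^ 2 = y ^ 2 := by rw [hy, one_div_pow]
      have ey3 : 1 - y ^ 2 = s * y * (1 + y) := by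
        rw [hy]; field_simp; ring
      have hy1 : y ≤ 1 := by
        rw [hy, div_le_one hs1]; linarith
      rw [ey, ey2]
      have e3 : f' s - (y ^ 2 * f' s + s * y * f'' s) =
          y * (s * ((1 + y) * f' s - f'' s)) := by
        linear_combination f' s * ey3
      have e4 : |(1 + y) * f' s - f'' s| ≤ 2 * |f' s| + |f'' s| := by
        refine (abs_sub _ _).trans ?_
        rw [abs_mul, abs_of_pos (by linarith : 0 < 1 + y)]
        nlinarith [abs_nonneg (f' s)]
      set T := 2 * |f' s| + |f'' s| with hT
      have hT2 : T ^ 2 ≤ 8 * f' s ^ 2 + 2 * f'' s ^ 2 := by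
        rw [hT, ← sq_abs (f' s), ← sq_abs (f'' s)]
        nlinarith [sq_nonneg (2 * |f' s| - |f'' s|)]
      rw [e3, abs_mul, abs_mul, abs_of_pos hy0, abs_of_nonneg hs0]
      have hT0 : 0 ≤ T := by positivity
      have a1 : y * (s * |(1 + y) * f' s - f'' s|) ≤ y * (s * T) := by gcongr
      refine a1.trans ?_
      have a2 : y * (s * T) ≤ 1 / 2 * (l * y ^ 2 + 1 / l * (s ^ 2 * T ^ 2)) := by
        have : 0 ≤ 1 / l * (l * y - s * T) ^ 2 := by positivity
        have h5 : 1 / l * (l * y - s * T) ^ 2 =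
            l * y ^ 2 - 2 * (y * (s * T)) + 1 / l * (s ^ 2 * T ^ 2) := by
          field_simp
          ring
        linarith
      refine a2.trans ?_
      gcongr
    refine e2.trans ?_
    have : 0 < 1 / (1 + N) := by positivity
    have h6 : 1 / l * J = J / l := by ring
    rw [h6]
    nlinarith
  by_cases h0 : f 0 = 0
  · rw [h0, hJ]
    simp only [ne_eq, OfNat.ofNat_ne_zero, not_false_eq_true, zero_pow]
    exact intervalIntegral.integral_nonneg hN fun s _ => by positivity
  -- The choice `l = |f 0|` gives `f 0 ^ 2 ≤ (f 0 ^ 2 + J) / 2`, and half of the left side is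
  -- absorbed.
  · have hp : 0 < |f 0| := abs_pos.2 h0
    have := key _ hp
    have h7 : |f 0| * (1 / 2 * (|f 0| + J / |f 0|)) = 1 / 2 * (|f 0| ^ 2 + J) := by
      field_simp
    have h8 := mul_le_mul_of_nonneg_left this hp.le
    rw [h7] at h8
    rw [← sq_abs]
    nlinarith

lemma fderiv_eq_sum_partialD {u : E3 → ℝ} {x : E3} (w : E3) :
    fderiv ℝ u x w = ∑ i, w i * partialD i u x := by
  have hw : w = ∑ i, w i • EuclideanSpace.single i (1 : ℝ) := by
    ext j
    simp [Finset.sum_apply, Pi.single_apply]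
  conv_lhs => rw [hw]
  simp [partialD]

lemma hasDerivAt_ray {u : E3 → ℝ} (hu : ContDiff ℝ ∞ u) (x₀ w : E3) (s : ℝ) :
    HasDerivAt (fun s : ℝ => u (x₀ + s • w)) (∑ i, w i * partialD i u (x₀ + s • w)) s := by
  have h1 : HasDerivAt (fun s : ℝ => x₀ + s • w) w s := by
    simpa using ((hasDerivAt_id s).smul_const w).const_add x₀
  have h2 := (hu.contDiffAt (x := x₀ + s • w)).differentiableAt (by simp)
  have := h2.hasFDerivAt.comp_hasDerivAt s h1
  rwa [fderiv_eq_sum_partialD] at this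

lemma abs_coord_le_one {w : E3} (hw : ‖w‖ = 1) (i : Fin 3) : |w i| ≤ 1 := by
  have := EuclideanSpace.norm_eq w ▸ hw
  have h2 : ‖w i‖ ≤ ‖w‖ := PiLp.norm_apply_le w i
  rwa [hw] at h2

lemma sq_sum_le {w : E3} (hw : ‖w‖ = 1) (a : Fin 3 → ℝ) :
    (∑ i, w i * a i) ^ 2 ≤ 3 * ∑ i, a i ^ 2 := by
  refine (sq_sum_le_card_mul_sum_sq).trans ?_
  simp only [Finset.card_univ, Fintype.card_fin, Nat.cast_ofNat]
  refine mul_le_mul_of_nonneg_left (Finset.sum_le_sum fun i _ => ?_) (by norm_num)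
  rw [mul_pow]
  have := abs_coord_le_one hw i
  have h2 : (w i) ^ 2 ≤ 1 := by rw [← sq_abs]; nlinarith [abs_nonneg (w i)]
  nlinarith [sq_nonneg (a i)]

/-- A pointwise Sobolev inequality in dimension three. -/
lemma sobolev_inequality {u : E3 → ℝ} (hu : ContDiff ℝ ∞ u) (hs : HasCompactSupport u) (x₀ : E3) :
    ENNReal.ofReal (u x₀ ^ 2) * sphereMeasure Set.univ ≤
      ∫⁻ x, ENNReal.ofReal (24 * ∑ i, partialD i u x ^ 2 +
        18 * ∑ i, ∑ j, partialD i (partialD j u) x ^ 2) := by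
  set G : E3 → ℝ := fun x => 24 * ∑ i, partialD i u x ^ 2 +
        18 * ∑ i, ∑ j, partialD i (partialD j u) x ^ 2 with hG
  have cd := fun i => (contDiff_partialD hu i)
  have cdd := fun i j => (contDiff_partialD (cd j) i)
  have hGc : Continuous G := by
    have := fun i => (cd i).continuous
    have := fun i j => (cdd i j).continuous
    fun_prop
  -- Polar coordinates are centred at `x₀`. The ray estimate holds in each direction `w` with the
  -- same left side, and integration over the sphere produces its area.
  have e0 : ∫⁻ x, ENNReal.ofReal (G x) = ∫⁻ x, ENNReal.ofReal (G (x₀ + x)) :=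
    (lintegral_add_left_eq_self (fun x => ENNReal.ofReal (G x)) x₀).symm
  rw [e0, lintegral_polar (by fun_prop), ← lintegral_const]
  refine lintegral_mono fun w => ?_
  have hw : ‖(w : E3)‖ = 1 := by simp
  obtain ⟨R, hR⟩ := hs.exists_norm_bound
  set N := |R| + ‖x₀‖ + 1 with hN
  have hN0 : 0 ≤ N := by positivity
  have hlarge : R < ‖x₀ + N • (w : E3)‖ := by
    have h1 : ‖N • (w : E3)‖ ≤ ‖x₀ + N • (w : E3)‖ + ‖x₀‖ := by
      have := norm_sub_le (x₀ + N • (w : E3)) x₀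
      simpa using this
    rw [norm_smul, hw, Real.norm_of_nonneg hN0] at h1
    have := le_abs_self R
    linarith
  have hfar : ∀ᶠ y in 𝓝 (x₀ + N • (w : E3)), u y = 0 := by
    filter_upwards [continuous_norm.continuousAt.eventually (lt_mem_nhds hlarge)] with y hy
    exact hR y hy
  have hfar' : ∀ i, partialD i u (x₀ + N • (w : E3)) = 0 := by
    intro i
    have : u =ᶠ[𝓝 (x₀ + N • (w : E3))] fun _ => 0 := hfar
    simp [partialD, this.fderiv_eq]
  have key := sq_le_integral_ray (f := fun s => u (x₀ + s • (w : E3)))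
    (f' := fun s => ∑ i, (w : E3) i * partialD i u (x₀ + s • (w : E3)))
    (f'' := fun s => ∑ i, (w : E3) i * ∑ j, (w : E3) j * partialD j (partialD i u) (x₀ + s • (w : E3)))
    (fun s => hasDerivAt_ray hu x₀ w s)
    (fun s => HasDerivAt.fun_sum fun i _ => (hasDerivAt_ray (cd i) x₀ w s).const_mul _)
    (by
      have := fun i j => (cdd i j).continuous
      fun_prop)
    hN0 hfar.self_of_nhds (by simp [hfar'])
  simp only [zero_smul, add_zero] at key
  have key2 : u x₀ ^ 2 ≤ ∫ s in (0 : ℝ)..N, s ^ 2 * G (x₀ + s • (w : E3)) := by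
    refine key.trans (intervalIntegral.integral_mono_on hN0 ?_ ?_ fun s hs => ?_)
    · refine Continuous.intervalIntegrable ?_ _ _
      have := fun i => (cd i).continuous
      have := fun i j => (cdd i j).continuous
      fun_prop
    · exact Continuous.intervalIntegrable (by fun_prop) _ _
    · refine mul_le_mul_of_nonneg_left ?_ (sq_nonneg s)
      -- Each contraction with the unit vector `w` costs a factor 3; this turns the constants 8 and
      -- 2 of the ray estimate into `8 * 3 = 24` and `2 * 3 * 3 = 18`.
      have h1 := sq_sum_le hw fun i => partialD i u (x₀ + s • (w : E3))
      have h2 := sq_sum_le hw fun i => ∑ j, (w : E3) j * partialD j (partialD i u) (x₀ + s • (w : E3))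
      have h3 : ∑ i, (∑ j, (w : E3) j * partialD j (partialD i u) (x₀ + s • (w : E3))) ^ 2 ≤
          ∑ i, 3 * ∑ j, partialD j (partialD i u) (x₀ + s • (w : E3)) ^ 2 :=
        Finset.sum_le_sum fun i _ => sq_sum_le hw _
      rw [← Finset.mul_sum, Finset.sum_comm] at h3
      simp only [hG]
      linarith
  calc ENNReal.ofReal (u x₀ ^ 2)
      ≤ ENNReal.ofReal (∫ s in (0 : ℝ)..N, s ^ 2 * G (x₀ + s • (w : E3))) :=
        ENNReal.ofReal_le_ofReal key2
    _ = ∫⁻ s in Set.Ioc 0 N, ENNReal.ofReal (s ^ 2 * G (x₀ + s • (w : E3))) := by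
        rw [intervalIntegral.integral_of_le hN0]
        refine ofReal_integral_eq_lintegral_ofReal ?_ ?_
        · exact (Continuous.intervalIntegrable (by fun_prop) 0 N).1
        · refine Eventually.of_forall fun s => ?_
          simp only [hG, Pi.zero_apply]
          positivity
    _ ≤ ∫⁻ s in Set.Ioi 0, ENNReal.ofReal (s ^ 2 * G (x₀ + s • (w : E3))) :=
        lintegral_mono_set Set.Ioc_subset_Ioi_self
    _ = _ := by
        refine lintegral_congr fun s => ?_
        rw [ENNReal.ofReal_mul (sq_nonneg s)]

/-! ### The space `H̄²_{-1/2}`: identification of derivatives and uniform convergence. -/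

namespace Background

/-- The weight `r ^ (-2 δ - 3)` is the square of `r ^ (-δ - 3 / 2)`. For `δ = -1/2 - j` the exponent
is `j - 1`: the weights are -1, 0, 1 for a function and its first and second derivatives. -/
lemma wNorm_two (B : Background) (δ : ℝ) (u : E3 → ℝ) :
    B.wNorm 2 δ u = eLpNorm (fun x => B.r x ^ (-δ - 3 / 2) * u x) 2 B.vol := by
  rw [eLpNorm_eq_lintegral_rpow_enorm_toReal (by norm_num) (by norm_num)]
  simp only [wNorm, ENNReal.toReal_ofNat]
  congr 1
  refine lintegral_congr_ae ?_
  filter_upwards [B.ae_mem_U] with x hx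
  have hr := B.r_pos (B.U_subset_M hx)
  rw [Real.enorm_eq_ofReal_abs, ENNReal.ofReal_rpow_of_nonneg (abs_nonneg _) (by norm_num),
    abs_mul, abs_of_pos (Real.rpow_pos_of_pos hr _),
    Real.mul_rpow (Real.rpow_pos_of_pos hr _).le (abs_nonneg _), ← Real.rpow_mul hr.le, mul_comm]
  ring_nf

variable {B : Background}

/-- For `δ = -3/2` the weight at order zero is trivial, so momenta are plainly square integrable.
Nothing about their derivatives is used. -/
lemma MemCompletion.L2w_zero {T : Set (E3 → ℝ)} {u : E3 → ℝ}
    (hT : ∀ ψ ∈ T, Continuous ψ ∧ HasCompactSupport ψ)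
    (h : B.MemCompletion T 1 2 (-3 / 2) u) : B.L2w 0 u := by
  obtain ⟨D, hD, hDm, ψ, hψ, hlim⟩ := h
  have h0 := hlim [] (by simp)
  have hm := hDm [] (by simp)
  simp only [wNorm_two, iterPartialD] at h0
  obtain ⟨n, hn⟩ := ((ENNReal.tendsto_nhds_zero.1 h0) 1 one_pos).exists
  have e : (-(-3 / 2 - (([] : List (Fin 3)).length : ℝ)) - 3 / 2) = 0 := by norm_num
  rw [e] at hn
  have hψ' : B.L2w 0 (ψ n) := L2w.of_continuous (hT _ (hψ n)).1 (hT _ (hψ n)).2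
  exact (hψ'.of_eLpNorm_sub hm (lt_of_le_of_lt hn ENNReal.one_lt_top)).congr hD

/-- Smooth functions `ψ n` with compact support in the interior which approximate `u` with two
derivatives, in the weighted norms of `H²_{-1/2}`. -/
structure H2Approx (B : Background) (u : E3 → ℝ) (ψ : ℕ → E3 → ℝ) : Prop where
  test : ∀ n, ψ n ∈ B.testFunctions
  mem₀ : B.L2w (-1) u
  mem₁ : ∀ i, B.L2w 0 (B.wd i u)
  mem₂ : ∀ i j, B.L2w 1 (B.wd i (B.wd j u))
  lim₀ : B.TendstoL2w (-1) ψ u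
  lim₁ : ∀ i, B.TendstoL2w 0 (fun n => partialD i (ψ n)) (B.wd i u)
  lim₂ : ∀ i j, B.TendstoL2w 1 (fun n => partialD i (partialD j (ψ n))) (B.wd i (B.wd j u))
  weak₂ : ∀ i j, B.HasWeakPartial i (B.wd j u) (B.wd i (B.wd j u))

lemma TendstoL2w.congr_right {s : ℝ} {u : ℕ → E3 → ℝ} {v w : E3 → ℝ} (h : B.TendstoL2w s u v)
    (hvw : v =ᵐ[B.vol] w) : B.TendstoL2w s u w := by
  refine Tendsto.congr (fun n => eLpNorm_congr_ae ?_) h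
  filter_upwards [hvw] with x hx
  rw [hx]

/-- The limits `D l` in the completion are weak derivatives of one another, because weak derivatives
are closed under convergence; uniqueness then identifies them with the representatives chosen by
`wd`. -/
lemma MemWbar.exists_H2Approx {u : E3 → ℝ} (h : B.MemWbar 2 2 (-1 / 2) u) :
    ∃ ψ, B.H2Approx u ψ := by
  obtain ⟨D, hD, hDm, ψ, hψ, hlim⟩ := h
  have hlim' : ∀ (l : List (Fin 3)) (s : ℝ), l.length ≤ 2 → s = l.length - 1 →
      B.TendstoL2w s (fun n => iterPartialD l (ψ n)) (D l) := by
    intro l s hl hs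
    have h0 := hlim l hl
    simp only [wNorm_two] at h0
    have e : (-(-1 / 2 - (l.length : ℝ)) - 3 / 2) = s := by rw [hs]; ring
    rw [e] at h0
    refine h0.congr fun n => ?_
    rw [← eLpNorm_neg]
    congr 1
    ext x
    simp only [Pi.neg_apply]
    ring
  have htest : ∀ (l : List (Fin 3)) n, iterPartialD l (ψ n) ∈ B.testFunctions := by
    intro l n
    induction l with
    | nil => exact hψ n
    | cons i l ih => exact partialD_mem_testFunctions ih i
  have hmem : ∀ (l : List (Fin 3)) (s : ℝ), l.length ≤ 2 → s = l.length - 1 → B.L2w s (D l) := by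
    intro l s hl hs
    obtain ⟨n, hn⟩ := ((ENNReal.tendsto_nhds_zero.1 (hlim' l s hl hs)) 1 one_pos).exists
    have h1 : B.L2w s (iterPartialD l (ψ n)) := L2w.of_test (htest l n)
    refine h1.of_eLpNorm_sub (hDm l hl) (lt_of_le_of_lt ?_ ENNReal.one_lt_top)
    rw [← eLpNorm_neg]
    refine le_trans (le_of_eq ?_) hn
    congr 1
    ext x
    simp only [Pi.neg_apply]
    ring
  have hweak : ∀ (i : Fin 3) (l : List (Fin 3)), l.length ≤ 1 →
      B.HasWeakPartial i (D l) (D (i :: l)) := by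
    intro i l hl
    have hl2 : (i :: l).length ≤ 2 := by simpa using hl
    refine HasWeakPartial.of_tendsto (s := (l.length : ℝ) - 1) (t := ((i :: l).length : ℝ) - 1)
      (U := fun n => iterPartialD l (ψ n)) (V := fun n => iterPartialD (i :: l) (ψ n))
      (fun n => HasWeakPartial.of_contDiffOn (htest l n).1.contDiffOn)
      (Eventually.of_forall fun n => L2w.of_test (htest l n))
      (Eventually.of_forall fun n => L2w.of_test (htest (i :: l) n))
      (hmem l _ (by omega) rfl) (hmem _ _ hl2 rfl) (hlim' l _ (by omega) rfl) (hlim' _ _ hl2 rfl)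
  have w1 : ∀ i, B.HasWeakPartial i u (D [i]) := fun i => (hweak i [] (by simp)).congr hD .rfl
  have e1 : ∀ i, B.wd i u =ᵐ[B.vol] D [i] := fun i => (w1 i).wd_eq
  have w2 : ∀ i j, B.HasWeakPartial i (B.wd j u) (D [i, j]) := fun i j =>
    (hweak i [j] (by simp)).congr (e1 j).symm .rfl
  have e2 : ∀ i j, B.wd i (B.wd j u) =ᵐ[B.vol] D [i, j] := fun i j => (w2 i j).wd_eq
  refine ⟨ψ, hψ, (hmem [] (-1) (by simp) (by simp)).congr hD,
    fun i => (hmem [i] 0 (by simp) (by simp)).congr (e1 i).symm,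
    fun i j => (hmem [i, j] 1 (by simp) (by norm_num)).congr (e2 i j).symm,
    (hlim' [] (-1) (by simp) (by simp)).congr_right hD,
    fun i => (hlim' [i] 0 (by simp) (by simp)).congr_right (e1 i).symm,
    fun i j => (hlim' [i, j] 1 (by simp) (by norm_num)).congr_right (e2 i j).symm,
    fun i j => (w2 i j).self_wd⟩

/-- Since `r ≥ 1/2`, one has `1 ≤ (2 r) ^ s`. So the unweighted norms in the Sobolev inequality are
controlled by the weighted ones. -/
lemma lintegral_sq_test {s : ℝ} (hs : 0 ≤ s) {ψ : E3 → ℝ} (hψ : ψ ∈ B.testFunctions) :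
    ∫⁻ x, ENNReal.ofReal (ψ x ^ 2) ≤
      ENNReal.ofReal (2 ^ s) ^ 2 * eLpNorm (fun x => B.r x ^ s * ψ x) 2 B.vol ^ 2 := by
  have h0 : ∫⁻ x, ENNReal.ofReal (ψ x ^ 2) = ∫⁻ x in B.U, ENNReal.ofReal (ψ x ^ 2) := by
    refine (setLIntegral_eq_of_support_subset ?_).symm
    intro x hx
    refine hψ.2.2 (subset_tsupport _ ?_)
    intro h
    exact hx (by simp [h])
  have h1 : eLpNorm (fun x => B.r x ^ s * ψ x) 2 B.vol ^ 2 =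
      ∫⁻ x in B.U, ENNReal.ofReal ((B.r x ^ s * ψ x) ^ 2) := by
    have := eLpNorm_nnreal_pow_eq_lintegral (f := fun x => B.r x ^ s * ψ x) (μ := B.vol) (p := 2)
      (by norm_num)
    simp only [NNReal.coe_ofNat, ENNReal.rpow_ofNat, ENNReal.coe_ofNat] at this
    rw [this]
    refine lintegral_congr fun x => ?_
    rw [Real.enorm_eq_ofReal_abs, ← ENNReal.ofReal_pow (abs_nonneg _), sq_abs]
  rw [h0, h1, ← lintegral_const_mul' _ _ (by simp)]
  refine lintegral_mono_ae ?_
  filter_upwards [B.ae_mem_U] with x hx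
  rw [← ENNReal.ofReal_pow (by positivity), ← ENNReal.ofReal_mul (by positivity)]
  refine ENNReal.ofReal_le_ofReal ?_
  have hr := B.r_pos (B.U_subset_M hx)
  have h2 := B.half_le_r (B.U_subset_M hx)
  have h3 : 1 ≤ 2 ^ s * B.r x ^ s := by
    rw [← Real.mul_rpow (by norm_num) hr.le]
    exact Real.one_le_rpow (by linarith) hs
  have h4 : (2 ^ s) ^ 2 * (B.r x ^ s * ψ x) ^ 2 = (2 ^ s * B.r x ^ s) ^ 2 * ψ x ^ 2 := by ring
  rw [h4]
  exact le_mul_of_one_le_left (sq_nonneg _) (one_le_pow₀ h3)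

/-- The Sobolev inequality applied to `ψ n - ψ m`. It involves only first and second derivatives,
whose weights 0 and 1 are nonnegative, so `lintegral_sq_test` applies. -/
lemma H2Approx.cauchy {u : E3 → ℝ} {ψ : ℕ → E3 → ℝ} (h : B.H2Approx u ψ) {ε : ℝ} (hε : 0 < ε) :
    ∃ N, ∀ n ≥ N, ∀ m ≥ N, ∀ x, |ψ n x - ψ m x| ≤ ε := by
  set κ := sphereMeasure Set.univ with hκ
  have hκ0 : κ ≠ 0 := Measure.measure_univ_ne_zero.2 (Measure.toSphere_ne_zero _)
  have hκt : κ ≠ ⊤ := measure_ne_top _ _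
  set I : ℕ → Fin 3 → ENNReal := fun n i =>
    eLpNorm (fun x => B.r x ^ (0 : ℝ) * (partialD i (ψ n) x - B.wd i u x)) 2 B.vol with hI
  set J : ℕ → Fin 3 → Fin 3 → ENNReal := fun n i j =>
    eLpNorm (fun x => B.r x ^ (1 : ℝ) * (partialD i (partialD j (ψ n)) x -
      B.wd i (B.wd j u) x)) 2 B.vol with hJ
  set S : ℕ × ℕ → ENNReal := fun p =>
    24 * ∑ i, (ENNReal.ofReal (2 ^ (0 : ℝ)) ^ 2 * (I p.1 i + I p.2 i) ^ 2) +
      18 * ∑ i, ∑ j, (ENNReal.ofReal (2 ^ (1 : ℝ)) ^ 2 * (J p.1 i j + J p.2 i j) ^ 2) with hS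
  have hSlim : Tendsto S (atTop ×ˢ atTop) (𝓝 0) := by
    have t1 : ∀ i, Tendsto (fun p : ℕ × ℕ => I p.1 i + I p.2 i) (atTop ×ˢ atTop) (𝓝 (0 + 0)) :=
      fun i => ((h.lim₁ i).comp tendsto_fst).add ((h.lim₁ i).comp tendsto_snd)
    have t2 : ∀ i j, Tendsto (fun p : ℕ × ℕ => J p.1 i j + J p.2 i j) (atTop ×ˢ atTop)
        (𝓝 (0 + 0)) :=
      fun i j => ((h.lim₂ i j).comp tendsto_fst).add ((h.lim₂ i j).comp tendsto_snd)
    have t1' : ∀ i, Tendsto (fun p : ℕ × ℕ => ENNReal.ofReal (2 ^ (0 : ℝ)) ^ 2 *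
        (I p.1 i + I p.2 i) ^ 2) (atTop ×ˢ atTop) (𝓝 0) := fun i => by
      have := ENNReal.Tendsto.const_mul (a := ENNReal.ofReal (2 ^ (0 : ℝ)) ^ 2)
        (ENNReal.Tendsto.pow (n := 2) (t1 i)) (Or.inr (by simp))
      simpa using this
    have t2' : ∀ i j, Tendsto (fun p : ℕ × ℕ => ENNReal.ofReal (2 ^ (1 : ℝ)) ^ 2 *
        (J p.1 i j + J p.2 i j) ^ 2) (atTop ×ˢ atTop) (𝓝 0) := fun i j => by
      have := ENNReal.Tendsto.const_mul (a := ENNReal.ofReal (2 ^ (1 : ℝ)) ^ 2)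
        (ENNReal.Tendsto.pow (n := 2) (t2 i j)) (Or.inr (by simp))
      simpa using this
    have s1 := ENNReal.Tendsto.const_mul (a := 24) (tendsto_finsetSum Finset.univ fun i _ => t1' i)
      (Or.inr (by simp))
    have s2 := ENNReal.Tendsto.const_mul (a := 18) (tendsto_finsetSum Finset.univ fun i _ =>
      tendsto_finsetSum Finset.univ fun j _ => t2' i j) (Or.inr (by simp))
    have s3 := s1.add s2
    simp only [Finset.sum_const_zero, mul_zero, add_zero] at s3
    exact s3
  have hpos : 0 < ENNReal.ofReal (ε ^ 2) * κ :=
    ENNReal.mul_pos (ENNReal.ofReal_pos.2 (by positivity)).ne' hκ0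
  have hev := (ENNReal.tendsto_nhds_zero.1 hSlim) _ hpos
  rw [prod_atTop_atTop_eq, eventually_atTop] at hev
  obtain ⟨⟨N1, N2⟩, hN⟩ := hev
  refine ⟨max N1 N2, fun n hn m hm x => ?_⟩
  have hle := hN (n, m) ⟨(le_max_left _ _).trans hn, (le_max_right _ _).trans hm⟩
  set v : E3 → ℝ := fun x => ψ n x - ψ m x with hv
  have hvc : ContDiff ℝ ∞ v := (h.test n).1.sub (h.test m).1
  have hvs : HasCompactSupport v := (h.test n).2.1.sub (h.test m).2.1
  have hvt : v ∈ B.testFunctions :=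
    ⟨hvc, hvs, (tsupport_sub _ _).trans (Set.union_subset (h.test n).2.2 (h.test m).2.2)⟩
  have dsub : ∀ {f g : E3 → ℝ}, ContDiff ℝ ∞ f → ContDiff ℝ ∞ g → ∀ i,
      partialD i (fun x => f x - g x) = fun x => partialD i f x - partialD i g x := by
    intro f g hf hg i
    ext x
    simp only [partialD]
    rw [fderiv_fun_sub (hf.differentiable (by simp) x) (hg.differentiable (by simp) x)]
    rfl
  have tri : ∀ (s : ℝ) (f g w : E3 → ℝ), f ∈ B.testFunctions → g ∈ B.testFunctions → B.L2w s w →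
      eLpNorm (fun x => B.r x ^ s * (f x - g x)) 2 B.vol ≤
        eLpNorm (fun x => B.r x ^ s * (f x - w x)) 2 B.vol +
        eLpNorm (fun x => B.r x ^ s * (g x - w x)) 2 B.vol := by
    intro s f g w hf hg hw
    have := eLpNorm_sub_le ((L2w.of_test (s := s) hf).sub hw).1
      ((L2w.of_test (s := s) hg).sub hw).1 (by norm_num : (1 : ENNReal) ≤ 2)
    refine le_trans (le_of_eq ?_) this
    congr 1
    ext x
    simp only [Pi.sub_apply]
    ring
  have d1 : ∀ i, partialD i v = fun x => partialD i (ψ n) x - partialD i (ψ m) x :=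
    dsub (h.test n).1 (h.test m).1
  have d2 : ∀ i j, partialD i (partialD j v) =
      fun x => partialD i (partialD j (ψ n)) x - partialD i (partialD j (ψ m)) x := by
    intro i j
    rw [d1 j]
    exact dsub (contDiff_partialD (h.test n).1 j) (contDiff_partialD (h.test m).1 j) i
  have b1 : ∀ i, ∫⁻ x, ENNReal.ofReal (partialD i v x ^ 2) ≤
      ENNReal.ofReal (2 ^ (0 : ℝ)) ^ 2 * (I n i + I m i) ^ 2 := by
    intro i
    refine (lintegral_sq_test (s := 0) le_rfl (partialD_mem_testFunctions hvt i)).trans ?_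
    gcongr
    rw [d1 i]
    exact tri 0 _ _ _ (partialD_mem_testFunctions (h.test n) i)
      (partialD_mem_testFunctions (h.test m) i) (h.mem₁ i)
  have b2 : ∀ i j, ∫⁻ x, ENNReal.ofReal (partialD i (partialD j v) x ^ 2) ≤
      ENNReal.ofReal (2 ^ (1 : ℝ)) ^ 2 * (J n i j + J m i j) ^ 2 := by
    intro i j
    refine (lintegral_sq_test (s := 1) zero_le_one (partialD_mem_testFunctions
      (partialD_mem_testFunctions hvt j) i)).trans ?_
    gcongr
    rw [d2 i j]
    exact tri 1 _ _ _ (partialD_mem_testFunctions (partialD_mem_testFunctions (h.test n) j) i)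
      (partialD_mem_testFunctions (partialD_mem_testFunctions (h.test m) j) i) (h.mem₂ i j)
  have c1 : ∀ i, Continuous (partialD i v) := fun i => (contDiff_partialD hvc i).continuous
  have c2 : ∀ i j, Continuous (partialD i (partialD j v)) := fun i j =>
    (contDiff_partialD (contDiff_partialD hvc j) i).continuous
  have hsob := sobolev_inequality hvc hvs x
  have hsum : ∫⁻ x, ENNReal.ofReal (24 * ∑ i, partialD i v x ^ 2 +
        18 * ∑ i, ∑ j, partialD i (partialD j v) x ^ 2) =
      24 * (∑ i, ∫⁻ x, ENNReal.ofReal (partialD i v x ^ 2)) +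
        18 * ∑ i, ∑ j, ∫⁻ x, ENNReal.ofReal (partialD i (partialD j v) x ^ 2) := by
    have e : ∀ x, ENNReal.ofReal (24 * ∑ i, partialD i v x ^ 2 +
        18 * ∑ i, ∑ j, partialD i (partialD j v) x ^ 2) =
        24 * ∑ i, ENNReal.ofReal (partialD i v x ^ 2) +
        18 * ∑ i, ∑ j, ENNReal.ofReal (partialD i (partialD j v) x ^ 2) := by
      intro x
      rw [ENNReal.ofReal_add (by positivity) (by positivity), ENNReal.ofReal_mul (by norm_num),
        ENNReal.ofReal_mul (by norm_num), ENNReal.ofReal_sum_of_nonneg (fun _ _ => by positivity),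
        ENNReal.ofReal_sum_of_nonneg (fun _ _ => by positivity)]
      simp_rw [ENNReal.ofReal_sum_of_nonneg (fun _ _ => sq_nonneg _)]
      simp
    simp_rw [e]
    rw [lintegral_add_left (by fun_prop), lintegral_const_mul _ (by fun_prop),
      lintegral_const_mul _ (by fun_prop), lintegral_finsetSum _ (fun i _ => by fun_prop),
      lintegral_finsetSum _ (fun i _ => by fun_prop)]
    congr 2
    refine Finset.sum_congr rfl fun i _ => ?_
    rw [lintegral_finsetSum _ (fun j _ => by fun_prop)]
  have hfin : ENNReal.ofReal (v x ^ 2) * κ ≤ ENNReal.ofReal (ε ^ 2) * κ := by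
    refine hsob.trans (le_trans ?_ hle)
    rw [hsum]
    simp only [hS]
    gcongr with i _ i _ j _
    · exact b1 i
    · exact b2 i j
  rw [ENNReal.mul_le_mul_iff_left hκ0 hκt, ENNReal.ofReal_le_ofReal_iff (by positivity)] at hfin
  exact abs_le_of_sq_le_sq hfin hε.le

/-- The sequence is uniformly Cauchy, and the weighted `L²` convergence gives a subsequence
converging almost everywhere, which identifies the uniform limit as `u`. -/
lemma H2Approx.tendstoUnif {u : E3 → ℝ} {ψ : ℕ → E3 → ℝ} (h : B.H2Approx u ψ) :
    B.TendstoUnif ψ u := by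
  intro ε hε
  obtain ⟨N, hN⟩ := h.cauchy hε
  have hmeas : TendstoInMeasure B.vol (fun n x => B.r x ^ (-1 : ℝ) * ψ n x) atTop
      (fun x => B.r x ^ (-1 : ℝ) * u x) := by
    refine tendstoInMeasure_of_tendsto_eLpNorm (p := 2) (by norm_num)
      (fun n => (L2w.of_test (h.test n)).1) h.mem₀.1 (h.lim₀.congr fun n => ?_)
    congr 1
    ext x
    simp only [Pi.sub_apply]
    ring
  obtain ⟨k, hk, hlim⟩ := hmeas.exists_seq_tendsto_ae
  filter_upwards [eventually_ge_atTop N] with n hn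
  filter_upwards [hlim, B.ae_mem_U] with x hx hU
  have hr := Real.rpow_pos_of_pos (B.r_pos (B.U_subset_M hU)) (-1)
  have hx' : Tendsto (fun i => ψ (k i) x) atTop (𝓝 (u x)) := by
    have := hx.const_mul (B.r x ^ (-1 : ℝ))⁻¹
    simpa [inv_mul_cancel_left₀ hr.ne'] using this
  refine le_of_tendsto ((tendsto_const_nhds.sub hx').abs) ?_
  filter_upwards [hk.tendsto_atTop.eventually_ge_atTop N] with i hi
  exact hN n hn _ hi x

lemma H2Approx.coef {u : E3 → ℝ} {ψ : ℕ → E3 → ℝ} (h : B.H2Approx u ψ) :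
    B.Coef u (fun i => B.wd i u) 0 := by
  refine ⟨h.mem₀.aesm, ?_, by simpa using h.mem₀, h.mem₁, ψ,
    Eventually.of_forall fun n => (h.test n).1.contDiffOn, h.tendstoUnif, h.lim₁⟩
  obtain ⟨n, hn⟩ := (h.tendstoUnif 1 one_pos).exists
  obtain ⟨C, hC⟩ := (h.test n).2.1.exists_bound_of_continuous (h.test n).1.continuous
  refine ⟨C + 1, ?_⟩
  filter_upwards [hn] with x hx
  have h1 := hC x
  have h2 := abs_sub_abs_le_abs_sub (u x) (ψ n x)
  rw [Real.norm_eq_abs] at h1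
  rw [abs_sub_comm] at hx
  linarith

lemma H2Approx.small_at_infinity {u : E3 → ℝ} {ψ : ℕ → E3 → ℝ} (h : B.H2Approx u ψ) {ε : ℝ}
    (hε : 0 < ε) : ∃ R : ℝ, ∀ᵐ x ∂B.vol, R < ‖x‖ → |u x| ≤ ε := by
  obtain ⟨n, hn⟩ := (h.tendstoUnif ε hε).exists
  obtain ⟨R, hR⟩ := (h.test n).2.1.exists_norm_bound
  refine ⟨R, ?_⟩
  filter_upwards [hn] with x hx hxR
  simpa [hR x hxR] using hx

end Background

/-! ### Fluxes through spheres and the divergence theorem for weak divergences. -/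

lemma ae_radialMeasure_iff {p : ℝ → Prop} :
    (∀ᵐ s ∂radialMeasure, p s) ↔ ∀ᵐ s ∂volume.restrict (Set.Ioi (0 : ℝ)), p s := by
  rw [radialMeasure, ae_withDensity_iff (by fun_prop)]
  refine ⟨fun h => ?_, fun h => h.mono fun s hs _ => hs⟩
  filter_upwards [h, ae_restrict_mem measurableSet_Ioi] with s hs h0
  exact hs (ENNReal.ofReal_pos.2 (pow_pos h0 2)).ne'

lemma integral_polar {F : E3 → ℝ} (hF : Integrable F) :
    (∀ᵐ R ∂volume.restrict (Set.Ioi (0 : ℝ)),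
      Integrable (fun w : Metric.sphere (0 : E3) 1 => F (R • (w : E3))) sphereMeasure) ∧
    IntegrableOn (fun R : ℝ => R ^ 2 * ∫ w : Metric.sphere (0 : E3) 1, F (R • (w : E3))
      ∂sphereMeasure) (Set.Ioi 0) ∧
    ∫ x, F x = ∫ R in Set.Ioi (0 : ℝ), R ^ 2 * ∫ w : Metric.sphere (0 : E3) 1, F (R • (w : E3))
      ∂sphereMeasure := by
  have h1 : Integrable (fun p => F (polarMap p)) (sphereMeasure.prod radialMeasure) :=
    measurePreserving_polarMap.integrable_comp_of_integrable hF
  have hd : ∀ G : ℝ → ℝ, ∀ᵐ s ∂volume.restrict (Set.Ioi (0 : ℝ)),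
      (ENNReal.ofReal (s ^ 2)).toReal • G s = s ^ 2 * G s := by
    intro G
    refine Eventually.of_forall fun s => ?_
    rw [ENNReal.toReal_ofReal (sq_nonneg s), smul_eq_mul]
  refine ⟨ae_radialMeasure_iff.1 h1.prod_left_ae, ?_, ?_⟩
  · have h2 := h1.integral_prod_right
    rw [radialMeasure, integrable_withDensity_iff_integrable_smul' (by fun_prop) (by simp)] at h2
    exact h2.congr (hd _)
  · have h2 := integral_prod_symm _ h1
    have h3 : ∫ x, F x = ∫ p, F (polarMap p) ∂(sphereMeasure.prod radialMeasure) := by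
      conv_lhs => rw [← measurePreserving_polarMap.map_eq]
      refine integral_map continuous_polarMap.measurable.aemeasurable ?_
      rw [measurePreserving_polarMap.map_eq]
      exact hF.1
    rw [h3, h2, radialMeasure, integral_withDensity_eq_integral_toReal_smul (by fun_prop)
      (by simp)]
    exact integral_congr_ae (hd _)

/-- The radial component of a vector field. -/
noncomputable def radialPart (V : Fin 3 → E3 → ℝ) (x : E3) : ℝ := ∑ j, V j x * (x j / ‖x‖)

/-- The flux of a vector field through the sphere of radius `R`. -/
noncomputable def sphereFlux (V : Fin 3 → E3 → ℝ) (R : ℝ) : ℝ :=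
  R ^ 2 * ∫ w : Metric.sphere (0 : E3) 1, radialPart V (R • (w : E3)) ∂sphereMeasure

/-- The flux of `V` through large spheres is defined and tends to `L`, along almost all radii. -/
def HasFlux (V : Fin 3 → E3 → ℝ) (L : ℝ) : Prop :=
  (∀ᵐ R : ℝ, 1 < R → Integrable
    (fun w : Metric.sphere (0 : E3) 1 => radialPart V (R • (w : E3))) sphereMeasure) ∧
  Tendsto (sphereFlux V) (atTop ⊓ ae volume) (𝓝 L)

lemma abs_coord_div_norm_le (x : E3) (j : Fin 3) : |x j / ‖x‖| ≤ 1 := by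
  rw [abs_div, abs_norm]
  exact div_le_one_of_le₀ (PiLp.norm_apply_le x j) (norm_nonneg _)

lemma integrable_mul_coord {V : E3 → ℝ} (hV : Integrable V) (j : Fin 3) :
    Integrable fun x => V x * (x j / ‖x‖) := by
  refine hV.mul_bdd (c := 1) ?_ (Eventually.of_forall fun x => abs_coord_div_norm_le x j)
  have h1 : Measurable fun x : E3 => x j := by fun_prop
  exact (h1.div measurable_norm).aestronglyMeasurable

lemma integrable_radialPart {V : Fin 3 → E3 → ℝ} (hV : ∀ j, Integrable (V j)) :
    Integrable (radialPart V) :=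
  integrable_finsetSum _ fun j _ => integrable_mul_coord (hV j) j

lemma norm_smul_sphere {R : ℝ} (hR : 0 < R) (w : Metric.sphere (0 : E3) 1) :
    ‖R • (w : E3)‖ = R := by
  rw [norm_smul, Real.norm_of_nonneg hR.le]
  simp

/-- By Fubini a null set meets almost every sphere in a null set. Hence the flux of a field defined
up to null sets is well defined for almost every radius. -/
lemma ae_sphere_of_ae {p : E3 → Prop} (h : ∀ᵐ x, p x) :
    ∀ᵐ R ∂volume.restrict (Set.Ioi (0 : ℝ)),
      ∀ᵐ w : Metric.sphere (0 : E3) 1 ∂sphereMeasure, p (R • (w : E3)) := by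
  have h1 : ∀ᵐ q ∂(sphereMeasure.prod radialMeasure), p (polarMap q) :=
    measurePreserving_polarMap.quasiMeasurePreserving.ae h
  have h2 : ∀ᵐ q ∂(radialMeasure.prod sphereMeasure), p (polarMap q.swap) :=
    Measure.measurePreserving_swap.quasiMeasurePreserving.ae h1
  exact ae_radialMeasure_iff.1 (Measure.ae_ae_of_ae_prod h2)

/-- The radial antiderivative of a function supported in `(0, b)`. -/
lemma exists_radial_primitive {η : ℝ → ℝ} (hη : ContDiff ℝ ∞ η) {a b : ℝ} (ha : 0 < a)
    (hab : ∀ t, t ∉ Set.Icc a b → η t = 0) :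
    ∃ ψ : E3 → ℝ, ContDiff ℝ ∞ ψ ∧ HasCompactSupport ψ ∧
      (∀ j x, partialD j ψ x = η ‖x‖ * (x j / ‖x‖)) ∧
      ∀ x, ψ x = - ∫ t, (if ‖x‖ < t then η t else 0) := by
  -- Based at `b + 1`, the primitive vanishes beyond `b`, which gives compact support. Below `a > 0`
  -- it is constant, so `χ ‖x‖` is smooth at the origin although the norm is not.
  set χ : ℝ → ℝ := fun t => ∫ s in (b + 1)..t, η s with hχ
  have hχd : ∀ t, HasDerivAt χ (η t) t := fun t =>
    intervalIntegral.integral_hasDerivAt_right (hη.continuous.intervalIntegrable _ _)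
      (hη.continuous.stronglyMeasurableAtFilter _ _) hη.continuous.continuousAt
  have hχs : ContDiff ℝ ∞ χ := by
    rw [contDiff_infty_iff_deriv]
    refine ⟨fun t => (hχd t).differentiableAt, ?_⟩
    have : deriv χ = η := by
      ext t
      exact (hχd t).deriv
    rwa [this]
  have hχ0 : ∀ t, b < t → χ t = 0 := by
    intro t ht
    refine intervalIntegral.integral_zero_ae (Eventually.of_forall fun s hs => hab s fun h => ?_)
    rcases Set.mem_uIoc.1 hs with h1 | h1 <;> linarith [h.2, h1.1]
  have hχc : ∀ t, t < a → χ t = χ 0 := by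
    intro t ht
    have : χ t - χ 0 = ∫ s in (0 : ℝ)..t, η s :=
      intervalIntegral.integral_interval_sub_left (hη.continuous.intervalIntegrable _ _)
        (hη.continuous.intervalIntegrable _ _)
    have h0 : ∫ s in (0 : ℝ)..t, η s = 0 := by
      refine intervalIntegral.integral_zero_ae (Eventually.of_forall fun s hs => hab s fun h => ?_)
      rcases Set.mem_uIoc.1 hs with h1 | h1 <;> linarith [h.1, h1.2]
    linarith
  have hcd : ∀ x : E3, x ≠ 0 → HasFDerivAt (fun x : E3 => χ ‖x‖)
      (η ‖x‖ • fderiv ℝ (fun x : E3 => ‖x‖) x) x := by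
    intro x hx
    have h1 : DifferentiableAt ℝ (fun x : E3 => ‖x‖) x :=
      (contDiffAt_norm ℝ (n := 1) hx).differentiableAt (by simp)
    exact (hχd ‖x‖).comp_hasFDerivAt x h1.hasFDerivAt
  have hnear : ∀ x : E3, ‖x‖ < a → (fun x : E3 => χ ‖x‖) =ᶠ[𝓝 x] fun _ => χ 0 := by
    intro x hx
    filter_upwards [continuous_norm.continuousAt.eventually (gt_mem_nhds hx)] with y hy
    exact hχc _ hy
  refine ⟨fun x => χ ‖x‖, ?_, ?_, ?_, ?_⟩
  · rw [contDiff_iff_contDiffAt]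
    intro x
    by_cases hx : x = 0
    · exact contDiffAt_const.congr_of_eventuallyEq (hnear x (by simpa [hx] using ha))
    · exact hχs.contDiffAt.comp x (contDiffAt_norm ℝ hx)
  · refine HasCompactSupport.intro (isCompact_closedBall (0 : E3) b) fun x hx => ?_
    exact hχ0 _ (by simpa using hx)
  · intro j x
    by_cases hx : x = 0
    · subst hx
      have := (hnear 0 (by simpa using ha)).fderiv_eq (𝕜 := ℝ)
      simp [partialD, this]
    · rw [partialD, (hcd x hx).fderiv]
      have h2 : fderiv ℝ (fun x : E3 => ‖x‖) x (EuclideanSpace.single j 1) = x j / ‖x‖ := by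
        have h1 : DifferentiableAt ℝ (fun x : E3 => ‖x‖) x :=
          (contDiffAt_norm ℝ (n := 1) hx).differentiableAt (by simp)
        have h3 := fderiv_norm_sq_apply (F := E3) x
        rw [(h1.hasFDerivAt.pow 2).fderiv] at h3
        have h4 := congrArg (fun T => T (EuclideanSpace.single j (1 : ℝ))) h3
        simp [EuclideanSpace.inner_single_right] at h4
        rw [eq_div_iff (norm_ne_zero_iff.2 hx)]
        linarith
      simp [h2]
  · intro x
    show χ ‖x‖ = _
    have e : ∀ t, (if ‖x‖ < t then η t else 0) = (Set.Ioi ‖x‖).indicator η t := fun t => by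
      simp [Set.indicator_apply]
    simp_rw [e]
    rw [integral_indicator measurableSet_Ioi]
    have h1 : ∫ t in Set.Ioi ‖x‖, η t = ∫ t in ‖x‖..(max ‖x‖ (b + 1)), η t := by
      rw [intervalIntegral.integral_of_le (le_max_left _ _)]
      refine (setIntegral_eq_of_subset_of_forall_sdiff_eq_zero measurableSet_Ioi
        Set.Ioc_subset_Ioi_self fun t ht => hab t fun h => ht.2 ⟨ht.1, ?_⟩)
      exact (h.2.trans (by linarith)).trans (le_max_right _ _)
    have h2 : χ ‖x‖ - χ (max ‖x‖ (b + 1)) = ∫ s in (max ‖x‖ (b + 1))..‖x‖, η s :=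
      intervalIntegral.integral_interval_sub_left (hη.continuous.intervalIntegrable _ _)
        (hη.continuous.intervalIntegrable _ _)
    have h3 : χ (max ‖x‖ (b + 1)) = 0 := hχ0 _ (lt_of_lt_of_le (by linarith) (le_max_right _ _))
    rw [h1, intervalIntegral.integral_symm, neg_neg]
    linarith

lemma integrableOn_ball_sphereFlux {V : Fin 3 → E3 → ℝ} (hV : ∀ j, LocallyIntegrable (V j))
    (b : ℝ) : IntegrableOn (sphereFlux V) (Set.Ioo 0 b) ∧
      ∀ᵐ R ∂volume.restrict (Set.Ioi (0 : ℝ)), R < b →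
        Integrable (fun w : Metric.sphere (0 : E3) 1 => radialPart V (R • (w : E3)))
          sphereMeasure := by
  have h1 : Integrable ((Metric.ball (0 : E3) b).indicator (radialPart V)) := by
    have h2 : Integrable (radialPart fun j => (Metric.ball (0 : E3) b).indicator (V j)) := by
      refine integrable_radialPart fun j => ?_
      rw [integrable_indicator_iff Metric.isOpen_ball.measurableSet]
      exact ((hV j).integrableOn_isCompact (isCompact_closedBall 0 b)).mono_set
        Metric.ball_subset_closedBall
    refine h2.congr (Eventually.of_forall fun x => ?_)
    by_cases hx : x ∈ Metric.ball (0 : E3) b <;> simp [radialPart, hx]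
  obtain ⟨p1, p2, -⟩ := integral_polar h1
  have hin : ∀ R ∈ Set.Ioo 0 b, ∀ w : Metric.sphere (0 : E3) 1,
      (Metric.ball (0 : E3) b).indicator (radialPart V) (R • (w : E3)) =
        radialPart V (R • (w : E3)) := by
    intro R hR w
    refine Set.indicator_of_mem ?_ _
    rw [mem_ball_zero_iff, norm_smul_sphere hR.1]
    exact hR.2
  constructor
  · refine (p2.mono_set Set.Ioo_subset_Ioi_self).congr_fun (fun R hR => ?_) measurableSet_Ioo
    simp only [sphereFlux, hin R hR]
  · filter_upwards [p1, ae_restrict_mem measurableSet_Ioi] with R h2 h0 hb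
    exact h2.congr (Eventually.of_forall (hin R ⟨h0, hb⟩))

/-- The divergence theorem on balls for a weak divergence. -/
lemma sphereFlux_ae_eq {V : Fin 3 → E3 → ℝ} {f : E3 → ℝ} (hV : ∀ j, LocallyIntegrable (V j))
    (hf : Integrable f)
    (hdiv : ∀ ψ : E3 → ℝ, ContDiff ℝ ∞ ψ → HasCompactSupport ψ →
      ∫ x, ∑ j, V j x * partialD j ψ x = - ∫ x, f x * ψ x) :
    ∀ᵐ R ∂volume.restrict (Set.Ioi (0 : ℝ)), sphereFlux V R = ∫ x in Metric.ball 0 R, f x := by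
  set m : ℝ → ℝ := fun R => ∫ x, if ‖x‖ < R then f x else 0 with hm
  have hmball : ∀ R, m R = ∫ x in Metric.ball 0 R, f x := by
    intro R
    rw [← integral_indicator Metric.isOpen_ball.measurableSet]
    refine integral_congr_ae (Eventually.of_forall fun x => ?_)
    by_cases hx : ‖x‖ < R <;> simp [Set.indicator, hx]
  have hset : MeasurableSet {p : E3 × ℝ | ‖p.1‖ < p.2} :=
    measurableSet_lt (by fun_prop) (by fun_prop)
  have hprod : ∀ η : ℝ → ℝ, ∀ μ : Measure ℝ, SFinite μ → Integrable η μ →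
      Integrable (fun p : E3 × ℝ => if ‖p.1‖ < p.2 then f p.1 * η p.2 else 0)
        (volume.prod μ) := by
    intro η μ _ hη
    refine ((hf.mul_prod hη).indicator hset).congr (Eventually.of_forall fun p => ?_)
    simp [Set.indicator_apply]
  have hmint : ∀ b, IntegrableOn m (Set.Ioo 0 b) := by
    intro b
    have := (hprod (fun _ => 1) (volume.restrict (Set.Ioo 0 b)) inferInstance
      (integrable_const _)).integral_prod_right
    simp only [mul_one] at this
    exact this
  have hloc : LocallyIntegrableOn (fun R => sphereFlux V R - m R) (Set.Ioi 0) := by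
    intro R hR
    refine ⟨Set.Ioo 0 (R + 1), mem_nhdsWithin_of_mem_nhds (Ioo_mem_nhds hR (by linarith)), ?_⟩
    exact ((integrableOn_ball_sphereFlux hV _).1).sub (hmint _)
  -- Both functions of `R` are compared against a test function `η` on the half line. With the
  -- radial function `ψ` of derivative `η`, the left side of `hdiv` becomes the integral of `η`
  -- times the flux by polar coordinates, and the right side the integral of `η m` by Fubini.
  have key := isOpen_Ioi.ae_eq_zero_of_integral_contDiff_smul_eq_zero hloc (μ := volume) ?_
  · rw [ae_restrict_iff' measurableSet_Ioi]
    filter_upwards [key] with R hR h0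
    rw [← hmball]
    linarith [hR h0]
  intro η hη hηc hηs
  obtain ⟨a, b, ha, hab⟩ : ∃ a b : ℝ, 0 < a ∧ tsupport η ⊆ Set.Icc a b := by
    by_cases hne : (tsupport η).Nonempty
    · obtain ⟨a, ha⟩ := hηc.isCompact.exists_isLeast hne
      obtain ⟨b, hb⟩ := hηc.isCompact.exists_isGreatest hne
      exact ⟨a, b, hηs ha.1, fun t ht => ⟨ha.2 ht, hb.2 ht⟩⟩
    · rw [Set.not_nonempty_iff_eq_empty] at hne
      exact ⟨1, 1, one_pos, by simp [hne]⟩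
  have hη0 : ∀ t, t ∉ Set.Icc a b → η t = 0 := fun t ht =>
    image_eq_zero_of_notMem_tsupport fun h => ht (hab h)
  obtain ⟨C, hC⟩ := hηc.exists_bound_of_continuous hη.continuous
  obtain ⟨ψ, hψ1, hψ2, hψ3, hψ4⟩ := exists_radial_primitive hη ha hη0
  have hd := hdiv ψ hψ1 hψ2
  have hW : ∀ x, ∑ j, V j x * partialD j ψ x = η ‖x‖ * radialPart V x := by
    intro x
    simp only [hψ3, radialPart, Finset.mul_sum]
    exact Finset.sum_congr rfl fun j _ => by ring
  have hWint : Integrable fun x : E3 => η ‖x‖ * radialPart V x := by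
    have h2 : Integrable (radialPart fun j => (Metric.closedBall (0 : E3) b).indicator (V j)) := by
      refine integrable_radialPart fun j => ?_
      rw [integrable_indicator_iff Metric.isClosed_closedBall.measurableSet]
      exact (hV j).integrableOn_isCompact (isCompact_closedBall 0 b)
    refine (h2.bdd_mul (c := C) (f := fun x => η ‖x‖)
      (hη.continuous.comp continuous_norm).aestronglyMeasurable
      (Eventually.of_forall fun x => hC _)).congr (Eventually.of_forall fun x => ?_)
    by_cases hx : x ∈ Metric.closedBall (0 : E3) b
    · simp [radialPart, hx]
    · have : η ‖x‖ = 0 := hη0 _ fun h => hx (by simpa using h.2)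
      simp [this]
  obtain ⟨-, q2, q3⟩ := integral_polar hWint
  have e1 : ∀ R ∈ Set.Ioi (0 : ℝ), R ^ 2 * ∫ w : Metric.sphere (0 : E3) 1,
      η ‖R • (w : E3)‖ * radialPart V (R • (w : E3)) ∂sphereMeasure = η R * sphereFlux V R := by
    intro R hR
    simp only [norm_smul_sphere hR, sphereFlux]
    rw [integral_const_mul]
    ring
  rw [setIntegral_congr_fun measurableSet_Ioi e1] at q3
  have q2' := q2.congr_fun e1 measurableSet_Ioi
  have hηint : Integrable η := hη.continuous.integrable_of_hasCompactSupport hηc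
  have hP := hprod η volume inferInstance hηint
  have e2 : - ∫ x, f x * ψ x = ∫ t, η t * m t := by
    have s1 : - ∫ x, f x * ψ x = ∫ x, ∫ t, (if ‖x‖ < t then f x * η t else 0) := by
      rw [← integral_neg]
      refine integral_congr_ae (Eventually.of_forall fun x => ?_)
      simp only [hψ4, mul_neg, neg_neg]
      rw [← integral_const_mul]
      refine integral_congr_ae (Eventually.of_forall fun t => ?_)
      simp
    rw [s1, integral_integral_swap hP]
    refine integral_congr_ae (Eventually.of_forall fun t => ?_)
    simp only [hm]
    rw [← integral_const_mul]
    refine integral_congr_ae (Eventually.of_forall fun x => ?_)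
    simp only [mul_ite, mul_zero, mul_comm]
  have hηm : Integrable fun t => η t * m t := by
    have := hP.integral_prod_right
    refine this.congr (Eventually.of_forall fun t => ?_)
    simp only [hm]
    rw [← integral_const_mul]
    refine integral_congr_ae (Eventually.of_forall fun x => ?_)
    simp only [mul_ite, mul_zero, mul_comm]
  have e3 : ∫ t, η t * m t = ∫ t in Set.Ioi 0, η t * m t := by
    refine (setIntegral_eq_integral_of_forall_compl_eq_zero fun t ht => ?_).symm
    rw [hη0 t fun h => ht (lt_of_lt_of_le ha h.1), zero_mul]
  have e4 : ∫ t, η t • (sphereFlux V t - m t) =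
      ∫ t in Set.Ioi 0, (η t * sphereFlux V t - η t * m t) := by
    rw [← setIntegral_eq_integral_of_forall_compl_eq_zero (s := Set.Ioi (0 : ℝ))]
    · exact integral_congr_ae (Eventually.of_forall fun t => by simp [mul_sub])
    · intro t ht
      rw [hη0 t fun h => ht (lt_of_lt_of_le ha h.1), zero_smul]
  rw [e4, integral_sub q2' hηm.integrableOn, ← q3, ← e3, ← e2, ← hd]
  simp_rw [hW]
  ring

/-- For almost every `R` the flux is the integral of `f` over the ball of radius `R`, which
converges by dominated convergence. -/
lemma hasFlux_of_div {V : Fin 3 → E3 → ℝ} {f : E3 → ℝ} (hV : ∀ j, LocallyIntegrable (V j))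
    (hf : Integrable f)
    (hdiv : ∀ ψ : E3 → ℝ, ContDiff ℝ ∞ ψ → HasCompactSupport ψ →
      ∫ x, ∑ j, V j x * partialD j ψ x = - ∫ x, f x * ψ x) :
    HasFlux V (∫ x, f x) := by
  constructor
  · have h1 : ∀ n : ℕ, ∀ᵐ R ∂volume.restrict (Set.Ioi (0 : ℝ)), R < (n : ℝ) →
        Integrable (fun w : Metric.sphere (0 : E3) 1 => radialPart V (R • (w : E3)))
          sphereMeasure := fun n => (integrableOn_ball_sphereFlux hV n).2
    have h2 : ∀ᵐ R ∂volume.restrict (Set.Ioi (0 : ℝ)), ∀ n : ℕ, R < (n : ℝ) →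
        Integrable (fun w : Metric.sphere (0 : E3) 1 => radialPart V (R • (w : E3)))
          sphereMeasure := ae_all_iff.2 h1
    rw [ae_restrict_iff' measurableSet_Ioi] at h2
    filter_upwards [h2] with R hR h3
    obtain ⟨n, hn⟩ := exists_nat_gt R
    exact hR (lt_trans zero_lt_one h3) n hn
  · have h1 : Tendsto (fun R : ℝ => ∫ x in Metric.ball 0 R, f x) atTop (𝓝 (∫ x, f x)) := by
      have h2 : ∀ R : ℝ, ∫ x in Metric.ball 0 R, f x = ∫ x, (Metric.ball 0 R).indicator f x :=
        fun R => (integral_indicator Metric.isOpen_ball.measurableSet).symm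
      simp_rw [h2]
      refine tendsto_integral_filter_of_dominated_convergence (fun x => ‖f x‖)
        (Eventually.of_forall fun R => hf.1.indicator Metric.isOpen_ball.measurableSet)
        (Eventually.of_forall fun R => Eventually.of_forall fun x =>
          norm_indicator_le_norm_self _ _) hf.norm (Eventually.of_forall fun x => ?_)
      refine tendsto_const_nhds.congr' ?_
      filter_upwards [eventually_gt_atTop ‖x‖] with R hR
      rw [Set.indicator_of_mem (by simpa using hR)]
    refine (h1.mono_left inf_le_left).congr' ?_
    have h2 := sphereFlux_ae_eq hV hf hdiv
    rw [ae_restrict_iff' measurableSet_Ioi] at h2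
    filter_upwards [mem_inf_of_left (Ioi_mem_atTop (0 : ℝ)), mem_inf_of_right h2] with R h0 hR
    exact (hR h0).symm

/-- Agreement beyond `R₀` settles the limit but not integrability on the spheres of radius between 1
and `R₀`, so the latter is assumed separately for `W`. -/
lemma HasFlux.congr {V W : Fin 3 → E3 → ℝ} {L R₀ : ℝ} (h : HasFlux V L) (hR₀ : 1 < R₀)
    (hVW : ∀ᵐ x : E3, R₀ < ‖x‖ → ∀ j, V j x = W j x)
    (hW : ∀ᵐ R : ℝ, 1 < R → Integrable
      (fun w : Metric.sphere (0 : E3) 1 => radialPart W (R • (w : E3))) sphereMeasure) :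
    HasFlux W L := by
  refine ⟨hW, h.2.congr' ?_⟩
  have h2 := ae_sphere_of_ae hVW
  rw [ae_restrict_iff' measurableSet_Ioi] at h2
  filter_upwards [mem_inf_of_left (Ioi_mem_atTop R₀), mem_inf_of_right h2] with R h0 hR
  have hpos : 0 < R := by linarith [Set.mem_Ioi.1 h0]
  simp only [sphereFlux]
  congr 1
  refine integral_congr_ae ?_
  filter_upwards [hR hpos] with w hw
  rw [norm_smul_sphere hpos] at hw
  simp only [radialPart, hw h0]

lemma HasFlux.congr_ae {V W : Fin 3 → E3 → ℝ} {L : ℝ} (h : HasFlux V L)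
    (hVW : ∀ᵐ x : E3, 1 < ‖x‖ → ∀ j, V j x = W j x) : HasFlux W L := by
  refine h.congr (R₀ := 2) (by norm_num) (hVW.mono fun x hx h2 => hx (by linarith)) ?_
  have h2 := ae_sphere_of_ae hVW
  rw [ae_restrict_iff' measurableSet_Ioi] at h2
  filter_upwards [h.1, h2] with R hR h3 h1
  have hpos : 0 < R := by linarith
  refine (hR h1).congr ?_
  filter_upwards [h3 hpos] with w hw
  rw [norm_smul_sphere hpos] at hw
  simp only [radialPart, hw h1]

lemma HasFlux.add {V W : Fin 3 → E3 → ℝ} {L K : ℝ} (hV : HasFlux V L) (hW : HasFlux W K) :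
    HasFlux (fun j x => V j x + W j x) (L + K) := by
  have e : ∀ x, radialPart (fun j x => V j x + W j x) x = radialPart V x + radialPart W x := by
    intro x
    simp [radialPart, add_mul, Finset.sum_add_distrib]
  constructor
  · filter_upwards [hV.1, hW.1] with R h1 h2 hR
    simp_rw [e]
    exact (h1 hR).add (h2 hR)
  · refine (hV.2.add hW.2).congr' ?_
    filter_upwards [mem_inf_of_left (Ioi_mem_atTop (1 : ℝ)), mem_inf_of_right hV.1,
      mem_inf_of_right hW.1] with R h0 h1 h2
    simp only [sphereFlux, e]
    rw [integral_add (h1 h0) (h2 h0)]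
    ring

lemma HasFlux.const_mul {V : Fin 3 → E3 → ℝ} {L : ℝ} (hV : HasFlux V L) (k : ℝ) :
    HasFlux (fun j x => k * V j x) (k * L) := by
  have e : ∀ x, radialPart (fun j x => k * V j x) x = k * radialPart V x := by
    intro x
    simp [radialPart, Finset.mul_sum, mul_assoc]
  constructor
  · filter_upwards [hV.1] with R h1 hR
    simp_rw [e]
    exact (h1 hR).const_mul k
  · refine (hV.2.const_mul k).congr fun R => ?_
    simp only [sphereFlux, e]
    rw [integral_const_mul]
    ring

lemma HasFlux.zero : HasFlux (fun _ _ => 0) 0 := by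
  have e : ∀ x, radialPart (fun _ _ => 0) x = 0 := fun x => by simp [radialPart]
  constructor
  · simp [e]
  · have : sphereFlux (fun _ _ => 0) = fun _ => 0 := by
      ext R
      simp [sphereFlux, e]
    rw [this]
    exact tendsto_const_nhds

lemma HasFlux.sum {ι : Type*} {s : Finset ι} {V : ι → Fin 3 → E3 → ℝ} {L : ι → ℝ}
    (h : ∀ k ∈ s, HasFlux (V k) (L k)) :
    HasFlux (fun j x => ∑ k ∈ s, V k j x) (∑ k ∈ s, L k) := by
  classical
  induction s using Finset.induction_on with
  | empty => simpa using HasFlux.zero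
  | insert a s ha ih =>
    simp_rw [Finset.sum_insert ha]
    exact (h a (Finset.mem_insert_self _ _)).add (ih fun k hk => h k (Finset.mem_insert_of_mem hk))

/-- If `|V| / |x|` is integrable near infinity, the limit of the flux vanishes. -/
lemma HasFlux.eq_zero {V : Fin 3 → E3 → ℝ} {L : ℝ} (h : HasFlux V L)
    (hV : ∀ j, IntegrableOn (fun x => ‖x‖⁻¹ * V j x) {x : E3 | 1 < ‖x‖}) : L = 0 := by
  by_contra hL
  have hms : MeasurableSet {x : E3 | 1 < ‖x‖} := (isOpen_lt continuous_const continuous_norm).measurableSet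
  have h1 : Integrable (radialPart fun j => {x : E3 | 1 < ‖x‖}.indicator fun x => ‖x‖⁻¹ * V j x) :=
    integrable_radialPart fun j => (integrable_indicator_iff hms).2 (hV j)
  obtain ⟨-, p2, -⟩ := integral_polar h1
  have e : ∀ R ∈ Set.Ioi (1 : ℝ), R ^ 2 * ∫ w : Metric.sphere (0 : E3) 1,
      radialPart (fun j => {x : E3 | 1 < ‖x‖}.indicator fun x => ‖x‖⁻¹ * V j x) (R • (w : E3))
        ∂sphereMeasure = R⁻¹ * sphereFlux V R := by
    intro R hR
    have h0 : 0 < R := lt_trans zero_lt_one hR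
    have e1 : ∀ w : Metric.sphere (0 : E3) 1,
        radialPart (fun j => {x : E3 | 1 < ‖x‖}.indicator fun x => ‖x‖⁻¹ * V j x) (R • (w : E3)) =
          R⁻¹ * radialPart V (R • (w : E3)) := by
      intro w
      have hmem : R • (w : E3) ∈ {x : E3 | 1 < ‖x‖} := by
        show 1 < ‖R • (w : E3)‖
        rw [norm_smul_sphere h0]
        exact hR
      simp only [radialPart, Set.indicator_of_mem hmem, norm_smul_sphere h0, Finset.mul_sum]
      exact Finset.sum_congr rfl fun j _ => by ring
    simp only [e1]
    rw [integral_const_mul, sphereFlux]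
    ring
  have p3 : IntegrableOn (fun R => R⁻¹ * sphereFlux V R) (Set.Ioi 1) :=
    (p2.mono_set (Set.Ioi_subset_Ioi zero_le_one)).congr_fun e measurableSet_Ioi
  have hLpos : 0 < |L| / 2 := by
    have := abs_pos.2 hL
    linarith
  have h2 : ∀ᶠ R in atTop ⊓ ae volume, |L| / 2 < |sphereFlux V R| :=
    h.2.abs.eventually (lt_mem_nhds (by linarith))
  rw [eventually_inf] at h2
  obtain ⟨s, hs, t, ht, hst⟩ := h2
  obtain ⟨R₁, hR₁⟩ := mem_atTop_sets.1 hs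
  set R₀ := max R₁ 1 with hR₀
  -- For almost every large `R` the flux exceeds `|L| / 2` in absolute value. By `p3` the function
  -- `R⁻¹` would then be integrable at infinity.
  have h3 : IntegrableOn (fun R : ℝ => R⁻¹) (Set.Ioi R₀) := by
    have p4 := (p3.mono_set (Set.Ioi_subset_Ioi (le_max_right R₁ 1))).norm.const_mul (|L| / 2)⁻¹
    refine Integrable.mono p4 measurable_inv.aestronglyMeasurable ?_
    have ht' : ∀ᵐ R ∂volume.restrict (Set.Ioi R₀), R ∈ t := ae_restrict_of_ae ht
    filter_upwards [ht', ae_restrict_mem measurableSet_Ioi] with R hRt hR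
    have hR1 : R₁ ≤ R := (le_max_left _ _).trans (le_of_lt hR)
    have hRp : 0 < R := lt_of_lt_of_le zero_lt_one ((le_max_right R₁ 1).trans (le_of_lt hR))
    have h5 : |L| / 2 < |sphereFlux V R| := hst R ⟨hR₁ R hR1, hRt⟩
    have h6 : ‖(|L| / 2)⁻¹ * ‖R⁻¹ * sphereFlux V R‖‖ =
        ‖R⁻¹‖ * ((|L| / 2)⁻¹ * |sphereFlux V R|) := by
      rw [norm_mul, norm_norm, norm_mul, Real.norm_of_nonneg (inv_pos.2 hLpos).le,
        Real.norm_eq_abs (sphereFlux V R)]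
      ring
    rw [h6]
    refine le_mul_of_one_le_right (norm_nonneg _) ?_
    rw [inv_mul_eq_div, one_le_div hLpos]
    exact h5.le
  exact not_integrableOn_Ioi_inv h3

/-! ### Functions smooth up to the boundary, and coefficients with second derivatives. -/

namespace Background

variable {B : Background}

/-- `M` is not convex, but it contains, for each of its points `x`, the half-space `⟨x, y⟩ ≥ ‖x‖ a`,
by Cauchy–Schwarz. This contains `x` and has `2 x` in its interior. -/
lemma uniqueDiffOn_M (B : Background) : UniqueDiffOn ℝ B.M := by
  intro x hx
  have ha := B.a_pos
  have hx0 : 0 < ‖x‖ := lt_of_lt_of_le ha hx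
  have hsub : {y : E3 | ‖x‖ * B.a ≤ inner ℝ x y} ⊆ B.M := by
    intro y hy
    have h1 : ‖x‖ * B.a ≤ ‖x‖ * ‖y‖ := le_trans hy (real_inner_le_norm x y)
    exact le_of_mul_le_mul_left h1 hx0
  have hconv : Convex ℝ {y : E3 | ‖x‖ * B.a ≤ inner ℝ x y} :=
    convex_halfSpace_ge (IsLinearMap.mk (fun u v => inner_add_right x u v)
      (fun c u => real_inner_smul_right x u c)) _
  refine (uniqueDiffWithinAt_convex hconv ⟨(2 : ℝ) • x, ?_⟩ (subset_closure ?_)).mono hsub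
  · refine mem_interior.2 ⟨{y : E3 | ‖x‖ * B.a < inner ℝ x y}, 
      fun y (hy : ‖x‖ * B.a < inner ℝ x y) => show ‖x‖ * B.a ≤ inner ℝ x y from hy.le,
      isOpen_lt continuous_const (by fun_prop), ?_⟩
    show ‖x‖ * B.a < inner ℝ x ((2 : ℝ) • x)
    rw [real_inner_smul_right, real_inner_self_eq_norm_sq]
    have : B.a ≤ ‖x‖ := hx
    nlinarith
  · show ‖x‖ * B.a ≤ inner ℝ x x
    rw [real_inner_self_eq_norm_sq]
    have : B.a ≤ ‖x‖ := hx
    nlinarith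

/-- The ambient derivative says nothing on `Σ`. The derivative within `M` agrees with it in the
interior and is smooth up to `Σ`, which bounds derivatives on the compact core. -/
lemma exists_smooth_extension_partialD {f : E3 → ℝ} (hf : ContDiffOn ℝ ∞ f B.M) (i : Fin 3) :
    ∃ f' : E3 → ℝ, ContDiffOn ℝ ∞ f' B.M ∧ ∀ x ∈ B.U, partialD i f x = f' x := by
  refine ⟨fun x => fderivWithin ℝ f B.M x (EuclideanSpace.single i 1),
    (hf.fderivWithin B.uniqueDiffOn_M (by simp)).clm_apply contDiffOn_const, fun x hx => ?_⟩
  simp only [partialD]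
  rw [fderivWithin_of_mem_nhds (mem_of_superset (B.isOpen_U.mem_nhds hx) B.U_subset_M)]

lemma L2w.of_continuousOn_M {s : ℝ} {f u : E3 → ℝ} (hf : ContinuousOn f B.M)
    (hu : ∀ x ∈ B.U, u x = f x) (h0 : ∀ x, 1 < ‖x‖ → u x = 0) : B.L2w s u := by
  obtain ⟨C, hC⟩ := ((isCompact_closedBall (0 : E3) 1).inter_left
    B.isClosed_M).exists_bound_of_continuousOn (hf.mono Set.inter_subset_left)
  have hum : AEStronglyMeasurable u B.vol := by
    refine ((hf.mono B.U_subset_M).aestronglyMeasurable B.measurableSet_U).congr ?_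
    filter_upwards [B.ae_mem_U] with x hx
    exact (hu x hx).symm
  refine L2w.of_bounded_support (C := |C|) (R := 1) hum ?_ h0
  filter_upwards [B.ae_mem_U] with x hx
  by_cases h1 : 1 < ‖x‖
  · rw [h0 x h1, abs_zero]
    exact abs_nonneg _
  · rw [hu x hx]
    exact (hC x ⟨B.U_subset_M hx, by simpa using not_lt.1 h1⟩).trans (le_abs_self C)

lemma partialD_eq_zero_of_const {f : E3 → ℝ} {k : ℝ} (h : ∀ x, 1 < ‖x‖ → f x = k) (i : Fin 3)
    (x : E3) (hx : 1 < ‖x‖) : partialD i f x = 0 := by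
  have : f =ᶠ[𝓝 x] fun _ => k := by
    filter_upwards [continuous_norm.continuousAt.eventually (lt_mem_nhds hx)] with y hy
    exact h y hy
  simp [partialD, this.fderiv_eq]

/-- Coefficients with a second weak derivative `∂²c` such that `r ∂²c` is square integrable. -/
structure Coef₂ (B : Background) (c : E3 → ℝ) (c₀ : ℝ) : Prop where
  coef : B.Coef c (fun i => B.wd i c) c₀
  weak₂ : ∀ i j, B.HasWeakPartial i (B.wd j c) (B.wd i (B.wd j c))
  mem₂ : ∀ i j, B.L2w 1 (B.wd i (B.wd j c))

lemma H2Approx.coef₂ {u : E3 → ℝ} {ψ : ℕ → E3 → ℝ} (h : B.H2Approx u ψ) : B.Coef₂ u 0 :=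
  ⟨h.coef, h.weak₂, h.mem₂⟩

/-- Meant for the components of the background metric. They are constant on the end, so the
integrability conditions concern only the compact core, and the approximating sequence may be taken
constant. -/
lemma Coef₂.of_smooth {f : E3 → ℝ} {k : ℝ} (hf : ContDiffOn ℝ ∞ f B.M)
    (hk : ∀ x, 1 < ‖x‖ → f x = k) : B.Coef₂ f k := by
  have hU := hf.mono B.U_subset_M
  have w1 : ∀ i, B.HasWeakPartial i f (partialD i f) := fun i => .of_contDiffOn hU
  have e1 : ∀ i, B.wd i f =ᵐ[B.vol] partialD i f := fun i => (w1 i).wd_eq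
  have w2 : ∀ i j, B.HasWeakPartial i (B.wd j f) (partialD i (partialD j f)) := fun i j =>
    (HasWeakPartial.of_contDiffOn (contDiffOn_partialD B.isOpen_U hU j)).congr (e1 j).symm .rfl
  have z1 := fun i => partialD_eq_zero_of_const hk i
  have z2 := fun i j => partialD_eq_zero_of_const (z1 j) i
  have m1 : ∀ i, B.L2w 0 (partialD i f) := fun i => by
    obtain ⟨f', hf', he⟩ := exists_smooth_extension_partialD hf i
    exact L2w.of_continuousOn_M hf'.continuousOn he (z1 i)
  have m2 : ∀ i j, B.L2w 1 (partialD i (partialD j f)) := fun i j => by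
    obtain ⟨f', hf', he⟩ := exists_smooth_extension_partialD hf j
    obtain ⟨f'', hf'', he'⟩ := exists_smooth_extension_partialD hf' i
    refine L2w.of_continuousOn_M hf''.continuousOn (fun x hx => ?_) (z2 i j)
    rw [← he' x hx, partialD, partialD, Filter.EventuallyEq.fderiv_eq]
    filter_upwards [B.isOpen_U.mem_nhds hx] with y hy
    exact he y hy
  have m0 : B.L2w (-1) (fun x => f x - k) :=
    L2w.of_continuousOn_M (hf.continuousOn.sub continuousOn_const) (fun _ _ => rfl)
      fun x hx => by rw [hk x hx, sub_self]
  have hc : B.Coef f (fun i => partialD i f) k := by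
    refine ⟨hU.continuousOn.aestronglyMeasurable B.measurableSet_U, ?_, m0, m1, fun _ => f,
      Eventually.of_forall fun _ => hU, fun ε hε => by simp [hε.le], fun i => by simp [TendstoL2w]⟩
    obtain ⟨C, hC⟩ := ((isCompact_closedBall (0 : E3) 1).inter_left
      B.isClosed_M).exists_bound_of_continuousOn (hf.continuousOn.mono Set.inter_subset_left)
    refine ⟨max C |k|, ?_⟩
    filter_upwards [B.ae_mem_U] with x hx
    by_cases h1 : 1 < ‖x‖
    · rw [hk x h1]
      exact le_max_right _ _
    · exact (hC x ⟨B.U_subset_M hx, by simpa using not_lt.1 h1⟩).trans (le_max_left _ _)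
  exact ⟨hc.congr .rfl fun i => (e1 i).symm, fun i j => (w2 i j).self_wd,
    fun i j => (m2 i j).congr (w2 i j).wd_eq.symm⟩

lemma Coef₂.add {c d : E3 → ℝ} {c₀ d₀ : ℝ} (hc : B.Coef₂ c c₀) (hd : B.Coef₂ d d₀) :
    B.Coef₂ (fun x => c x + d x) (c₀ + d₀) := by
  have h := hc.coef.add hd.coef
  have e1 : ∀ i, B.wd i (fun x => c x + d x) =ᵐ[B.vol] fun x => B.wd i c x + B.wd i d x :=
    fun i => h.wd_eq i
  have w2 : ∀ i j, B.HasWeakPartial i (B.wd j fun x => c x + d x)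
      (fun x => B.wd i (B.wd j c) x + B.wd i (B.wd j d) x) := fun i j =>
    ((hc.weak₂ i j).add (hd.weak₂ i j)).congr (e1 j).symm .rfl
  exact ⟨h.congr .rfl fun i => (e1 i).symm, fun i j => (w2 i j).self_wd,
    fun i j => ((hc.mem₂ i j).add (hd.mem₂ i j)).congr (w2 i j).wd_eq.symm⟩

/-! ### Fluxes through infinity of square integrable fields on the manifold. -/

lemma L2w.locallyIntegrable_indicator {V : E3 → ℝ} (hV : B.L2w 0 V) :
    LocallyIntegrable (B.U.indicator V) :=
  ((memLp_indicator_iff_restrict B.measurableSet_U).2 (L2w.zero_iff.1 hV)).locallyIntegrable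
    (by norm_num)

lemma indicator_U_eq {V : E3 → ℝ} {x : E3} (hx : 1 < ‖x‖) : B.U.indicator V x = V x :=
  Set.indicator_of_mem (B.mem_U_of_one_lt hx) _

/-- A field whose weak divergence vanishes on the boundary in the weak sense. -/
lemma hasFlux_of_div_boundary {V : Fin 3 → E3 → ℝ} {f : E3 → ℝ} (hV : ∀ j, B.L2w 0 (V j))
    (hf : Integrable f B.vol)
    (hdiv : ∀ ψ : E3 → ℝ, ContDiff ℝ ∞ ψ → HasCompactSupport ψ →
      ∫ x in B.U, ∑ j, V j x * partialD j ψ x = - ∫ x in B.U, f x * ψ x) :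
    HasFlux V (∫ x in B.U, f x) := by
  -- As the functions `ψ` in `hdiv` need not vanish on `Σ`, the hypothesis says that the extension
  -- of `V` by zero has divergence `f` extended by zero, with no surface term.
  have h := hasFlux_of_div (V := fun j => B.U.indicator (V j)) (f := B.U.indicator f)
    (fun j => (hV j).locallyIntegrable_indicator)
    ((integrable_indicator_iff B.measurableSet_U).2 hf) ?_
  · rw [integral_indicator B.measurableSet_U] at h
    exact h.congr_ae (Eventually.of_forall fun x hx j => indicator_U_eq hx)
  · intro ψ h1 h2
    have h3 := hdiv ψ h1 h2
    rw [← integral_indicator B.measurableSet_U, ← integral_indicator B.measurableSet_U] at h3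
    have e1 : ∀ x, ∑ j, B.U.indicator (V j) x * partialD j ψ x =
        B.U.indicator (fun x => ∑ j, V j x * partialD j ψ x) x := fun x => by
      by_cases hx : x ∈ B.U <;> simp [hx]
    have e2 : ∀ x, B.U.indicator f x * ψ x = B.U.indicator (fun x => f x * ψ x) x := fun x => by
      by_cases hx : x ∈ B.U <;> simp [hx]
    simp_rw [e1, e2]
    exact h3

/-- A field whose weak divergence is integrable near infinity has a flux through infinity. -/
lemma exists_hasFlux {V : Fin 3 → E3 → ℝ} {f : E3 → ℝ} (hV : ∀ j, B.L2w 0 (V j))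
    (hf : IntegrableOn f {x : E3 | 1 < ‖x‖})
    (hdiv : ∀ ψ ∈ B.testFunctions,
      ∫ x in B.U, ∑ j, V j x * partialD j ψ x = - ∫ x in B.U, f x * ψ x) :
    ∃ L, HasFlux V L := by
  -- The cutoff `ζ = 1 - b` vanishes for `‖x‖ ≤ 2` and is 1 beyond 3. The field `ζ V` lives on the
  -- whole space, has the integrable divergence `ζ f + ∇ζ · V`, and has the same flux as `V` beyond
  -- radius 3.
  let b : ContDiffBump (0 : E3) := ⟨2, 3, by norm_num, by norm_num⟩
  have hb : ContDiff ℝ ∞ b := b.contDiff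
  set ζ : E3 → ℝ := fun x => 1 - b x with hζ
  have hζs : ContDiff ℝ ∞ ζ := contDiff_const.sub hb
  have hζ0 : ∀ x, ‖x‖ ≤ 2 → ζ x = 0 := fun x hx => by
    simp [hζ, b.one_of_mem_closedBall (show x ∈ Metric.closedBall (0 : E3) b.rIn by simpa [b] using hx)]
  have hζ1 : ∀ x, 3 < ‖x‖ → ζ x = 1 := fun x hx => by
    simp [hζ, b.zero_of_le_dist (x := x) (by simpa [b] using hx.le)]
  have hζb : ∀ x, |ζ x| ≤ 1 := fun x => by
    have h1 := b.nonneg (x := x)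
    have h2 := b.le_one (x := x)
    rw [abs_le]
    constructor <;> simp only [hζ] <;> linarith
  have hζd : ∀ j, partialD j ζ = fun x => -partialD j b x := fun j => by
    ext x
    simp only [partialD, hζ]
    rw [fderiv_const_sub]
    rfl
  have hζdc : ∀ j, HasCompactSupport (partialD j ζ) := fun j => by
    have h1 : HasCompactSupport (partialD j b) := b.hasCompactSupport.mono'
      ((subset_tsupport _).trans (tsupport_partialD_subset b j))
    rw [hζd j]
    exact h1.neg
  set E : Set E3 := {x : E3 | 1 < ‖x‖} with hE
  have hEm : MeasurableSet E := (isOpen_lt continuous_const continuous_norm).measurableSet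
  have hζf : Integrable fun x => ζ x * E.indicator f x :=
    ((integrable_indicator_iff hEm).2 hf).bdd_mul hζs.continuous.aestronglyMeasurable
      (Eventually.of_forall hζb)
  have hζV : ∀ j, Integrable fun x => partialD j ζ x * B.U.indicator (V j) x := fun j =>
    (hV j).locallyIntegrable_indicator.integrable_smul_left_of_hasCompactSupport
      (contDiff_partialD hζs j).continuous (hζdc j)
  have h := hasFlux_of_div (V := fun j x => ζ x * B.U.indicator (V j) x)
    (f := fun x => ζ x * E.indicator f x + ∑ j, partialD j ζ x * B.U.indicator (V j) x)
    (fun j => ?_) (hζf.add (integrable_finsetSum _ fun j _ => hζV j)) ?_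
  · refine ⟨_, h.congr (R₀ := 3) (by norm_num) (Eventually.of_forall fun x hx j => ?_) ?_⟩
    · rw [hζ1 x hx, one_mul, indicator_U_eq (by linarith)]
    · have h1 : ∀ n : ℕ, ∀ᵐ R ∂volume.restrict (Set.Ioi (0 : ℝ)), R < (n : ℝ) →
          Integrable (fun w : Metric.sphere (0 : E3) 1 =>
            radialPart (fun j => B.U.indicator (V j)) (R • (w : E3))) sphereMeasure := fun n =>
        (integrableOn_ball_sphereFlux (fun j => (hV j).locallyIntegrable_indicator) n).2
      have h2 : ∀ᵐ R ∂volume.restrict (Set.Ioi (0 : ℝ)), ∀ n : ℕ, R < (n : ℝ) →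
          Integrable (fun w : Metric.sphere (0 : E3) 1 =>
            radialPart (fun j => B.U.indicator (V j)) (R • (w : E3))) sphereMeasure :=
        ae_all_iff.2 h1
      rw [ae_restrict_iff' measurableSet_Ioi] at h2
      filter_upwards [h2] with R hR h3
      obtain ⟨n, hn⟩ := exists_nat_gt R
      have hpos := lt_trans zero_lt_one h3
      refine (hR hpos n hn).congr (Eventually.of_forall fun w => ?_)
      simp only [radialPart]
      refine Finset.sum_congr rfl fun j _ => ?_
      rw [indicator_U_eq (by rwa [norm_smul_sphere hpos])]
  · refine (hV j).locallyIntegrable_indicator.mono ?_ (Eventually.of_forall fun x => ?_)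
    · exact hζs.continuous.aestronglyMeasurable.mul
        (hV j).locallyIntegrable_indicator.aestronglyMeasurable
    · rw [norm_mul]
      exact mul_le_of_le_one_left (norm_nonneg _) (hζb x)
  · intro ψ hψ1 hψ2
    set θ : E3 → ℝ := fun x => ζ x * ψ x with hθ
    have hθt : θ ∈ B.testFunctions := by
      refine ⟨hζs.mul hψ1, hψ2.mul_left, ?_⟩
      have h1 : tsupport θ ⊆ {x : E3 | 2 ≤ ‖x‖} := by
        refine closure_minimal (fun x hx => ?_) (isClosed_le continuous_const continuous_norm)
        by_contra h2
        have h3 : ‖x‖ < 2 := not_le.1 h2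
        exact hx (by simp [hθ, hζ0 x h3.le])
      intro x hx
      have h2 : (2 : ℝ) ≤ ‖x‖ := h1 hx
      exact B.mem_U_of_one_lt (by linarith)
    have hdθ : ∀ j x, partialD j θ x = partialD j ζ x * ψ x + ζ x * partialD j ψ x := fun j x =>
      partialD_mul (hζs.differentiable (by simp) x) (hψ1.differentiable (by simp) x) j
    have hd := hdiv θ hθt
    have i1 : ∀ j, Integrable (fun x => V j x * partialD j θ x) B.vol := fun j =>
      (hV j).locallyIntegrableOn.integrable_mul_test (partialD_mem_testFunctions hθt j)
    have i2 : ∀ j, Integrable (fun x => V j x * (partialD j ζ x * ψ x)) B.vol := fun j =>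
      (hV j).integrable_mul (L2w.of_continuous
        ((contDiff_partialD hζs j).continuous.mul hψ1.continuous) hψ2.mul_left)
    have i3 : Integrable (fun x => f x * θ x) B.vol := by
      obtain ⟨C, hC⟩ := hψ2.exists_bound_of_continuous hψ1.continuous
      have := (hζf.mul_bdd hψ1.continuous.aestronglyMeasurable
        (Eventually.of_forall hC)).restrict (s := B.U)
      refine this.congr (Eventually.of_forall fun x => ?_)
      by_cases hx : x ∈ E
      · simp only [Set.indicator_of_mem hx, hθ]
        ring
      · have : ζ x = 0 := hζ0 x (by
          have : ‖x‖ ≤ 1 := not_lt.1 hx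
          linarith)
        simp [hθ, this]
    have l1 : ∫ x, ∑ j, ζ x * B.U.indicator (V j) x * partialD j ψ x =
        ∫ x in B.U, ((∑ j, V j x * partialD j θ x) - ∑ j, V j x * (partialD j ζ x * ψ x)) := by
      rw [← integral_indicator B.measurableSet_U]
      refine integral_congr_ae (Eventually.of_forall fun x => ?_)
      by_cases hx : x ∈ B.U
      · simp only [Set.indicator_of_mem hx]
        rw [← Finset.sum_sub_distrib]
        refine Finset.sum_congr rfl fun j _ => ?_
        rw [hdθ]
        ring
      · simp [hx]
    have l2 : ∫ x, (ζ x * E.indicator f x + ∑ j, partialD j ζ x * B.U.indicator (V j) x) * ψ x =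
        ∫ x in B.U, (f x * θ x + ∑ j, V j x * (partialD j ζ x * ψ x)) := by
      rw [← integral_indicator B.measurableSet_U]
      refine integral_congr_ae (Eventually.of_forall fun x => ?_)
      by_cases hx : x ∈ B.U
      · simp only [Set.indicator_of_mem hx]
        have e : ζ x * E.indicator f x = ζ x * f x := by
          by_cases hxE : x ∈ E
          · rw [Set.indicator_of_mem hxE]
          · have : ζ x = 0 := hζ0 x (by
              have : ‖x‖ ≤ 1 := not_lt.1 hxE
              linarith)
            simp [this]
        rw [e, add_mul, Finset.sum_mul]
        congr 1
        · simp only [hθ]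
          ring
        · exact Finset.sum_congr rfl fun j _ => by ring
      · have hxE : x ∉ E := fun h => hx (B.mem_U_of_one_lt h)
        simp [hx, hxE]
    rw [l1, l2, integral_sub (integrable_finsetSum _ fun j _ => i1 j)
      (integrable_finsetSum _ fun j _ => i2 j), hd,
      integral_add i3 (integrable_finsetSum _ fun j _ => i2 j)]
    ring

/-- The flux through infinity of a product of a coefficient tending to zero and a square integrable
function vanishes. -/
lemma Coef.hasFlux_zero {c b b' : E3 → ℝ} {c' : Fin 3 → E3 → ℝ} (hc : B.Coef c c' 0) (j₀ : Fin 3)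
    (hb : B.L2w 0 b) (hbw : B.HasWeakPartial j₀ b b') (hb' : B.L2w 1 b') :
    HasFlux (fun j x => if j = j₀ then c x * b x else 0) 0 := by
  obtain ⟨C, hC⟩ := hc.bdd
  have hdecay : B.L2w (-1) c := by simpa using hc.decay
  have hw := hc.hasWeakPartial_mul hbw hb
  have hcb : B.L2w 0 (fun x => c x * b x) := hb.bdd_mul hc.aesm hC
  have hV : ∀ j, B.L2w 0 (fun x => if j = j₀ then c x * b x else 0) := by
    intro j
    by_cases h : j = j₀
    · simpa [h] using hcb
    · simpa [h] using L2w.zero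
  -- Weights 0 and 0 in the first product, -1 and 1 in the second. This uses that `c` tends to zero
  -- at infinity.
  have hf : Integrable (fun x => c' j₀ x * b x + c x * b' x) B.vol :=
    ((hc.deriv j₀).integrable_mul₀ hb).add (hdecay.integrable_mul (by simpa using hb'))
  have hEU : {x : E3 | 1 < ‖x‖} ⊆ B.U := fun x hx => B.mem_U_of_one_lt hx
  obtain ⟨L, hL⟩ := exists_hasFlux (B := B) hV
    (f := fun x => c' j₀ x * b x + c x * b' x) (IntegrableOn.mono_set hf hEU) fun ψ hψ => by
      have h1 := hw.2.2 ψ hψ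
      simpa [ite_mul] using h1
  -- The product of `c / r` and `b` is integrable, and `r = ‖x‖` on the end, so a nonzero limit is
  -- excluded.
  have h0 : L = 0 := by
    refine hL.eq_zero fun j => ?_
    by_cases h : j = j₀
    · simp only [h, if_true]
      have h1 : Integrable (fun x => (B.r x ^ (-1 : ℝ) * c x) * b x) B.vol :=
        MemLp.integrable_mul hdecay (L2w.zero_iff.1 hb)
      have h2 : IntegrableOn (fun x => (B.r x ^ (-1 : ℝ) * c x) * b x) {x : E3 | 1 < ‖x‖} :=
        IntegrableOn.mono_set h1 hEU
      refine h2.congr_fun (fun x hx => ?_)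
        (isOpen_lt continuous_const continuous_norm).measurableSet
      simp only [B.r_end x hx, Real.rpow_neg_one]
      ring
    · simp [h]
  rwa [h0] at hL

end Background

/-! ### The inverse metric, the volume density and their derivatives. -/

/-- The cofactor formula in dimension three, in cyclic form. -/
lemma adjugate_cyclic (A : Matrix (Fin 3) (Fin 3) ℝ) (k l : Fin 3) :
    A.adjugate k l =
      A (l + 1) (k + 1) * A (l + 2) (k + 2) - A (l + 1) (k + 2) * A (l + 2) (k + 1) := by
  rw [Matrix.adjugate_fin_three]
  fin_cases k <;> fin_cases l <;> simp <;> ring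

lemma inv_apply_eq (A : Matrix (Fin 3) (Fin 3) ℝ) (k l : Fin 3) :
    A⁻¹ k l = A.det⁻¹ * A.adjugate k l := by
  simp [Matrix.inv_def]

lemma exists_det_gt_half : ∃ δ > 0, ∀ A : Matrix (Fin 3) (Fin 3) ℝ,
    (∀ i j, |A i j - (1 : Matrix (Fin 3) (Fin 3) ℝ) i j| ≤ δ) → 1 / 2 ≤ A.det := by
  have hc : Continuous fun e : Fin 3 → Fin 3 → ℝ => (Matrix.of e).det := by
    have h : Continuous fun e : Fin 3 → Fin 3 → ℝ => Matrix.of e := continuous_id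
    exact h.matrix_det
  have h1 : (Matrix.of (fun i j => (1 : Matrix (Fin 3) (Fin 3) ℝ) i j)).det = 1 := by
    have : (Matrix.of (fun i j => (1 : Matrix (Fin 3) (Fin 3) ℝ) i j)) = 1 := rfl
    rw [this, Matrix.det_one]
  obtain ⟨δ, hδ, h⟩ := Metric.continuousAt_iff.1
    (hc.continuousAt (x := fun i j => (1 : Matrix (Fin 3) (Fin 3) ℝ) i j)) (1 / 2) (by norm_num)
  refine ⟨δ / 2, half_pos hδ, fun A hA => ?_⟩
  have h2 := h (x := fun i j => A i j) (by
    rw [dist_pi_lt_iff hδ]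
    intro i
    rw [dist_pi_lt_iff hδ]
    intro j
    rw [Real.dist_eq]
    linarith [hA i j])
  rw [h1, Real.dist_eq] at h2
  have h3 := (abs_lt.1 h2).1
  have h4 : (Matrix.of fun i j => A i j).det = A.det := rfl
  rw [h4] at h3
  linarith

namespace Background

variable {B : Background} {g : Field2}

namespace MemG

lemma coef₂ (hg : B.MemG g) (i j : Fin 3) :
    B.Coef₂ (fun x => g x i j) ((1 : Matrix (Fin 3) (Fin 3) ℝ) i j) := by
  obtain ⟨ψ, hψ⟩ := (hg.2.2 i j).exists_H2Approx
  have h1 : B.Coef₂ (fun x => B.og x i j) ((1 : Matrix (Fin 3) (Fin 3) ℝ) i j) :=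
    Coef₂.of_smooth (B.og_smooth i j) fun x hx => by rw [B.og_end x hx]
  simpa using h1.add hψ.coef₂

lemma coef (hg : B.MemG g) (i j : Fin 3) : B.Coef (fun x => g x i j)
    (fun m => B.wd m fun x => g x i j) ((1 : Matrix (Fin 3) (Fin 3) ℝ) i j) :=
  (hg.coef₂ i j).coef

lemma symm (hg : B.MemG g) {x : E3} (hx : x ∈ B.U) (i j : Fin 3) : g x i j = g x j i := by
  have := (hg.2.1 x (B.U_subset_M hx)).1.apply i j
  simpa using this.symm

lemma det_pos (hg : B.MemG g) {x : E3} (hx : x ∈ B.U) : 0 < (g x).det :=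
  (hg.2.1 x (B.U_subset_M hx)).det_pos

lemma continuousOn_det (hg : B.MemG g) : ContinuousOn (fun x => (g x).det) B.M := by
  have h : ∀ i j, ContinuousOn (fun x => g x i j) B.M := hg.1
  simp only [Matrix.det_fin_three]
  fun_prop

/-- Far out `g` is uniformly close to the Euclidean metric and the determinant is at least 1/2. The
rest of `M`, boundary included, is compact, and there a positive continuous function is bounded
below. The bound `m ≤ 1` puts the limit value 1 of the determinant in the interval used for the
chain rule. -/
lemma exists_det_bound (hg : B.MemG g) : ∃ m > 0, m ≤ 1 ∧ ∀ᵐ x ∂B.vol, m ≤ (g x).det := by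
  obtain ⟨δ, hδ, hdet⟩ := exists_det_gt_half
  have h1 : ∀ i j, ∃ R : ℝ, ∀ᵐ x ∂B.vol, R < ‖x‖ → |g x i j - B.og x i j| ≤ δ := fun i j => by
    obtain ⟨ψ, hψ⟩ := (hg.2.2 i j).exists_H2Approx
    exact hψ.small_at_infinity hδ
  choose R hR using h1
  set R₀ := ∑ i, ∑ j, |R i j| + 1 with hR₀
  have hRle : ∀ i j, R i j ≤ R₀ := fun i j => by
    have a1 := Finset.single_le_sum (f := fun j => |R i j|) (fun _ _ => abs_nonneg _)
      (Finset.mem_univ j)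
    have a2 := Finset.single_le_sum (f := fun i => ∑ j, |R i j|)
      (fun _ _ => Finset.sum_nonneg fun _ _ => abs_nonneg _) (Finset.mem_univ i)
    have a3 := le_abs_self (R i j)
    linarith
  have hR₀1 : 1 ≤ R₀ := by
    have : 0 ≤ ∑ i, ∑ j, |R i j| := by positivity
    linarith
  obtain ⟨m, hm, hmin⟩ := ((isCompact_closedBall (0 : E3) R₀).inter_left
    B.isClosed_M).exists_forall_le' (hg.continuousOn_det.mono Set.inter_subset_left)
    (a := 0) fun x hx => (hg.2.1 x hx.1).det_pos
  refine ⟨min m (1 / 2), by positivity, (min_le_right _ _).trans (by norm_num), ?_⟩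
  have hR' := ae_all_iff.2 fun i => ae_all_iff.2 (hR i)
  filter_upwards [hR', B.ae_mem_U] with x hx hU
  by_cases h : R₀ < ‖x‖
  · refine (min_le_right _ _).trans (hdet _ fun i j => ?_)
    have h2 := hx i j ((hRle i j).trans_lt h)
    rwa [B.og_end x (by linarith)] at h2
  · exact (min_le_left _ _).trans (hmin x ⟨B.U_subset_M hU, by simpa using not_lt.1 h⟩)

/-- The Leibniz expansion writes the determinant through sums and products of coefficients;
collecting terms in its derivative gives Jacobi's formula. -/
lemma coef_det (hg : B.MemG g) : ∃ d' : Fin 3 → E3 → ℝ, B.Coef (fun x => (g x).det) d' 1 ∧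
    ∀ i x, d' i x = ∑ a, ∑ b, (g x).adjugate a b * B.wd i (fun y => g y b a) x := by
  have c := hg.coef
  have h := ((((((c 0 0).mul (c 1 1)).mul (c 2 2)).sub (((c 0 0).mul (c 1 2)).mul (c 2 1))).sub
    (((c 0 1).mul (c 1 0)).mul (c 2 2))).add (((c 0 1).mul (c 1 2)).mul (c 2 0))).add
    (((c 0 2).mul (c 1 0)).mul (c 2 1)) |>.sub (((c 0 2).mul (c 1 1)).mul (c 2 0))
  simp only [← Matrix.det_fin_three, Matrix.det_one] at h
  refine ⟨_, h, fun i x => ?_⟩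
  simp only [adjugate_cyclic, Fin.sum_univ_three]
  have e1 : (0 : Fin 3) + 1 = 1 := rfl
  have e2 : (0 : Fin 3) + 2 = 2 := rfl
  have e3 : (1 : Fin 3) + 1 = 2 := rfl
  have e4 : (1 : Fin 3) + 2 = 0 := rfl
  have e5 : (2 : Fin 3) + 1 = 0 := rfl
  have e6 : (2 : Fin 3) + 2 = 1 := rfl
  simp only [e1, e2, e3, e4, e5, e6]
  ring

/-- Cofactors are polynomials in the coefficients, and the determinant stays in a compact interval
of `(0, ∞)`, where inversion is smooth. -/
lemma coef_inv (hg : B.MemG g) (k l : Fin 3) : B.Coef (fun x => (g x)⁻¹ k l)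
    (fun m => B.wd m fun x => (g x)⁻¹ k l) ((1 : Matrix (Fin 3) (Fin 3) ℝ) k l) := by
  obtain ⟨d', hd, -⟩ := hg.coef_det
  obtain ⟨m, hm, hm1, hmd⟩ := hg.exists_det_bound
  obtain ⟨C, hC⟩ := hd.bdd
  have h1 := hd.comp (F := fun y => y⁻¹) (Ω := Set.Ioi 0) (a := m) (b := max C 1) isOpen_Ioi
    (fun y hy => (contDiffAt_inv ℝ (ne_of_gt hy)).contDiffWithinAt)
    (fun y hy => lt_of_lt_of_le hm hy.1) (by
      filter_upwards [hC, hmd] with x h1 h2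
      exact ⟨h2, ((le_abs_self _).trans h1).trans (le_max_left _ _)⟩) ⟨hm1, le_max_right _ _⟩
  have c := hg.coef
  have h2 := h1.mul (((c (l + 1) (k + 1)).mul (c (l + 2) (k + 2))).sub
    ((c (l + 1) (k + 2)).mul (c (l + 2) (k + 1))))
  simp only [← adjugate_cyclic, ← inv_apply_eq] at h2
  rw [Matrix.adjugate_one, inv_one, one_mul] at h2
  exact h2.congr .rfl fun i => (h2.wd_eq i).symm

lemma coef_sqrtDet (hg : B.MemG g) : B.Coef (sqrtDet g) (fun m => B.wd m (sqrtDet g)) 1 := by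
  obtain ⟨d', hd, -⟩ := hg.coef_det
  obtain ⟨m, hm, hm1, hmd⟩ := hg.exists_det_bound
  obtain ⟨C, hC⟩ := hd.bdd
  have h1 := hd.comp (F := Real.sqrt) (Ω := Set.Ioi 0) (a := m) (b := max C 1) isOpen_Ioi
    (fun y hy => (Real.contDiffAt_sqrt (ne_of_gt hy)).contDiffWithinAt)
    (fun y hy => lt_of_lt_of_le hm hy.1) (by
      filter_upwards [hC, hmd] with x h1 h2
      exact ⟨h2, ((le_abs_self _).trans h1).trans (le_max_left _ _)⟩) ⟨hm1, le_max_right _ _⟩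
  rw [Real.sqrt_one] at h1
  exact h1.congr .rfl fun i => (h1.wd_eq i).symm

lemma sqrtDet_pos (hg : B.MemG g) {x : E3} (hx : x ∈ B.U) : 0 < sqrtDet g x :=
  Real.sqrt_pos.2 (hg.det_pos hx)

lemma exists_inv_sqrtDet_bound (hg : B.MemG g) :
    ∃ C, ∀ᵐ x ∂B.vol, |(sqrtDet g x)⁻¹| ≤ C := by
  obtain ⟨m, hm, hm1, hmd⟩ := hg.exists_det_bound
  refine ⟨(Real.sqrt m)⁻¹, ?_⟩
  filter_upwards [hmd, B.ae_mem_U] with x hx hU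
  rw [abs_of_pos (inv_pos.2 (hg.sqrtDet_pos hU))]
  exact inv_anti₀ (Real.sqrt_pos.2 hm) (Real.sqrt_le_sqrt hx)

lemma inv_symm (hg : B.MemG g) {x : E3} (hx : x ∈ B.U) (i j : Fin 3) :
    (g x)⁻¹ i j = (g x)⁻¹ j i := by
  have h : (g x).IsSymm := by
    ext a b
    exact hg.symm hx b a
  exact (h.inv.apply i j).symm

lemma wd_symm (hg : B.MemG g) (m i j : Fin 3) :
    B.wd m (fun x => g x i j) =ᵐ[B.vol] B.wd m fun x => g x j i :=
  wd_congr (by filter_upwards [B.ae_mem_U] with x hx using hg.symm hx i j)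

/-- The derivative of the inverse metric. -/
lemma wd_inv (hg : B.MemG g) (m k c : Fin 3) :
    B.wd m (fun x => (g x)⁻¹ k c) =ᵐ[B.vol] fun x =>
      - ∑ a, ∑ b, (g x)⁻¹ k a * B.wd m (fun y => g y a b) x * (g x)⁻¹ b c := by
  -- The derivative of `g g⁻¹ = 1`, to be multiplied by `g⁻¹` from the left.
  have h1 : ∀ a, ∀ᵐ x ∂B.vol, ∑ b, (B.wd m (fun y => g y a b) x * (g x)⁻¹ b c +
      g x a b * B.wd m (fun y => (g y)⁻¹ b c) x) = 0 := by
    intro a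
    have h2 := Coef.sum (s := Finset.univ) fun b _ => (hg.coef a b).mul (hg.coef_inv b c)
    have h3 : (fun x => ∑ b, g x a b * (g x)⁻¹ b c) =ᵐ[B.vol]
        fun _ => (1 : Matrix (Fin 3) (Fin 3) ℝ) a c := by
      filter_upwards [B.ae_mem_U] with x hx
      have := Matrix.mul_nonsing_inv (g x) (isUnit_iff_ne_zero.2 (hg.det_pos hx).ne')
      rw [← this, Matrix.mul_apply]
    have h4 := (h2.hasWeakPartial m).congr h3 .rfl
    exact h4.unique ((Coef.const _).hasWeakPartial m)
  filter_upwards [ae_all_iff.2 h1, B.ae_mem_U] with x hx hU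
  have hinv := Matrix.nonsing_inv_mul (g x) (isUnit_iff_ne_zero.2 (hg.det_pos hU).ne')
  have h5 : ∑ a, (g x)⁻¹ k a * ∑ b, (B.wd m (fun y => g y a b) x * (g x)⁻¹ b c +
      g x a b * B.wd m (fun y => (g y)⁻¹ b c) x) = 0 := by
    simp only [hx, mul_zero, Finset.sum_const_zero]
  have h6 : ∑ a, (g x)⁻¹ k a * ∑ b, g x a b * B.wd m (fun y => (g y)⁻¹ b c) x =
      B.wd m (fun y => (g y)⁻¹ k c) x := by
    simp_rw [Finset.mul_sum]
    rw [Finset.sum_comm]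
    have e : ∀ b, ∑ a, (g x)⁻¹ k a * (g x a b * B.wd m (fun y => (g y)⁻¹ b c) x) =
        (1 : Matrix (Fin 3) (Fin 3) ℝ) k b * B.wd m (fun y => (g y)⁻¹ b c) x := by
      intro b
      rw [← hinv, Matrix.mul_apply, Finset.sum_mul]
      exact Finset.sum_congr rfl fun a _ => by ring
    simp_rw [e, Matrix.one_apply, ite_mul, one_mul, zero_mul]
    simp
  simp_rw [Finset.sum_add_distrib, mul_add, Finset.sum_add_distrib] at h5
  rw [h6] at h5
  have h7 : ∑ a, (g x)⁻¹ k a * ∑ b, B.wd m (fun y => g y a b) x * (g x)⁻¹ b c =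
      ∑ a, ∑ b, (g x)⁻¹ k a * B.wd m (fun y => g y a b) x * (g x)⁻¹ b c := by
    simp_rw [Finset.mul_sum, mul_assoc]
  linarith

/-- The derivative of the volume density. -/
lemma wd_sqrtDet (hg : B.MemG g) (m : Fin 3) :
    B.wd m (sqrtDet g) =ᵐ[B.vol] fun x =>
      1 / 2 * sqrtDet g x * ∑ a, ∑ b, (g x)⁻¹ a b * B.wd m (fun y => g y b a) x := by
  obtain ⟨d', hd, hd'⟩ := hg.coef_det
  -- Differentiating `√g √g = det g` and comparing with Jacobi's formula avoids the explicit
  -- derivative of the square root.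
  have h1 := (hg.coef_sqrtDet.mul hg.coef_sqrtDet).hasWeakPartial m
  have h2 : (fun x => sqrtDet g x * sqrtDet g x) =ᵐ[B.vol] fun x => (g x).det := by
    filter_upwards [B.ae_mem_U] with x hx
    exact Real.mul_self_sqrt (hg.det_pos hx).le
  filter_upwards [(h1.congr h2 .rfl).unique (hd.hasWeakPartial m), h2, B.ae_mem_U] with x h3 h4 hU
  have hs := hg.sqrtDet_pos hU
  have h5 : d' m x = (g x).det * ∑ a, ∑ b, (g x)⁻¹ a b * B.wd m (fun y => g y b a) x := by
    rw [hd']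
    simp_rw [inv_apply_eq, Finset.mul_sum]
    refine Finset.sum_congr rfl fun a _ => Finset.sum_congr rfl fun b _ => ?_
    have := (hg.det_pos hU).ne'
    field_simp
  rw [h5, ← h4] at h3
  have h6 : sqrtDet g x * (2 * B.wd m (sqrtDet g) x) = sqrtDet g x * (sqrtDet g x *
      ∑ a, ∑ b, (g x)⁻¹ a b * B.wd m (fun y => g y b a) x) := by linarith
  have h7 := mul_left_cancel₀ hs.ne' h6
  linarith

end MemG

end Background

/-! ### The Laplacian in divergence form and the flux of the gradient. -/

/-- The algebra behind `∂_j (√g g^{jk}) = -√g g^{ij} Γ^k_{ij}`, divided by `√g`: `G` stands for the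
inverse metric and `P m a b` for `∂_m g_{ab}`. -/
lemma contracted_christoffel_identity {G : Matrix (Fin 3) (Fin 3) ℝ}
    {P : Fin 3 → Fin 3 → Fin 3 → ℝ} (hG : ∀ i j, G i j = G j i)
    (hP : ∀ m a b, P m a b = P m b a) (k : Fin 3) :
    ∑ j, (1 / 2 * (∑ a, ∑ b, G a b * P j b a) * G j k - ∑ a, ∑ b, G j a * P j a b * G b k) =
      - ∑ i, ∑ j, G i j * (1 / 2 * ∑ l, G k l * (P i j l + P j i l - P l i j)) := by
  simp only [Fin.sum_univ_three]
  rw [hG 0 k, hG 1 k, hG 2 k]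
  simp only [hG 1 0, hG 2 0, hG 2 1, hP _ 1 0, hP _ 2 0, hP _ 2 1]
  ring

namespace Background

variable {B : Background} {g : Field2}

/-- Here `θ` need not vanish on `Σ`, and yet no boundary term appears: for the approximants `ψ n` of
`φ`, supported in the interior, `θ ∂_k ψ n` is an admissible test function for the weak derivative
of `c`, and the identity passes to the limit. -/
lemma Coef.integral_mul_wd {c φ : E3 → ℝ} {c' : Fin 3 → E3 → ℝ} {c₀ : ℝ} {ψ : ℕ → E3 → ℝ}
    (hc : B.Coef c c' c₀) (hφ : B.H2Approx φ ψ) (j k : Fin 3) {θ : E3 → ℝ}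
    (hθ : ContDiff ℝ ∞ θ) (hθc : HasCompactSupport θ) :
    Integrable (fun x => c x * B.wd k φ x * partialD j θ x) B.vol ∧
    Integrable (fun x => (c' j x * B.wd k φ x + c x * B.wd j (B.wd k φ) x) * θ x) B.vol ∧
    ∫ x in B.U, c x * B.wd k φ x * partialD j θ x =
      - ∫ x in B.U, (c' j x * B.wd k φ x + c x * B.wd j (B.wd k φ) x) * θ x := by
  obtain ⟨C, hC⟩ := hc.bdd
  have hθ' := contDiff_partialD hθ j
  have hθ'c : HasCompactSupport (partialD j θ) :=
    hθc.mono' ((subset_tsupport _).trans (tsupport_partialD_subset θ j))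
  obtain ⟨D, hD⟩ := hθc.exists_bound_of_continuous hθ.continuous
  have a1 : B.L2w 0 (fun x => c x * partialD j θ x) :=
    (L2w.of_continuous hθ'.continuous hθ'c).bdd_mul hc.aesm hC
  have a2 : B.L2w 0 (fun x => θ x * c' j x) :=
    (hc.deriv j).bdd_mul (C := D) hθ.continuous.aestronglyMeasurable (Eventually.of_forall hD)
  have a3 : B.L2w (-1) (fun x => c x * θ x) :=
    (L2w.of_continuous hθ.continuous hθc).bdd_mul hc.aesm hC
  have t1 := (hφ.lim₁ k).integral_mul (Eventually.of_forall fun n => L2w.of_test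
    (partialD_mem_testFunctions (hφ.test n) k)) (hφ.mem₁ k) (by simpa using a1)
  have t2 := (hφ.lim₁ k).integral_mul (Eventually.of_forall fun n => L2w.of_test
    (partialD_mem_testFunctions (hφ.test n) k)) (hφ.mem₁ k) (by simpa using a2)
  have t3 := (hφ.lim₂ j k).integral_mul (Eventually.of_forall fun n => L2w.of_test
    (partialD_mem_testFunctions (partialD_mem_testFunctions (hφ.test n) k) j)) (hφ.mem₂ j k) a3
  have i1 := (hφ.mem₁ k).integrable_mul₀ a1
  have i2 := (hφ.mem₁ k).integrable_mul₀ a2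
  have i3 := (hφ.mem₂ j k).integrable_mul a3
  refine ⟨i1.congr (Eventually.of_forall fun x => by ring),
    (i2.add i3).congr (Eventually.of_forall fun x => ?_), ?_⟩
  · simp only [Pi.add_apply]
    ring
  have e1 : ∀ n, ∫ x in B.U, partialD k (ψ n) x * (c x * partialD j θ x) =
      -((∫ x in B.U, partialD k (ψ n) x * (θ x * c' j x)) +
        ∫ x in B.U, partialD j (partialD k (ψ n)) x * (c x * θ x)) := by
    intro n
    have hψk := partialD_mem_testFunctions (hφ.test n) k
    have hψjk := partialD_mem_testFunctions hψk j
    have hT := mul_mem_testFunctions hθ.contDiffOn hψk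
    have h1 := (hc.hasWeakPartial j).2.2 _ hT
    have b1 := (L2w.of_test (s := 0) hψk).integrable_mul₀ a1
    have b3 := (L2w.of_test (s := 1) hψjk).integrable_mul a3
    have e2 : ∫ x in B.U, c x * partialD j (fun x => θ x * partialD k (ψ n) x) x =
        (∫ x in B.U, partialD k (ψ n) x * (c x * partialD j θ x)) +
        ∫ x in B.U, partialD j (partialD k (ψ n)) x * (c x * θ x) := by
      rw [← integral_add b1 b3]
      refine integral_congr_ae (Eventually.of_forall fun x => ?_)
      simp only [partialD_mul_test hθ.contDiffOn hψk]
      ring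
    have e3 : ∫ x in B.U, c' j x * (θ x * partialD k (ψ n) x) =
        ∫ x in B.U, partialD k (ψ n) x * (θ x * c' j x) :=
      integral_congr_ae (Eventually.of_forall fun x => by ring)
    rw [e2, e3] at h1
    linarith
  have h := tendsto_nhds_unique t1 ((t2.add t3).neg.congr fun n => (e1 n).symm)
  have e4 : ∫ x in B.U, c x * B.wd k φ x * partialD j θ x =
      ∫ x in B.U, B.wd k φ x * (c x * partialD j θ x) :=
    integral_congr_ae (Eventually.of_forall fun x => by ring)
  rw [e4, h, ← integral_add i2 i3]
  congr 1
  exact integral_congr_ae (Eventually.of_forall fun x => by ring)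

namespace MemG

lemma coef_density (hg : B.MemG g) (j k : Fin 3) :
    B.Coef (fun x => sqrtDet g x * (g x)⁻¹ j k)
      (fun m x => B.wd m (sqrtDet g) x * (g x)⁻¹ j k +
        sqrtDet g x * B.wd m (fun y => (g y)⁻¹ j k) x) ((1 : Matrix (Fin 3) (Fin 3) ℝ) j k) := by
  simpa using hg.coef_sqrtDet.mul (hg.coef_inv j k)

/-- The Laplacian in divergence form. -/
lemma laplacian_eq_div (hg : B.MemG g) (φ : E3 → ℝ) : ∀ᵐ x ∂B.vol,
    ∑ j, ∑ k, ((B.wd j (sqrtDet g) x * (g x)⁻¹ j k +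
        sqrtDet g x * B.wd j (fun y => (g y)⁻¹ j k) x) * B.wd k φ x +
      sqrtDet g x * (g x)⁻¹ j k * B.wd j (B.wd k φ) x) = sqrtDet g x * B.laplacian g φ x := by
  have w1 := ae_all_iff.2 fun m => hg.wd_sqrtDet m
  have w2 := ae_all_iff.2 fun m => ae_all_iff.2 fun k => ae_all_iff.2 fun c => hg.wd_inv m k c
  have w3 := ae_all_iff.2 fun m => ae_all_iff.2 fun i => ae_all_iff.2 fun j => hg.wd_symm m i j
  filter_upwards [w1, w2, w3, B.ae_mem_U] with x h1 h2 h3 hU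
  have key : ∀ k, ∑ j, (B.wd j (sqrtDet g) x * (g x)⁻¹ j k +
        sqrtDet g x * B.wd j (fun y => (g y)⁻¹ j k) x) =
      - (sqrtDet g x * ∑ i, ∑ j, (g x)⁻¹ i j * B.christoffel g k i j x) := by
    intro k
    have h4 := contracted_christoffel_identity (G := (g x)⁻¹)
      (P := fun m a b => B.wd m (fun y => g y a b) x) (fun i j => hg.inv_symm hU i j)
      (fun m a b => h3 m a b) k
    have h5 := congrArg (fun t => sqrtDet g x * t) h4
    simp only [mul_neg] at h5
    simp only [christoffel]
    rw [← h5, Finset.mul_sum]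
    refine Finset.sum_congr rfl fun j _ => ?_
    rw [h1 j, h2 j j k]
    ring
  have e1 : ∀ j, ∑ k, ((B.wd j (sqrtDet g) x * (g x)⁻¹ j k +
        sqrtDet g x * B.wd j (fun y => (g y)⁻¹ j k) x) * B.wd k φ x +
      sqrtDet g x * (g x)⁻¹ j k * B.wd j (B.wd k φ) x) =
      (∑ k, (B.wd j (sqrtDet g) x * (g x)⁻¹ j k +
        sqrtDet g x * B.wd j (fun y => (g y)⁻¹ j k) x) * B.wd k φ x) +
      ∑ k, sqrtDet g x * (g x)⁻¹ j k * B.wd j (B.wd k φ) x := fun j => Finset.sum_add_distrib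
  simp_rw [e1]
  rw [Finset.sum_add_distrib, Finset.sum_comm]
  simp_rw [← Finset.sum_mul, key, laplacian, mul_sub, Finset.sum_sub_distrib, mul_sub]
  have e2 : ∑ i, ∑ j, (g x)⁻¹ i j * ∑ k, B.christoffel g k i j x * B.wd k φ x =
      ∑ k, (∑ i, ∑ j, (g x)⁻¹ i j * B.christoffel g k i j x) * B.wd k φ x := by
    simp_rw [Finset.mul_sum, Finset.sum_mul]
    have e3 : ∀ i, ∑ j, ∑ k, (g x)⁻¹ i j * (B.christoffel g k i j x * B.wd k φ x) =
        ∑ k, ∑ j, (g x)⁻¹ i j * (B.christoffel g k i j x * B.wd k φ x) := fun i =>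
      Finset.sum_comm
    simp_rw [e3]
    rw [Finset.sum_comm]
    simp_rw [mul_assoc]
  have e3 : ∑ j, ∑ k, sqrtDet g x * (g x)⁻¹ j k * B.wd j (B.wd k φ) x =
      sqrtDet g x * ∑ j, ∑ k, (g x)⁻¹ j k * B.wd j (B.wd k φ) x := by
    simp_rw [Finset.mul_sum, mul_assoc]
  have e4 : ∑ k, -(sqrtDet g x * ∑ i, ∑ j, (g x)⁻¹ i j * B.christoffel g k i j x) * B.wd k φ x =
      -(sqrtDet g x *
        ∑ k, (∑ i, ∑ j, (g x)⁻¹ i j * B.christoffel g k i j x) * B.wd k φ x) := by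
    rw [Finset.mul_sum, ← Finset.sum_neg_distrib]
    exact Finset.sum_congr rfl fun k _ => by ring
  rw [e2, e3, e4]
  ring

/-- The divergence theorem without a term on `Σ`. Integrability of `√g Δφ` must be assumed: that `r
∂²φ` is square integrable does not imply it. -/
lemma hasFlux_gradient (hg : B.MemG g) {φ : E3 → ℝ} {ψ : ℕ → E3 → ℝ} (hφ : B.H2Approx φ ψ)
    (hint : Integrable (fun x => sqrtDet g x * B.laplacian g φ x) B.vol) :
    HasFlux (fun j x => ∑ k, sqrtDet g x * (g x)⁻¹ j k * B.wd k φ x)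
      (∫ x in B.U, sqrtDet g x * B.laplacian g φ x) := by
  refine hasFlux_of_div_boundary (fun j => L2w.sum fun k _ => ?_) hint fun θ hθ hθc => ?_
  · obtain ⟨C, hC⟩ := (hg.coef_density j k).bdd
    exact (hφ.mem₁ k).bdd_mul (hg.coef_density j k).aesm hC
  · have h := fun j k => (hg.coef_density j k).integral_mul_wd hφ j k hθ hθc
    have e1 : ∫ x in B.U, ∑ j, (∑ k, sqrtDet g x * (g x)⁻¹ j k * B.wd k φ x) * partialD j θ x =
        ∑ j, ∑ k, ∫ x in B.U, sqrtDet g x * (g x)⁻¹ j k * B.wd k φ x * partialD j θ x := by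
      simp_rw [Finset.sum_mul]
      rw [integral_finsetSum _ fun j _ => integrable_finsetSum _ fun k _ => (h j k).1]
      exact Finset.sum_congr rfl fun j _ => integral_finsetSum _ fun k _ => (h j k).1
    rw [e1]
    simp_rw [fun j k => (h j k).2.2, Finset.sum_neg_distrib]
    congr 1
    have e2 : ∀ j, ∑ k, ∫ x in B.U, ((B.wd j (sqrtDet g) x * (g x)⁻¹ j k +
        sqrtDet g x * B.wd j (fun y => (g y)⁻¹ j k) x) * B.wd k φ x +
        sqrtDet g x * (g x)⁻¹ j k * B.wd j (B.wd k φ) x) * θ x =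
        ∫ x in B.U, ∑ k, ((B.wd j (sqrtDet g) x * (g x)⁻¹ j k +
        sqrtDet g x * B.wd j (fun y => (g y)⁻¹ j k) x) * B.wd k φ x +
        sqrtDet g x * (g x)⁻¹ j k * B.wd j (B.wd k φ) x) * θ x := fun j =>
      (integral_finsetSum _ fun k _ => (h j k).2.1).symm
    simp_rw [e2]
    rw [← integral_finsetSum _ fun j _ => integrable_finsetSum _ fun k _ => (h j k).2.1]
    refine integral_congr_ae ?_
    filter_upwards [hg.laplacian_eq_div φ] with x hx
    rw [← hx]
    simp_rw [Finset.sum_mul]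

end MemG

end Background

/-! ### The energy flux field and the scalar curvature. -/

namespace Background

/-- The vector field `∂_i g_{ij} - ∂_j g_{ii}` whose flux through infinity is the energy. -/
noncomputable def energyFlux (B : Background) (g : Field2) (j : Fin 3) : E3 → ℝ := fun x =>
  ∑ i, (B.wd i (fun y => g y i j) x - B.wd j (fun y => g y i i) x)

variable {B : Background} {g : Field2}

namespace MemG

lemma L2w_wd (hg : B.MemG g) (m i j : Fin 3) : B.L2w 0 (B.wd m fun x => g x i j) :=
  (hg.coef i j).deriv m

lemma weak₂ (hg : B.MemG g) (n m i j : Fin 3) : B.HasWeakPartial n (B.wd m fun x => g x i j)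
    (B.wd n (B.wd m fun x => g x i j)) :=
  (hg.coef₂ i j).weak₂ n m

lemma mem₂ (hg : B.MemG g) (n m i j : Fin 3) :
    B.L2w 1 (B.wd n (B.wd m fun x => g x i j)) :=
  (hg.coef₂ i j).mem₂ n m

lemma L2w_christoffel (hg : B.MemG g) (k i j : Fin 3) : B.L2w 0 (B.christoffel g k i j) := by
  refine (L2w.sum fun l _ => ?_).const_mul (1 / 2)
  obtain ⟨C, hC⟩ := (hg.coef_inv k l).bdd
  exact (((hg.L2w_wd i j l).add (hg.L2w_wd j i l)).sub (hg.L2w_wd l i j)).bdd_mul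
    (hg.coef_inv k l).aesm hC

lemma wd_christoffel (hg : B.MemG g) (m k i j : Fin 3) :
    B.wd m (B.christoffel g k i j) =ᵐ[B.vol] fun x => 1 / 2 * ∑ l,
      (B.wd m (fun y => (g y)⁻¹ k l) x * (B.wd i (fun y => g y j l) x +
        B.wd j (fun y => g y i l) x - B.wd l (fun y => g y i j) x) +
      (g x)⁻¹ k l * (B.wd m (B.wd i fun y => g y j l) x + B.wd m (B.wd j fun y => g y i l) x -
        B.wd m (B.wd l fun y => g y i j) x)) := by
  refine (HasWeakPartial.const_mul (HasWeakPartial.sum fun l _ => ?_) _).wd_eq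
  exact (hg.coef_inv k l).hasWeakPartial_mul
    (((hg.weak₂ m i j l).add (hg.weak₂ m j i l)).sub (hg.weak₂ m l i j))
    (((hg.L2w_wd i j l).add (hg.L2w_wd j i l)).sub (hg.L2w_wd l i j))

lemma integrable_density_mul (hg : B.MemG g) {f : E3 → ℝ} (hf : Integrable f B.vol)
    (i j : Fin 3) : Integrable (fun x => sqrtDet g x * (g x)⁻¹ i j * f x) B.vol := by
  obtain ⟨C, hC⟩ := (hg.coef_density i j).bdd
  exact hf.bdd_mul (hg.coef_density i j).aesm hC

/-- The divergence of the energy flux field differs from `R √g` by an integrable function. -/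
lemma integrable_div_energyFlux (hg : B.MemG g)
    (hR : IntegrableOn (fun x => B.scalarCurvature g x * sqrtDet g x) B.U) :
    Integrable (fun x => ∑ j, ∑ i, (B.wd j (B.wd i fun y => g y i j) x -
      B.wd j (B.wd j fun y => g y i i) x)) B.vol := by
  set T : Fin 3 → Fin 3 → Fin 3 → Fin 3 → E3 → ℝ := fun m i a b =>
    B.wd m (B.wd i fun y => g y a b) with hT
  set b : Fin 3 → Fin 3 → Fin 3 → E3 → ℝ := fun i j l x => B.wd i (fun y => g y j l) x +
        B.wd j (fun y => g y i l) x - B.wd l (fun y => g y i j) x with hb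
  -- The curvature is split as `R √g = ∑ √g g^{ij} g^{kl} A_{ijkl} + ∑ √g g^{ij} C_{ijk}`, with `A`
  -- linear in second derivatives of `g` and `C` quadratic in first derivatives of the metric and
  -- its inverse.
  set A : Fin 3 → Fin 3 → Fin 3 → Fin 3 → E3 → ℝ := fun i j k l x =>
    1 / 2 * ((T k i j l x + T k j i l x - T k l i j x) -
      (T j i k l x + T j k i l x - T j l i k x)) with hA
  set C : Fin 3 → Fin 3 → Fin 3 → E3 → ℝ := fun i j k x => ∑ l,
    (1 / 2 * (B.wd k (fun y => (g y)⁻¹ k l) x * b i j l x) -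
      1 / 2 * (B.wd j (fun y => (g y)⁻¹ k l) x * b i k l x) +
      (B.christoffel g k k l x * B.christoffel g l i j x -
        B.christoffel g k j l x * B.christoffel g l i k x)) with hC
  have hbL : ∀ i j l, B.L2w 0 (b i j l) := fun i j l =>
    ((hg.L2w_wd i j l).add (hg.L2w_wd j i l)).sub (hg.L2w_wd l i j)
  have hAL : ∀ i j k l, B.L2w 1 (A i j k l) := fun i j k l =>
    ((((hg.mem₂ k i j l).add (hg.mem₂ k j i l)).sub (hg.mem₂ k l i j)).sub
      (((hg.mem₂ j i k l).add (hg.mem₂ j k i l)).sub (hg.mem₂ j l i k))).const_mul _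
  have hCI : ∀ i j k, Integrable (C i j k) B.vol := by
    intro i j k
    refine integrable_finsetSum _ fun l _ => ?_
    exact (((((hg.coef_inv k l).deriv k).integrable_mul₀ (hbL i j l)).const_mul _).sub
      ((((hg.coef_inv k l).deriv j).integrable_mul₀ (hbL i k l)).const_mul _)).add
      (((hg.L2w_christoffel k k l).integrable_mul₀ (hg.L2w_christoffel l i j)).sub
      ((hg.L2w_christoffel k j l).integrable_mul₀ (hg.L2w_christoffel l i k)))
  -- Replacing the coefficient of `A` by its Euclidean limit costs an integrable error: the
  -- difference has weight -1 and `A` has weight 1.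
  have hX : Integrable (fun x => ∑ i, ∑ j, ∑ k, ∑ l, (sqrtDet g x * (g x)⁻¹ i j * (g x)⁻¹ k l -
      (1 : Matrix (Fin 3) (Fin 3) ℝ) i j * (1 : Matrix (Fin 3) (Fin 3) ℝ) k l) * A i j k l x)
      B.vol := by
    refine integrable_finsetSum _ fun i _ => integrable_finsetSum _ fun j _ =>
      integrable_finsetSum _ fun k _ => integrable_finsetSum _ fun l _ => ?_
    exact ((hg.coef_density i j).mul (hg.coef_inv k l)).decay.integrable_mul
      (by simpa using hAL i j k l)
  have hY : Integrable (fun x => ∑ i, ∑ j, ∑ k, sqrtDet g x * (g x)⁻¹ i j * C i j k x)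
      B.vol := by
    refine integrable_finsetSum _ fun i _ => integrable_finsetSum _ fun j _ =>
      integrable_finsetSum _ fun k _ => ?_
    exact hg.integrable_density_mul (hCI i j k) i j
  refine ((Integrable.sub hR hX).sub hY).congr ?_
  have w := ae_all_iff.2 fun m => ae_all_iff.2 fun k => ae_all_iff.2 fun i =>
    ae_all_iff.2 fun j => hg.wd_christoffel m k i j
  filter_upwards [w] with x hx
  have e1 : ∀ i j k, B.wd k (B.christoffel g k i j) x - B.wd j (B.christoffel g k i k) x +
      ∑ l, (B.christoffel g k k l x * B.christoffel g l i j x -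
        B.christoffel g k j l x * B.christoffel g l i k x) =
      (∑ l, (g x)⁻¹ k l * A i j k l x) + C i j k x := by
    intro i j k
    rw [hx k k i j, hx j k i k, hC]
    simp only [hA, hb, hT]
    rw [Finset.mul_sum, Finset.mul_sum, ← Finset.sum_sub_distrib, ← Finset.sum_add_distrib,
      ← Finset.sum_add_distrib]
    exact Finset.sum_congr rfl fun l _ => by ring
  have e2 : B.scalarCurvature g x * sqrtDet g x =
      (∑ i, ∑ j, ∑ k, ∑ l, sqrtDet g x * (g x)⁻¹ i j * (g x)⁻¹ k l * A i j k l x) +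
      ∑ i, ∑ j, ∑ k, sqrtDet g x * (g x)⁻¹ i j * C i j k x := by
    simp only [scalarCurvature, e1]
    simp_rw [← Finset.sum_add_distrib, Finset.sum_mul, Finset.mul_sum, Finset.sum_mul]
    refine Finset.sum_congr rfl fun i _ => Finset.sum_congr rfl fun j _ =>
      Finset.sum_congr rfl fun k _ => ?_
    rw [mul_add, add_mul, Finset.mul_sum, Finset.sum_mul]
    congr 1
    · exact Finset.sum_congr rfl fun l _ => by ring
    · ring
  -- With Euclidean coefficients the second order part is exactly the divergence of the energy
  -- field. Relabelling of indices suffices; derivatives need not be commuted.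
  have e3 : ∑ j, ∑ i, (T j i i j x - T j j i i x) = ∑ i, ∑ j, ∑ k, ∑ l,
      (1 : Matrix (Fin 3) (Fin 3) ℝ) i j * (1 : Matrix (Fin 3) (Fin 3) ℝ) k l * A i j k l x := by
    simp only [hA, Matrix.one_apply, ite_mul, mul_ite, one_mul, mul_one, zero_mul, mul_zero,
      Finset.sum_ite_eq, Finset.mem_univ, if_true, Finset.sum_ite_irrel, Finset.sum_const_zero]
    simp only [Fin.sum_univ_three]
    ring
  simp only [Pi.sub_apply]
  rw [e2]
  change _ = ∑ j, ∑ i, (T j i i j x - T j j i i x)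
  rw [e3]
  simp_rw [sub_mul, Finset.sum_sub_distrib]
  ring

/-- If `R √g` is integrable, the energy exists. -/
lemma exists_hasFlux_energyFlux (hg : B.MemG g)
    (hR : IntegrableOn (fun x => B.scalarCurvature g x * sqrtDet g x) B.U) :
    ∃ L, HasFlux (B.energyFlux g) L := by
  have hV : ∀ j, B.L2w 0 (B.energyFlux g j) := fun j =>
    L2w.sum fun i _ => (hg.L2w_wd i i j).sub (hg.L2w_wd j i i)
  have hW : ∀ j, B.HasWeakPartial j (B.energyFlux g j) fun x => ∑ i,
      (B.wd j (B.wd i fun y => g y i j) x - B.wd j (B.wd j fun y => g y i i) x) := fun j =>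
    HasWeakPartial.sum fun i _ => (hg.weak₂ j i i j).sub (hg.weak₂ j j i i)
  refine exists_hasFlux hV (IntegrableOn.mono_set
    (hg.integrable_div_energyFlux hR) fun x hx => B.mem_U_of_one_lt hx) fun ψ hψ => ?_
  have e1 : ∀ j, ∫ x in B.U, B.energyFlux g j x * partialD j ψ x =
      - ∫ x in B.U, (∑ i, (B.wd j (B.wd i fun y => g y i j) x -
        B.wd j (B.wd j fun y => g y i i) x)) * ψ x := fun j => (hW j).2.2 ψ hψ
  rw [integral_finsetSum _ fun j _ =>
    (hW j).1.integrable_mul_test (partialD_mem_testFunctions hψ j)]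
  simp_rw [e1, Finset.sum_neg_distrib]
  rw [← integral_finsetSum _ fun j _ => (hW j).2.1.integrable_mul_test hψ]
  simp_rw [← Finset.sum_mul]

end MemG

end Background

/-! ### The conformal change of the energy, and integrability of the integrand. -/

namespace Background

variable {B : Background} {g : Field2}

/-- The flux through infinity of a field whose components are products of a coefficient tending to
zero and a square integrable function vanishes. -/
lemma hasFlux_zero_of_coef {c b b' : Fin 3 → E3 → ℝ} {c' : Fin 3 → Fin 3 → E3 → ℝ}
    (hc : ∀ j, B.Coef (c j) (c' j) 0) (hb : ∀ j, B.L2w 0 (b j))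
    (hbw : ∀ j, B.HasWeakPartial j (b j) (b' j)) (hb' : ∀ j, B.L2w 1 (b' j)) :
    HasFlux (fun j x => c j x * b j x) 0 := by
  have h := HasFlux.sum (s := Finset.univ) fun j₀ _ =>
    (hc j₀).hasFlux_zero j₀ (hb j₀) (hbw j₀) (hb' j₀)
  simpa using h

lemma Coef.sub_limit {c : E3 → ℝ} {c' : Fin 3 → E3 → ℝ} {c₀ : ℝ} (hc : B.Coef c c' c₀) :
    B.Coef (fun x => c x - c₀) c' 0 := by
  simpa using hc.sub (Coef.const c₀)

lemma ae_of_one_lt_norm {p : E3 → Prop} (h : ∀ᵐ x ∂B.vol, p x) : ∀ᵐ x : E3, 1 < ‖x‖ → p x := by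
  rw [ae_restrict_iff' B.measurableSet_U] at h
  exact h.mono fun x hx h1 => hx (B.mem_U_of_one_lt h1)

lemma hasADMEnergy_of_hasFlux {L : ℝ} (h : HasFlux (B.energyFlux g) L) :
    B.HasADMEnergy g (L / (16 * Real.pi)) := by
  have e : B.fluxDensity g = radialPart (B.energyFlux g) := by
    ext x
    simp only [fluxDensity, radialPart, energyFlux, Finset.sum_mul]
    exact Finset.sum_comm
  rw [HasADMEnergy, e, mul_div_cancel₀ L (by positivity)]
  exact h

lemma H2Approx.coef_exp {φ : E3 → ℝ} {ψ : ℕ → E3 → ℝ} (hφ : B.H2Approx φ ψ) (k : ℝ) :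
    B.Coef (fun x => Real.exp (k * φ x)) (fun i x => k * Real.exp (k * φ x) * B.wd i φ x) 1 := by
  have h := hφ.coef.comp_contDiff (F := fun y => Real.exp (k * y)) (by fun_prop)
  simp only [mul_zero, Real.exp_zero] at h
  refine h.congr .rfl fun i => Eventually.of_forall fun x => ?_
  have h1 : HasDerivAt (fun y => Real.exp (k * y)) (Real.exp (k * φ x) * (k * 1)) (φ x) :=
    ((hasDerivAt_id _).const_mul k).exp
  simp only [h1.deriv]
  ring

namespace MemG

lemma coef_conformal (hg : B.MemG g) {φ : E3 → ℝ} {ψ : ℕ → E3 → ℝ} (hφ : B.H2Approx φ ψ)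
    (i j : Fin 3) : B.Coef (fun x => conformalMetric φ g x i j)
      (fun m x => 4 * Real.exp (4 * φ x) * B.wd m φ x * g x i j +
        Real.exp (4 * φ x) * B.wd m (fun y => g y i j) x) ((1 : Matrix (Fin 3) (Fin 3) ℝ) i j) := by
  simpa [conformalMetric] using (hφ.coef_exp 4).mul (hg.coef i j)

/-- The flux of the energy of a conformal metric. -/
lemma hasFlux_conformal (hg : B.MemG g) {φ : E3 → ℝ} {ψ : ℕ → E3 → ℝ} (hφ : B.H2Approx φ ψ)
    {L D : ℝ} (hL : HasFlux (B.energyFlux g) L)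
    (hD : HasFlux (fun j x => ∑ k, sqrtDet g x * (g x)⁻¹ j k * B.wd k φ x) D) :
    HasFlux (B.energyFlux (conformalMetric φ g)) (L - 8 * D) := by
  have hE := (hφ.coef_exp 4).sub_limit
  have hc := fun i j => (hg.coef_conformal hφ i j).sub_limit
  have hd := fun i j => (hg.coef_density i j).sub_limit
  -- The five errors without flux. `v1` and `v2` come from replacing `e^{4φ}` by 1 in front of the
  -- derivatives of `g`, `v3` and `v4` from replacing `e^{4φ} g_{ij}` by `δ_{ij}` in front of those
  -- of `φ`, and `v5` from replacing `√g g^{jk}` by `δ^{jk}` in the gradient field. What remains is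
  -- the energy field of `g` and `(4 - 4 * 3) ∂_j φ = -8 ∂_j φ`.
  have v1 := HasFlux.sum (s := Finset.univ) fun i _ => hasFlux_zero_of_coef (fun _ => hE)
    (fun j => hg.L2w_wd i i j) (fun j => hg.weak₂ j i i j) (fun j => hg.mem₂ j i i j)
  have v2 := HasFlux.sum (s := Finset.univ) fun i _ => hasFlux_zero_of_coef (fun _ => hE)
    (fun j => hg.L2w_wd j i i) (fun j => hg.weak₂ j j i i) (fun j => hg.mem₂ j j i i)
  have v3 := HasFlux.sum (s := Finset.univ) fun i _ => hasFlux_zero_of_coef (fun j => hc i j)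
    (fun _ => hφ.mem₁ i) (fun j => hφ.weak₂ j i) (fun j => hφ.mem₂ j i)
  have v4 := HasFlux.sum (s := Finset.univ) fun i _ => hasFlux_zero_of_coef (fun _ => hc i i)
    (fun j => hφ.mem₁ j) (fun j => hφ.weak₂ j j) (fun j => hφ.mem₂ j j)
  have v5 := HasFlux.sum (s := Finset.univ) fun k _ => hasFlux_zero_of_coef (fun j => hd j k)
    (fun _ => hφ.mem₁ k) (fun j => hφ.weak₂ j k) (fun j => hφ.mem₂ j k)
  have h := (((((hL.add (hD.const_mul (-8))).add v1).add (v2.const_mul (-1))).add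
    (v3.const_mul 4)).add (v4.const_mul (-4))).add (v5.const_mul 8)
  simp only [Finset.sum_const_zero, mul_zero, add_zero, neg_mul, ← sub_eq_add_neg] at h
  refine h.congr_ae ?_
  have w := ae_all_iff.2 fun m => ae_all_iff.2 fun i => ae_all_iff.2 fun j =>
    (hg.coef_conformal hφ i j).wd_eq m
  refine (ae_of_one_lt_norm w).mono fun x hx h1 j => ?_
  have hx := hx h1
  simp only [energyFlux, hx]
  have hj : j = 0 ∨ j = 1 ∨ j = 2 := by fin_cases j <;> simp
  obtain rfl | rfl | rfl := hj <;> simp [Fin.sum_univ_three, conformalMetric] <;> ring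

lemma integrable_gradSq (hg : B.MemG g) {φ : E3 → ℝ} {ψ : ℕ → E3 → ℝ} (hφ : B.H2Approx φ ψ) :
    Integrable (fun x => B.gradSq g φ x * sqrtDet g x) B.vol := by
  have h : Integrable (fun x => ∑ i, ∑ j, sqrtDet g x * (g x)⁻¹ i j *
      (B.wd i φ x * B.wd j φ x)) B.vol :=
    integrable_finsetSum _ fun i _ => integrable_finsetSum _ fun j _ =>
      hg.integrable_density_mul ((hφ.mem₁ i).integrable_mul₀ (hφ.mem₁ j)) i j
  refine h.congr (Eventually.of_forall fun x => ?_)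
  simp only [gradSq, Finset.sum_mul]
  exact Finset.sum_congr rfl fun i _ => Finset.sum_congr rfl fun j _ => by ring

lemma integrable_momentum (hg : B.MemG g) {π : Field2} (hπ : ∀ i j, B.L2w 0 fun x => π x i j) :
    Integrable (fun x => (momentumSq g π x - 1 / 2 * momentumTrace g π x ^ 2) / sqrtDet g x)
      B.vol := by
  have hbdd : ∀ {u : E3 → ℝ}, B.L2w 0 u → ∀ i j, B.L2w 0 fun x => g x i j * u x := by
    intro u hu i j
    obtain ⟨C, hC⟩ := (hg.coef i j).bdd
    exact hu.bdd_mul (hg.coef i j).aesm hC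
  have h1 : Integrable (momentumSq g π) B.vol := by
    refine integrable_finsetSum _ fun i _ => integrable_finsetSum _ fun j _ =>
      integrable_finsetSum _ fun k _ => integrable_finsetSum _ fun l _ => ?_
    refine ((hbdd (hπ i j) i k).integrable_mul₀ (hbdd (hπ k l) j l)).congr
      (Eventually.of_forall fun x => ?_)
    ring
  have h2 : B.L2w 0 (momentumTrace g π) :=
    L2w.sum fun i _ => L2w.sum fun j _ => hbdd (hπ i j) i j
  have h3 := h1.sub ((h2.integrable_mul₀ h2).const_mul (1 / 2))
  obtain ⟨C, hC⟩ := hg.exists_inv_sqrtDet_bound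
  have hm : AEStronglyMeasurable (fun x => (sqrtDet g x)⁻¹) B.vol :=
    hg.coef_sqrtDet.aesm.aemeasurable.inv.aestronglyMeasurable
  refine (h3.bdd_mul hm hC).congr (Eventually.of_forall fun x => ?_)
  simp only [Pi.sub_apply]
  ring

end MemG

/-- For `p = 1` and `δ = -3` the weight exponent `-δ p - 3` is zero. -/
lemma MemL.integrable {ρ : E3 → ℝ} (h : B.MemL 1 (-3) ρ) : Integrable ρ B.vol := by
  refine ⟨h.1, ?_⟩
  have h2 := h.2
  have e : -(-3 : ℝ) - 3 = 0 := by norm_num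
  simp only [wNorm, Real.rpow_one, mul_one, e, Real.rpow_zero, div_one, ENNReal.rpow_one] at h2
  simpa [HasFiniteIntegral, Real.enorm_eq_ofReal_abs] using h2

lemma MemK.L2w_zero {opi π : Field2} (hopi : B.IsMomentumReference opi) (hπ : B.MemK opi π)
    (i j : Fin 3) : B.L2w 0 fun x => π x i j := by
  have h1 := MemCompletion.L2w_zero (fun ψ hψ => ⟨hψ.1.continuous, hψ.2⟩) (hopi.2.2 i j)
  have h2 := MemCompletion.L2w_zero (fun ψ hψ => ⟨hψ.1.continuous, hψ.2.1⟩) (hπ.2 i j)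
  simpa using h1.add h2

lemma MemG.integrable_energyIntegrand (hg : B.MemG g) {φ ρ : E3 → ℝ} {ψ : ℕ → E3 → ℝ} {π : Field2}
    (hφ : B.H2Approx φ ψ) (hπ : ∀ i j, B.L2w 0 fun x => π x i j) (hρ : Integrable ρ B.vol)
    (hR : IntegrableOn (fun x => B.scalarCurvature g x * sqrtDet g x) B.U) :
    Integrable (B.energyIntegrand g φ π ρ) B.vol := by
  obtain ⟨C, hC⟩ := (hφ.coef_exp (-2)).bdd
  have h1 := ((hg.integrable_gradSq hφ).const_mul 8).sub hR
  have h2 := (hρ.bdd_mul (hφ.coef_exp (-2)).aesm hC).const_mul (16 * Real.pi)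
  refine ((h1.add (hg.integrable_momentum hπ)).add h2).congr (Eventually.of_forall fun x => ?_)
  simp only [energyIntegrand, Pi.add_apply, Pi.sub_apply]
  ring

/-- Multiplied by `e^{-2φ}`, the constraint expresses the matter term through the geometry; the
curvature, gradient and momentum terms cancel and only the Laplacian survives. -/
lemma energyIntegrand_eq_of_constraint {φ ρ : E3 → ℝ} {π : Field2} {x : E3}
    (h : B.conformalHamiltonian g φ π x = 16 * Real.pi * ρ x) :
    B.energyIntegrand g φ π ρ x = -8 * (sqrtDet g x * B.laplacian g φ x) := by
  have h1 : Real.exp (-2 * φ x) * Real.exp (2 * φ x) = 1 := by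
    rw [← Real.exp_add]
    simp
  have h2 : 16 * Real.pi * Real.exp (-2 * φ x) * ρ x =
      Real.exp (-2 * φ x) * B.conformalHamiltonian g φ π x := by
    rw [h]
    ring
  rw [energyIntegrand, h2, conformalHamiltonian, ← mul_assoc, h1]
  ring

end Background

end ConformalEnergy

open ConformalEnergy in
theorem mainTheorem4 (B : Background)
    (gt : Field2) (hgt : B.MemG gt)
    (opi : Field2) (hopi : B.IsMomentumReference opi)
    (φ : E3 → ℝ) (hφ : B.MemWbar 2 2 (-1 / 2) φ)
    (π : Field2) (hπ : B.MemK opi π)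
    (ρ : E3 → ℝ) (hρ : B.MemL 1 (-3) ρ)
    (hR : IntegrableOn (fun x => B.scalarCurvature gt x * sqrtDet gt x) B.U)
    (hconstraint : ∀ᵐ x ∂volume.restrict B.U,
      B.conformalHamiltonian gt φ π x = 16 * Real.pi * ρ x) :
    ∃ E Et : ℝ,
      B.HasADMEnergy (conformalMetric φ gt) E ∧
      B.HasADMEnergy gt Et ∧
      IntegrableOn (B.energyIntegrand gt φ π ρ) B.U ∧
      16 * Real.pi * E =
        16 * Real.pi * Et + ∫ x in B.U, B.energyIntegrand gt φ π ρ x := by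
  obtain ⟨ψ, hψ⟩ := hφ.exists_H2Approx
  have hint := hgt.integrable_energyIntegrand hψ (hπ.L2w_zero hopi) hρ.integrable hR
  have heq : B.energyIntegrand gt φ π ρ =ᵐ[B.vol] fun x =>
      -8 * (sqrtDet gt x * B.laplacian gt φ x) :=
    hconstraint.mono fun x hx => Background.energyIntegrand_eq_of_constraint hx
  -- The constraint enters twice: here it makes `√g Δφ` integrable, as the flux of the gradient
  -- requires, and at the end it converts the integral of `-8 √g Δφ` into that of the integrand.
  have hlap : Integrable (fun x => sqrtDet gt x * B.laplacian gt φ x) B.vol :=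
    ((hint.congr heq).const_mul (-1 / 8)).congr (Eventually.of_forall fun x => by ring)
  obtain ⟨L, hL⟩ := hgt.exists_hasFlux_energyFlux hR
  have hflux := hgt.hasFlux_conformal hψ hL (hgt.hasFlux_gradient hψ hlap)
  refine ⟨_, _, Background.hasADMEnergy_of_hasFlux hflux, Background.hasADMEnergy_of_hasFlux hL,
    hint, ?_⟩
  rw [mul_div_cancel₀ _ (by positivity), mul_div_cancel₀ _ (by positivity), integral_congr_ae heq,
    integral_const_mul]
  ring
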